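/- **Setting.** Let $\mu_0,\mu_1$ be $\sigma$-finite Borel measures on $\mathbb R$, $\mu_Z$ a $\sigma$-finite Borel measure on $\mathbb R^k$, and $\nu_a=\mu_a\otimes\mu_Z$ for $a\in\{0,1\}$. Let $\mathbf Q$ be the family of probability distributions $Q$ of $W=(Y(0),Y(1),Z)$ on $\mathbb R^{2+k}$ that are dominated by $\mu_0\otimes\mu_1\otimes\mu_Z$ and satisfy $\mathbb E_Q[Y(a)^2]<\infty$ for $a=0,1$. Let $\mathbb S:\mathbb R^k\to\{1,\dots,\mathcal S\}$ be measurable, $\pi(s)\in(0,1)$ for each $s$, and for each $n$ let $\alpha_n(\cdot\mid \mathbf s_n)$, $\mathbf s_n\in\{1,\dots,\mathcal S\}^n$, be known probability mass functions on $\{0,1\}^n$. **Covariate-adaptive randomization (CAR).** Let $W_i=(Y_i(0),Y_i(1),Z_i)$, $i\ge 1$, be i.i.d. with law $Q_0\in\mathbf Q$, let $S_i=\mathbb S(Z_i)$, $\mathbf W_n=(W_1,\dots,W_n)$, $\mathbf S_n=(S_1,\dots,S_n)$, and let $\mathbf A_n=(A_{n1},\dots,A_{nn})\in\{0,1\}^n$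 be treatment assignments such that, for every $n$, $\mathbf W_n$ and $\mathbf A_n$ are conditionally independent given $\mathbf S_n$; $\Pr(\mathbf A_n=\mathbf a_n\mid\mathbf S_n=\mathbf s_n)=\alpha_n(\mathbf a_n\mid\mathbf s_n)$; and, for every $s$ with $Q_0(\mathbb S(Z)=s)>0$, $$\frac{\#\{i\le n: A_{ni}=1,\ S_i=s\}}{\#\{i\le n: S_i=s\}}\ \xrightarrow{\ p\ }\ \pi(s).$$ The observed data are $\mathbf X_n=(X_{n1},\dots,X_{nn})$ with $X_{ni}=(Y_{ni},A_{ni},Z_i)$ and $Y_{ni}=A_{ni}Y_i(1)+(1-A_{ni})Y_i(0)$; $P_{0,n}$ is the law of $\mathbf X_n$. **Regular parametric submodel.** Let $\Theta\subseteq\mathbb R^d$ be open and bounded. For each $\theta\in\Theta$ let $q_0(\cdot;\theta),q_1(\cdot;\theta)$ be densities, with respect to $\nu_0$ and $\nu_1$, of the laws of $(Y(0),Z)$ and $(Y(1),Z)$ under a common distribution in $\mathbf Q$ (in particular their $Z$-marginals agree). Let $$p_n(\mathbf y_n,\mathbf a_n,\mathbf z_n;\theta)=\alpha_n\big(\mathbf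 a_n\mid \mathbb S(z_1),\dots,\mathbb S(z_n)\big)\prod_{i=1}^n q_1(y_i,z_i;\theta)^{a_i}q_0(y_i,z_i;\theta)^{1-a_i},$$ and let $P_{\theta,n}$ be the distribution with density $p_n(\cdot;\theta)$ with respect to the $n$-fold product of the measure $\nu$ on $\mathbb R\times\{0,1\}\times\mathbb R^k$ whose restriction to $\{A=a\}$ is $\nu_a$. Suppose $\theta_0\in\Theta$ is such that $q_a(\cdot;\theta_0)$ is a density of $(Y(a),Z)$ under $Q_0$ for $a=0,1$, and that $\theta_0$ is identified: if $\theta\in\Theta$ and $P_{\theta,n}=P_{\theta_0,n}$ for all $n$, then $\theta=\theta_0$. Suppose that for each $a\in\{0,1\}$ there is a measurable $D_a:\mathbb R^{1+k}\to\mathbb R^d$ with $\int\|D_a\|^2\,d\nu_a<\infty$ and $$\lim_{t\to0}\|t\|^{-2}\int\Big(\sqrt{q_a(\cdot;\theta_0+t)}-\sqrt{q_a(\cdot;\theta_0)}-D_a't\Big)^2d\nu_a=0,$$ and that $4\int D_aD_a'\,d\nu_a$ is nonsingular. **Score and information.** Put $\dot\ell_a=2\,D_a\,q_a(\cdot;\theta_0)^{-1/2}\,\mathbb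 I\{q_a(\cdot;\theta_0)>0\}$, $\dot\ell(y,a,z)=a\,\dot\ell_1(y,z)+(1-a)\,\dot\ell_0(y,z)$, $\dot\ell_n=\sum_{i=1}^n\dot\ell(X_{ni})$, and $$\mathcal I=\sum_{s=1}^{\mathcal S}Q_0(\mathbb S(Z)=s)\Big\{\pi(s)\,\mathbb E_{Q_0}\big[\dot\ell_1\dot\ell_1'(Y(1),Z)\mid\mathbb S(Z)=s\big]+(1-\pi(s))\,\mathbb E_{Q_0}\big[\dot\ell_0\dot\ell_0'(Y(0),Z)\mid\mathbb S(Z)=s\big]\Big\},$$ where strata of probability zero contribute $0$. Let $\ell_n(\theta)=\log p_n(\mathbf X_n;\theta)$ (with $\log0=-\infty$), and for $t\in\mathbb R^d$ with $\theta_0+t/\sqrt n\in\Theta$ define $R_n(\theta_0,t)$ by $$\ell_n(\theta_0+t/\sqrt n)-\ell_n(\theta_0)=t'\,\tfrac1{\sqrt n}\dot\ell_n-\tfrac12t'\mathcal I\,t+R_n(\theta_0,t).$$ **Claim.** The submodel is locally asymptotically normal at $\theta_0$: 0. $\mathcal I$ is positive semidefinite and $\mathcal I=\mathbb E[\dot\ell(Y,A,Z)\dot\ell(Y,A,Z)']$,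 where $Y=AY(1)+(1-A)Y(0)$, $W\sim Q_0$ and, given $W$, $A$ is Bernoulli with parameter $\pi(\mathbb S(Z))$. 1. Under $P_{0,n}$, $n^{-1/2}\dot\ell_n$ converges in distribution to $\mathcal N(\mathbf 0_d,\mathcal I)$. 2. For every $M>0$ and $\varepsilon>0$, $$\lim_{n\to\infty}\ \sup_{\|t\|\le M}P_{0,n}\big(|R_n(\theta_0,t)|>\varepsilon\big)=0.$$ (For $n$ large, $\theta_0+t/\sqrt n\in\Theta$ for all $\|t\|\le M$, since $\Theta$ is open.) -/

import Mathlib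

open MeasureTheory ProbabilityTheory Filter Topology
open scoped ENNReal Matrix

noncomputable section

namespace CAR

/-- Values of `W = (Y(0), Y(1), Z)` with `Z ∈ ℝᵏ`. -/
abbrev Pop (k : ℕ) : Type := ℝ × ℝ × (Fin k → ℝ)

/-- Values of a single observation `X = (Y, A, Z)`; treatment `1` is `true`, control `0` is
`false`. -/
abbrev Obs (k : ℕ) : Type := ℝ × Bool × (Fin k → ℝ)

/-- The baseline covariates `Z` of `w = (Y(0), Y(1), Z)`. -/
def covariates {k : ℕ} (w : Pop k) : Fin k → ℝ := w.2.2

/-- The potential outcome `Y(a)` of `w = (Y(0), Y(1), Z)`. -/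
def outcome {k : ℕ} (a : Bool) (w : Pop k) : ℝ := if a = true then w.2.1 else w.1

/-- The pair `(Y(a), Z)`. -/
def arm {k : ℕ} (a : Bool) (w : Pop k) : ℝ × (Fin k → ℝ) := (outcome a w, covariates w)

/-- The observation `(Y, A, Z)` with `A = a` and `Y = Y(1) A + Y(0) (1 - A)`. -/
def observe {k : ℕ} (a : Bool) (w : Pop k) : Obs k := (outcome a w, a, covariates w)

/-- The measure `ν_a = μ_a ⊗ μ_Z` on `ℝ × ℝᵏ`. -/
def armMeasure {k : ℕ} (μ : Bool → Measure ℝ) (μZ : Measure (Fin k → ℝ)) (a : Bool) :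
    Measure (ℝ × (Fin k → ℝ)) :=
  (μ a).prod μZ

/-- The measure `ν` on the space of single observations:
`ν(𝒴 × 𝒜 × 𝒵) = ν₁(𝒴 × 𝒵) 1{1 ∈ 𝒜} + ν₀(𝒴 × 𝒵) 1{0 ∈ 𝒜}`. -/
def obsMeasure {k : ℕ} (μ : Bool → Measure ℝ) (μZ : Measure (Fin k → ℝ)) : Measure (Obs k) :=
  ∑ a : Bool, (armMeasure μ μZ a).map (fun yz => ((yz.1, a, yz.2) : Obs k))

/-- The nonparametric family of population distributions: probability measures on `ℝ^{2+k}`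
dominated by `μ₀ ⊗ μ₁ ⊗ μ_Z` under which both potential outcomes have a finite second moment. -/
def populationFamily {k : ℕ} (μ : Bool → Measure ℝ) (μZ : Measure (Fin k → ℝ)) :
    Set (Measure (Pop k)) :=
  {Q | IsProbabilityMeasure Q ∧ Q ≪ (μ false).prod ((μ true).prod μZ) ∧
    ∀ a, MemLp (outcome a) 2 Q}

/-- What the experimenter knows and chooses: the stratification `𝕊 : ℝᵏ → {1, …, 𝒮}`, the target
treatment proportions `π(s) ∈ (0, 1)`, and, for each sample size, the conditional probability mass
function `α_n(· | s_n)` of the treatment assignments given the sample strata. -/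
structure Design (k : ℕ) where
  numStrata : ℕ
  stratum : (Fin k → ℝ) → Fin numStrata
  measurable_stratum : Measurable stratum
  target : Fin numStrata → ℝ
  target_mem : ∀ s, target s ∈ Set.Ioo (0 : ℝ) 1
  assign : (n : ℕ) → (Fin n → Fin numStrata) → PMF (Fin n → Bool)

namespace Design

variable {k : ℕ} (𝒟 : Design k)

/-- The event `𝕊(Z) = s`. -/
def stratumEvent (s : Fin 𝒟.numStrata) : Set (Pop k) := {w | 𝒟.stratum (covariates w) = s}

/-- `π_a(s) = π(s)^a (1 - π(s))^{1-a}`. -/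
def armTarget (a : Bool) (s : Fin 𝒟.numStrata) : ℝ :=
  if a = true then 𝒟.target s else 1 - 𝒟.target s

/-- The strata `s_n = (𝕊(z_1), …, 𝕊(z_n))` of a sample. -/
def sampleStrata {n : ℕ} (x : Fin n → Obs k) : Fin n → Fin 𝒟.numStrata :=
  fun i => 𝒟.stratum (x i).2.2

/-- The stratum size `N_n(s)`. -/
def stratumSize {n : ℕ} (x : Fin n → Obs k) (s : Fin 𝒟.numStrata) : ℕ :=
  (Finset.univ.filter fun i => 𝒟.sampleStrata x i = s).card

/-- The stratum treatment group size `N_n(a, s)`. -/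
def groupSize {n : ℕ} (x : Fin n → Obs k) (a : Bool) (s : Fin 𝒟.numStrata) : ℕ :=
  (Finset.univ.filter fun i => (x i).2.1 = a ∧ 𝒟.sampleStrata x i = s).card

/-- The target law `P₀` of `X = (Y, A, Z)` under simple stratified randomization: `W ∼ Q₀`, and
given `W` the treatment `A` is Bernoulli with success probability `π(𝕊(Z))`. -/
def targetLaw (Q₀ : Measure (Pop k)) : Measure (Obs k) :=
  ∑ a : Bool, (Q₀.withDensity fun w =>
    ENNReal.ofReal (𝒟.armTarget a (𝒟.stratum (covariates w)))).map (observe a)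

end Design

/-- The observed sample `X_n = (X_{n1}, …, X_{nn})`, `X_{ni} = (Y_{ni}, A_{ni}, Z_i)`. -/
def sample {k : ℕ} {Ω : Type*} (W : ℕ → Ω → Pop k) (A : (n : ℕ) → Ω → Fin n → Bool)
    (n : ℕ) (ω : Ω) : Fin n → Obs k :=
  fun i => observe (A n ω i) (W i ω)

/-- `W₁, W₂, …` and the treatment assignments `A_n`, `n ∈ ℕ`, form a covariate-adaptive randomized
experiment with design `𝒟` and population distribution `Q₀`. -/
structure IsExperiment {k : ℕ} (𝒟 : Design k) (Q₀ : Measure (Pop k)) {Ω : Type*}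
    [MeasurableSpace Ω] (Pr : Measure Ω) (W : ℕ → Ω → Pop k)
    (A : (n : ℕ) → Ω → Fin n → Bool) : Prop where
  measurable_pop : ∀ i, Measurable (W i)
  measurable_assign : ∀ n, Measurable (A n)
  indep : iIndepFun W Pr
  law : ∀ i, Pr.map (W i) = Q₀
  /-- `W_n` and `A_n` are independent conditionally on the sample strata. -/
  exogenous : ∀ (n : ℕ) (s : Fin n → Fin 𝒟.numStrata) (a : Fin n → Bool)
    (B : Set (Fin n → Pop k)), MeasurableSet B →
    (cond Pr {ω | 𝒟.sampleStrata (sample W A n ω) = s})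
        ({ω | (fun i : Fin n => W i ω) ∈ B} ∩ {ω | A n ω = a}) =
      (cond Pr {ω | 𝒟.sampleStrata (sample W A n ω) = s})
          {ω | (fun i : Fin n => W i ω) ∈ B} *
        (cond Pr {ω | 𝒟.sampleStrata (sample W A n ω) = s}) {ω | A n ω = a}
  /-- `Pr(A_n = a_n | S_n = s_n) = α_n(a_n | s_n)`. -/
  adaptive : ∀ (n : ℕ) (s : Fin n → Fin 𝒟.numStrata) (a : Fin n → Bool),
    Pr {ω | 𝒟.sampleStrata (sample W A n ω) = s} ≠ 0 →
    (cond Pr {ω | 𝒟.sampleStrata (sample W A n ω) = s}) {ω | A n ω = a} = 𝒟.assign n s a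
  /-- `N_n(1, s) / N_n(s) → π(s)` in probability, for every stratum of positive probability. -/
  proportions : ∀ s, Q₀ (𝒟.stratumEvent s) ≠ 0 →
    TendstoInMeasure Pr
      (fun n ω => (𝒟.groupSize (sample W A n ω) true s : ℝ) /
        (𝒟.stratumSize (sample W A n ω) s : ℝ))
      atTop (fun _ => 𝒟.target s)

/-- `q 0` and `q 1` are nonnegative measurable versions of the densities, with respect to
`ν_0` and `ν_1`, of the laws of `(Y(0), Z)` and `(Y(1), Z)` under `Q`. -/
def HasArmDensities {k : ℕ} (μ : Bool → Measure ℝ) (μZ : Measure (Fin k → ℝ))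
    (Q : Measure (Pop k)) (q : Bool → ℝ × (Fin k → ℝ) → ℝ) : Prop :=
  ∀ a, Measurable (q a) ∧ (∀ x, 0 ≤ q a x) ∧
    Q.map (arm a) = (armMeasure μ μZ a).withDensity (fun x => ENNReal.ofReal (q a x))

/-- The density `p_n(y, a, z) = α_n(a | s) ∏ᵢ q₁(yᵢ, zᵢ)^{aᵢ} q₀(yᵢ, zᵢ)^{1 - aᵢ}`. -/
def jointDensity {k : ℕ} (𝒟 : Design k) (q : Bool → ℝ × (Fin k → ℝ) → ℝ) (n : ℕ)
    (x : Fin n → Obs k) : ℝ≥0∞ :=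
  𝒟.assign n (𝒟.sampleStrata x) (fun i => (x i).2.1) *
    ∏ i, ENNReal.ofReal (q (x i).2.1 ((x i).1, (x i).2.2))

/-- The law with density `p_n` with respect to the `n`-fold product of `ν`. -/
def jointLaw {k : ℕ} (𝒟 : Design k) (μ : Bool → Measure ℝ) (μZ : Measure (Fin k → ℝ))
    (q : Bool → ℝ × (Fin k → ℝ) → ℝ) (n : ℕ) : Measure (Fin n → Obs k) :=
  (Measure.pi fun _ : Fin n => obsMeasure μ μZ).withDensity (jointDensity 𝒟 q n)

/-- A parametric submodel with parameter space `Θ ⊆ ℝᵈ` and true value `θ₀`. For every `θ ∈ Θ` the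
pair `(q 0 θ, q 1 θ)` consists of the `(Y(a), Z)`-marginal densities of one population distribution
in the nonparametric family, so that both have the same `Z`-marginal; at `θ₀` this population
distribution is `Q₀`. -/
structure ParametricSubmodel {k : ℕ} (𝒟 : Design k) (μ : Bool → Measure ℝ)
    (μZ : Measure (Fin k → ℝ)) (Q₀ : Measure (Pop k)) (d : ℕ) where
  Θ : Set (EuclideanSpace ℝ (Fin d))
  q : Bool → EuclideanSpace ℝ (Fin d) → ℝ × (Fin k → ℝ) → ℝ
  population : ∀ θ ∈ Θ, ∃ Q ∈ populationFamily μ μZ, HasArmDensities μ μZ Q (fun a => q a θ)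
  θ₀ : EuclideanSpace ℝ (Fin d)
  θ₀_mem : θ₀ ∈ Θ
  truth_mem : Q₀ ∈ populationFamily μ μZ
  truth : HasArmDensities μ μZ Q₀ (fun a => q a θ₀)
  identified : ∀ θ ∈ Θ,
    (∀ n, jointLaw 𝒟 μ μZ (fun a => q a θ) n = jointLaw 𝒟 μ μZ (fun a => q a θ₀) n) → θ = θ₀

namespace ParametricSubmodel

variable {k : ℕ} {𝒟 : Design k} {μ : Bool → Measure ℝ} {μZ : Measure (Fin k → ℝ)}
  {Q₀ : Measure (Pop k)} {d : ℕ} (M : ParametricSubmodel 𝒟 μ μZ Q₀ d)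

/-- The submodel is regular at `θ₀`, with quadratic mean derivatives `D 0` and `D 1`. -/
structure IsRegular (D : Bool → ℝ × (Fin k → ℝ) → EuclideanSpace ℝ (Fin d)) : Prop where
  isOpen : IsOpen M.Θ
  isBounded : Bornology.IsBounded M.Θ
  measurable : ∀ a, Measurable (D a)
  memLp : ∀ a, MemLp (D a) 2 (armMeasure μ μZ a)
  qmd : ∀ a, Tendsto
    (fun t : EuclideanSpace ℝ (Fin d) => (‖t‖ ^ 2)⁻¹ *
      ∫ x, (√(M.q a (M.θ₀ + t) x) - √(M.q a M.θ₀ x) - inner ℝ (D a x) t) ^ 2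
        ∂(armMeasure μ μZ a))
    (𝓝[≠] 0) (𝓝 0)
  nonsingular : ∀ a, IsUnit
    (Matrix.of fun i j => 4 * ∫ x, D a x i * D a x j ∂(armMeasure μ μZ a)).det

/-- The log-likelihood `ℓ_n(θ) = log p_n(x; θ)`, with `log 0 = -∞`. -/
def logLikelihood (n : ℕ) (x : Fin n → Obs k) (θ : EuclideanSpace ℝ (Fin d)) : EReal :=
  ENNReal.log (jointDensity 𝒟 (fun a => M.q a θ) n x)

variable (D : Bool → ℝ × (Fin k → ℝ) → EuclideanSpace ℝ (Fin d))

/-- The marginal score `2 D_a / √q_a(·; θ₀) · 1{q_a(·; θ₀) > 0}`. -/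
def armScore (a : Bool) (x : ℝ × (Fin k → ℝ)) : EuclideanSpace ℝ (Fin d) :=
  if 0 < M.q a M.θ₀ x then (2 / √(M.q a M.θ₀ x)) • D a x else 0

/-- The score of a single observation. -/
def obsScore (x : Obs k) : EuclideanSpace ℝ (Fin d) := M.armScore D x.2.1 (x.1, x.2.2)

/-- The score of the sample. -/
def score (n : ℕ) (x : Fin n → Obs k) : EuclideanSpace ℝ (Fin d) := ∑ i, M.obsScore D (x i)

/-- The stratified information matrix
`∑ₛ Q₀(𝕊(Z) = s) ∑ₐ π_a(s) E[score_a(Y(a), Z) score_a(Y(a), Z)' | 𝕊(Z) = s]`. -/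
def information : Matrix (Fin d) (Fin d) ℝ :=
  Matrix.of fun i j => ∑ s, Q₀.real (𝒟.stratumEvent s) *
    ∑ a, 𝒟.armTarget a s *
      ∫ w, M.armScore D a (arm a w) i * M.armScore D a (arm a w) j
        ∂(cond Q₀ (𝒟.stratumEvent s))

/-- The remainder `R_n(θ₀, t)` of the quadratic expansion of the log-likelihood ratio. It is
extended-real valued, since the likelihood at `θ₀ + t / √n` may vanish. -/
def remainder (n : ℕ) (t : EuclideanSpace ℝ (Fin d)) (x : Fin n → Obs k) : EReal :=
  (M.logLikelihood n x (M.θ₀ + (√(n : ℝ))⁻¹ • t) - M.logLikelihood n x M.θ₀) -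
    ((inner ℝ t ((√(n : ℝ))⁻¹ • M.score D n x) -
      2⁻¹ * (t.ofLp ⬝ᵥ (M.information D *ᵥ t.ofLp)) : ℝ) : EReal)

end ParametricSubmodel

end CAR

end

/-!
Local asymptotic normality is proved in the manner of Le Cam, with conditional independence taking
the place of independence. Conditionally on the strata and the treatments of the first `n` units,
the units are independent, and each is distributed as the population restricted to its stratum
(`IsExperiment.map_units_block`). The treatments therefore influence sums over units only through
the conditional means and variances of the summands, hence only through the sizes of the groups
defined by treatment and stratum, which are asymptotically deterministic. Group sizes are known to
first order only, so a term of order `√n` multiplying them would be fatal. It is absent for one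
reason: `(Y(0), Z)` and `(Y(1), Z)` have the same `Z`-marginal along the submodel, so that quantities
that only concern the probabilities of the strata agree in the two arms.

*Score.* Differentiating the stratum probabilities shows that the conditional mean of the score
given the stratum is the same in both arms (`ParametricSubmodel.integral_root_smul_eq`), with mean
zero over the strata. The normalized score is thus a sum of independent stratum means and of
summands that are conditionally independent and centered. The classical central limit theorem
applies to the former; the conditional characteristic function of the latter is asymptotically a
Gaussian one with deterministic variance, and the two variances add up to the information
(`IsExperiment.tendsto_charFun_sum`).

*Likelihood ratio.* Let `ρ` be the increment of the root likelihood ratio of one observation and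
`g / (2 √n)` its linearization, `g` being the score in direction `t`. The log-likelihood ratio is
`∑ 2 log (1 + ρ)`, which `2 ∑ ρ - ∑ ρ ^ 2` approximates because the largest increment is negligible.
By a law of large numbers for dominated functions (`IsExperiment.tendstoInMeasure_average`) the sum
of squares is a quarter of the quadratic form `t' I t`. The sum of the `ρ - g / (2 √n)` may be
replaced by the sum of their conditional means given the stratum, since the conditional variances
are negligible. By differentiability in quadratic mean, which passes to the restriction to a
stratum, such a mean consists of a squared distance of root densities, which sums to
`-(t' I t) / 8`, and of the first-order error of the stratum probability
(`ParametricSubmodel.stratumMean_ratioError`). That error is only `o(n^{-1/2})` for a single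
stratum. But it does not depend on the arm, so that its sum over units is a sum of independent
variables with variance `o(1)`; and its mean is `o(1 / n)`, since the errors of all strata add up to
zero and those of null strata are of second order
(`ParametricSubmodel.tendsto_sum_massError`).

The expansion is obtained along bounded sequences of local parameters, which yields uniformity over
balls. The likelihood at `θ₀ + t / √n` may vanish, but only where some `ρ` equals `-1`, an event of
vanishing probability.
-/

/-! ### Samples, strata and the conditional law of the units -/

namespace CAR

section Experiment

variable {k : ℕ} {𝒟 : Design k} {Q₀ : Measure (Pop k)} {Ω : Type*} [MeasurableSpace Ω]
  {Pr : Measure Ω} {W : ℕ → Ω → Pop k} {A : (n : ℕ) → Ω → Fin n → Bool}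

lemma measurable_covariates : Measurable (covariates : Pop k → Fin k → ℝ) :=
  measurable_snd.comp measurable_snd

lemma measurable_outcome (a : Bool) : Measurable (outcome a : Pop k → ℝ) := by
  cases a
  · simpa [outcome] using! measurable_fst
  · simpa [outcome] using! measurable_fst.comp measurable_snd

lemma measurable_arm (a : Bool) : Measurable (arm a : Pop k → ℝ × (Fin k → ℝ)) :=
  (measurable_outcome a).prodMk measurable_covariates

lemma measurable_observe (a : Bool) : Measurable (observe a : Pop k → Obs k) :=
  (measurable_outcome a).prodMk (measurable_const.prodMk measurable_covariates)

/-- The stratum of a unit with characteristics `w`. -/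
def Design.unitStratum (𝒟 : Design k) (w : Pop k) : Fin 𝒟.numStrata := 𝒟.stratum (covariates w)

lemma Design.measurable_unitStratum : Measurable 𝒟.unitStratum :=
  𝒟.measurable_stratum.comp measurable_covariates

lemma Design.measurableSet_stratumEvent (s : Fin 𝒟.numStrata) :
    MeasurableSet (𝒟.stratumEvent s) :=
  𝒟.measurable_unitStratum (measurableSet_singleton s)

/-- The event that the first `n` units have strata `s` and treatments `a`. -/
def block (𝒟 : Design k) (W : ℕ → Ω → Pop k) (A : (n : ℕ) → Ω → Fin n → Bool) (n : ℕ)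
    (s : Fin n → Fin 𝒟.numStrata) (a : Fin n → Bool) : Set Ω :=
  {ω | (fun i : Fin n => 𝒟.unitStratum (W i ω)) = s ∧ A n ω = a}

namespace IsExperiment

lemma isProbabilityMeasure (hX : IsExperiment 𝒟 Q₀ Pr W A) [IsProbabilityMeasure Pr] :
    IsProbabilityMeasure Q₀ := by
  rw [← hX.law 0]
  exact Measure.isProbabilityMeasure_map (hX.measurable_pop 0).aemeasurable

lemma measurable_strata (hX : IsExperiment 𝒟 Q₀ Pr W A) (n : ℕ) :
    Measurable fun ω => fun i : Fin n => 𝒟.unitStratum (W i ω) :=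
  measurable_pi_lambda _ fun i => 𝒟.measurable_unitStratum.comp (hX.measurable_pop i)

lemma measurable_units (hX : IsExperiment 𝒟 Q₀ Pr W A) (n : ℕ) :
    Measurable fun ω => fun i : Fin n => W i ω :=
  measurable_pi_lambda _ fun i => hX.measurable_pop i

lemma map_units [IsProbabilityMeasure Pr] (hX : IsExperiment 𝒟 Q₀ Pr W A) (n : ℕ) :
    Pr.map (fun ω => fun i : Fin n => W i ω) = Measure.pi fun _ => Q₀ := by
  have h : iIndepFun (fun i : Fin n => W i) Pr := hX.indep.precomp Fin.val_injective
  refine ((iIndepFun_iff_map_fun_eq_pi_map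
    fun i : Fin n => (hX.measurable_pop i).aemeasurable).1 h).trans ?_
  simp [hX.law]

/-- Conditionally on the strata and the treatments of the first `n` units, these units are
independent, and each is drawn from the population restricted to its stratum. -/
lemma map_units_block [IsProbabilityMeasure Pr] (hX : IsExperiment 𝒟 Q₀ Pr W A) (n : ℕ)
    (s : Fin n → Fin 𝒟.numStrata) (a : Fin n → Bool) :
    (Pr.restrict (block 𝒟 W A n s a)).map (fun ω => fun i : Fin n => W i ω) =
      Pr (block 𝒟 W A n s a) • Measure.pi fun i => cond Q₀ (𝒟.stratumEvent (s i)) := by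
  have := hX.isProbabilityMeasure
  have hW := hX.measurable_units n
  -- the event that the strata are `s`, which is determined by `W`
  set C : Set Ω := {ω | 𝒟.sampleStrata (sample W A n ω) = s} with hC
  have hCm : MeasurableSet C := hX.measurable_strata n (measurableSet_singleton s)
  have hblock : block 𝒟 W A n s a = C ∩ {ω | A n ω = a} := rfl
  have hCpre : C = (fun ω => fun i : Fin n => W i ω) ⁻¹'
      (Set.univ.pi fun i => 𝒟.stratumEvent (s i)) := by
    ext ω
    simp only [hC, Set.mem_ofPred_eq, Set.mem_preimage, Set.mem_pi, Set.mem_univ, true_imp_iff]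
    exact funext_iff
  have hPC : Pr C = ∏ i, Q₀ (𝒟.stratumEvent (s i)) := by
    rw [hCpre, ← Measure.map_apply hW
      (MeasurableSet.univ_pi fun i => 𝒟.measurableSet_stratumEvent _), hX.map_units,
      Measure.pi_pi]
  ext B hB
  rw [Measure.map_apply hW hB, Measure.restrict_apply (hW hB), Measure.smul_apply, smul_eq_mul]
  by_cases h0 : Pr C = 0
  · have h1 : Pr (block 𝒟 W A n s a) = 0 :=
      measure_mono_null (hblock ▸ Set.inter_subset_left) h0
    rw [h1, zero_mul]
    exact measure_mono_null Set.inter_subset_right h1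
  -- conditioning a product measure on a box conditions each factor
  have hpi : (Measure.pi fun i => cond Q₀ (𝒟.stratumEvent (s i))) =
      (Pr C)⁻¹ • (Measure.pi fun _ : Fin n => Q₀).restrict
        (Set.univ.pi fun i => 𝒟.stratumEvent (s i)) := by
    refine Measure.pi_eq fun t ht => ?_
    have hne : ∀ i, Q₀ (𝒟.stratumEvent (s i)) ≠ 0 := by
      intro i hi
      exact h0 (hPC.trans (Finset.prod_eq_zero (Finset.mem_univ i) hi))
    rw [Measure.restrict_pi_pi, Measure.smul_apply, Measure.pi_pi, smul_eq_mul, hPC,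
      ENNReal.prod_inv_distrib (fun i _ j _ _ => Or.inl (hne i)), ← Finset.prod_mul_distrib]
    rfl
  have hex := hX.exogenous n s a B hB
  rw [← hC, cond_apply hCm, cond_apply hCm, cond_apply hCm] at hex
  have hfin : Pr C ≠ ∞ := measure_ne_top _ _
  have h2 : (Measure.pi fun i => cond Q₀ (𝒟.stratumEvent (s i))) B =
      (Pr C)⁻¹ * Pr (C ∩ {ω | (fun i : Fin n => W i ω) ∈ B}) := by
    rw [hpi, Measure.smul_apply, Measure.restrict_apply hB, ← hX.map_units n, Measure.map_apply hW
      (hB.inter (MeasurableSet.univ_pi fun i => 𝒟.measurableSet_stratumEvent _)),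
      Set.preimage_inter, ← hCpre, Set.inter_comm, smul_eq_mul]
    rfl
  rw [h2, hblock]
  have h3 : (fun ω => fun i : Fin n => W i ω) ⁻¹' B ∩ (C ∩ {ω | A n ω = a}) =
      C ∩ ({ω | (fun i : Fin n => W i ω) ∈ B} ∩ {ω | A n ω = a}) := by
    rw [Set.inter_left_comm]; rfl
  rw [h3]
  calc Pr (C ∩ ({ω | (fun i : Fin n => W i ω) ∈ B} ∩ {ω | A n ω = a}))
      = Pr C * ((Pr C)⁻¹ *
          Pr (C ∩ ({ω | (fun i : Fin n => W i ω) ∈ B} ∩ {ω | A n ω = a}))) := by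
        rw [← mul_assoc, ENNReal.mul_inv_cancel h0 hfin, one_mul]
    _ = (Pr C * (Pr C)⁻¹) * Pr (C ∩ {ω | A n ω = a}) *
          ((Pr C)⁻¹ * Pr (C ∩ {ω | (fun i : Fin n => W i ω) ∈ B})) := by
        rw [hex]; ring
    _ = _ := by rw [ENNReal.mul_inv_cancel h0 hfin, one_mul]

/-- The tower property: an expectation may be computed by first averaging over the units
conditionally on the strata and the treatments. -/
lemma integral_eq_integral_pi [IsProbabilityMeasure Pr] (hX : IsExperiment 𝒟 Q₀ Pr W A) (n : ℕ)
    {E : Type*} [NormedAddCommGroup E] [NormedSpace ℝ E] [CompleteSpace E]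
    {F : (Fin n → Bool) → (Fin n → Pop k) → E} (hF : ∀ a, StronglyMeasurable (F a))
    (hint : Integrable (fun ω => F (A n ω) fun i => W i ω) Pr) :
    ∫ ω, F (A n ω) (fun i => W i ω) ∂Pr =
      ∫ ω, (∫ w, F (A n ω) w ∂(Measure.pi fun i : Fin n =>
        cond Q₀ (𝒟.stratumEvent (𝒟.unitStratum (W i ω))))) ∂Pr := by
  let T : Ω → (Fin n → Fin 𝒟.numStrata) × (Fin n → Bool) :=
    fun ω => (fun i => 𝒟.unitStratum (W i ω), A n ω)
  have hT : Measurable T := (hX.measurable_strata n).prodMk (hX.measurable_assign n)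
  let G : (Fin n → Fin 𝒟.numStrata) × (Fin n → Bool) → E := fun x =>
    ∫ w, F x.2 w ∂(Measure.pi fun i : Fin n => cond Q₀ (𝒟.stratumEvent (x.1 i)))
  have hG : Integrable (fun ω => G (T ω)) Pr := by
    have := Measure.isProbabilityMeasure_map (μ := Pr) hT.aemeasurable
    have h : Integrable G (Pr.map T) := Integrable.of_finite
    exact h.comp_measurable hT
  have hU : (⋃ x : (Fin n → Fin 𝒟.numStrata) × (Fin n → Bool), T ⁻¹' {x}) = Set.univ := by
    ext ω; simp
  have hm : ∀ x, MeasurableSet (T ⁻¹' {x}) := fun x => hT (measurableSet_singleton x)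
  have hd : Pairwise (Function.onFun Disjoint fun x => T ⁻¹' {x}) := fun x y hxy =>
    Disjoint.preimage _ (Set.disjoint_singleton.2 hxy)
  change _ = ∫ ω, G (T ω) ∂Pr
  rw [← setIntegral_univ, ← setIntegral_univ (f := fun ω => G (T ω)), ← hU,
    integral_iUnion_fintype hm hd fun _ => hint.integrableOn,
    integral_iUnion_fintype hm hd fun _ => hG.integrableOn]
  refine Finset.sum_congr rfl fun x _ => ?_
  have hx : T ⁻¹' {x} = block 𝒟 W A n x.1 x.2 := by
    ext ω
    simp only [Set.mem_preimage, Set.mem_singleton_iff, block, Set.mem_ofPred_eq]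
    exact Prod.ext_iff
  have h1 : ∫ ω in T ⁻¹' {x}, F (A n ω) (fun i => W i ω) ∂Pr =
      ∫ ω in T ⁻¹' {x}, F x.2 (fun i => W i ω) ∂Pr :=
    setIntegral_congr_fun (hm x) fun ω hω => by
      rw [hx] at hω
      rw [hω.2]
  have h2 : ∫ ω in T ⁻¹' {x}, G (T ω) ∂Pr = ∫ ω in T ⁻¹' {x}, G x ∂Pr :=
    setIntegral_congr_fun (hm x) fun ω hω => by
      rw [show T ω = x from hω]
  rw [h1, h2, setIntegral_const, ← integral_map (φ := fun ω => fun i : Fin n => W i ω)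
    (hX.measurable_units n).aemeasurable (hF x.2).aestronglyMeasurable, hx,
    hX.map_units_block, integral_smul_measure]
  rfl

end IsExperiment
end Experiment
end CAR

/-! ### Conditional means given the stratum -/

namespace CAR

section Experiment

variable {k : ℕ} {𝒟 : Design k} {Q₀ : Measure (Pop k)} {Ω : Type*} [MeasurableSpace Ω]
  {Pr : Measure Ω} {W : ℕ → Ω → Pop k} {A : (n : ℕ) → Ω → Fin n → Bool}

section Strata

lemma stratumEvent_ae [IsFiniteMeasure Q₀] (s : Fin 𝒟.numStrata) :
    ∀ᵐ w ∂(cond Q₀ (𝒟.stratumEvent s)), 𝒟.unitStratum w = s :=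
  ae_cond_mem (𝒟.measurableSet_stratumEvent s)

lemma memLp_cond [IsFiniteMeasure Q₀] {E : Type*} [NormedAddCommGroup E] {f : Pop k → E}
    {p : ℝ≥0∞} (hf : MemLp f p Q₀) (s : Set (Pop k)) : MemLp f p (cond Q₀ s) := by
  by_cases h : Q₀ s = 0
  · rw [cond_eq_zero_of_meas_eq_zero h]
    exact ⟨aestronglyMeasurable_zero_measure f, by simp⟩
  · exact hf.restrict s |>.smul_measure (ENNReal.inv_ne_top.2 h)

lemma integrable_cond [IsFiniteMeasure Q₀] {E : Type*} [NormedAddCommGroup E] {f : Pop k → E}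
    (hf : Integrable f Q₀) (s : Set (Pop k)) : Integrable f (cond Q₀ s) := by
  rw [← memLp_one_iff_integrable] at hf ⊢
  exact memLp_cond hf s

/-- This holds for null events as well, since conditioning on them gives the zero measure. -/
lemma real_mul_integral_cond [IsFiniteMeasure Q₀] {E : Type*} [NormedAddCommGroup E]
    [NormedSpace ℝ E] (f : Pop k → E) (s : Set (Pop k)) :
    Q₀.real s • ∫ w, f w ∂(cond Q₀ s) = ∫ w in s, f w ∂Q₀ := by
  by_cases h : Q₀ s = 0
  · rw [Measure.restrict_eq_zero.2 h, integral_zero_measure, cond_eq_zero_of_meas_eq_zero h,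
      integral_zero_measure, smul_zero]
  · rw [ProbabilityTheory.cond, integral_smul_measure, smul_smul, ENNReal.toReal_inv, Measure.real,
      mul_inv_cancel₀ (ENNReal.toReal_ne_zero.2 ⟨h, measure_ne_top _ _⟩), one_smul]

lemma integral_eq_sum_strata [IsFiniteMeasure Q₀] {E : Type*} [NormedAddCommGroup E]
    [NormedSpace ℝ E] {f : Pop k → E} (hf : Integrable f Q₀) :
    ∫ w, f w ∂Q₀ = ∑ s, ∫ w in 𝒟.stratumEvent s, f w ∂Q₀ := by
  have hU : (⋃ s, 𝒟.stratumEvent s) = Set.univ := by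
    ext w; simp [Design.stratumEvent]
  rw [← setIntegral_univ, ← hU, integral_iUnion_fintype 𝒟.measurableSet_stratumEvent _
    fun _ => hf.integrableOn]
  intro s t hst
  exact Set.disjoint_left.2 fun w hw hw' => hst (hw.symm.trans hw')

end Strata

/-- The conditional mean of `f` in stratum `s`. On a stratum of probability zero the conditional
measure is zero, and so is the mean. -/
noncomputable def stratumMean (𝒟 : Design k) (Q₀ : Measure (Pop k)) (f : Pop k → ℝ)
    (s : Fin 𝒟.numStrata) : ℝ :=
  ∫ w, f w ∂(cond Q₀ (𝒟.stratumEvent s))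

lemma integral_eq_sum_stratumMean [IsFiniteMeasure Q₀] {f : Pop k → ℝ} (hf : Integrable f Q₀) :
    ∫ w, f w ∂Q₀ = ∑ s, Q₀.real (𝒟.stratumEvent s) * stratumMean 𝒟 Q₀ f s := by
  rw [integral_eq_sum_strata (𝒟 := 𝒟) hf]
  exact Finset.sum_congr rfl fun s _ => (real_mul_integral_cond f _).symm

lemma integrable_comp_unitStratum [IsFiniteMeasure Q₀] (c : Fin 𝒟.numStrata → ℝ) :
    Integrable (fun w => c (𝒟.unitStratum w)) Q₀ :=
  (Integrable.of_finite (f := c) (μ := Q₀.map 𝒟.unitStratum)).comp_measurable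
    𝒟.measurable_unitStratum

lemma stratumMean_comp_unitStratum [IsFiniteMeasure Q₀] (c : Fin 𝒟.numStrata → ℝ)
    {s : Fin 𝒟.numStrata} (hs : Q₀ (𝒟.stratumEvent s) ≠ 0) :
    stratumMean 𝒟 Q₀ (fun w => c (𝒟.unitStratum w)) s = c s := by
  have := cond_isProbabilityMeasure hs
  rw [stratumMean, integral_congr_ae (g := fun _ => c s)]
  · simp
  · filter_upwards [stratumEvent_ae s] with w hw
    rw [hw]

lemma integral_comp_unitStratum [IsFiniteMeasure Q₀] (c : Fin 𝒟.numStrata → ℝ) :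
    ∫ w, c (𝒟.unitStratum w) ∂Q₀ = ∑ s, Q₀.real (𝒟.stratumEvent s) * c s := by
  rw [integral_eq_sum_stratumMean (𝒟 := 𝒟) (integrable_comp_unitStratum c)]
  refine Finset.sum_congr rfl fun s _ => ?_
  by_cases hs : Q₀ (𝒟.stratumEvent s) = 0
  · simp [Measure.real, hs]
  · rw [stratumMean_comp_unitStratum c hs]

/-- The deviation of `f` from its conditional mean given the stratum. -/
noncomputable def stratumCentered (𝒟 : Design k) (Q₀ : Measure (Pop k)) (f : Pop k → ℝ)
    (w : Pop k) : ℝ :=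
  f w - stratumMean 𝒟 Q₀ f (𝒟.unitStratum w)

lemma measurable_comp_unitStratum (c : Fin 𝒟.numStrata → ℝ) :
    Measurable fun w => c (𝒟.unitStratum w) :=
  (measurable_of_finite c).comp 𝒟.measurable_unitStratum

lemma measurable_stratumCentered {f : Pop k → ℝ} (hf : Measurable f) :
    Measurable (stratumCentered 𝒟 Q₀ f) :=
  hf.sub (measurable_comp_unitStratum _)

lemma memLp_comp_unitStratum [IsFiniteMeasure Q₀] (c : Fin 𝒟.numStrata → ℝ) (p : ℝ≥0∞) :
    MemLp (fun w => c (𝒟.unitStratum w)) p Q₀ := by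
  refine MemLp.of_bound (measurable_comp_unitStratum c).aestronglyMeasurable
    (∑ s, ‖c s‖) (Eventually.of_forall fun w => ?_)
  exact Finset.single_le_sum (f := fun s => ‖c s‖) (fun _ _ => norm_nonneg _) (Finset.mem_univ _)

lemma memLp_stratumCentered [IsFiniteMeasure Q₀] {f : Pop k → ℝ} (hf : MemLp f 2 Q₀) :
    MemLp (stratumCentered 𝒟 Q₀ f) 2 Q₀ :=
  hf.sub (memLp_comp_unitStratum _ 2)

lemma stratumMean_stratumCentered [IsFiniteMeasure Q₀] {f : Pop k → ℝ} (hf : Integrable f Q₀)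
    (s : Fin 𝒟.numStrata) : stratumMean 𝒟 Q₀ (stratumCentered 𝒟 Q₀ f) s = 0 := by
  by_cases hs : Q₀ (𝒟.stratumEvent s) = 0
  · rw [stratumMean, cond_eq_zero_of_meas_eq_zero hs, integral_zero_measure]
  · rw [stratumMean]
    unfold stratumCentered
    rw [integral_sub (integrable_cond hf _)
      (integrable_cond (integrable_comp_unitStratum _) _)]
    exact sub_eq_zero.2 (stratumMean_comp_unitStratum (stratumMean 𝒟 Q₀ f) hs).symm

lemma stratumMean_stratumCentered_sq_eq [IsFiniteMeasure Q₀] {f : Pop k → ℝ} (hf : MemLp f 2 Q₀)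
    {s : Fin 𝒟.numStrata} (hs : Q₀ (𝒟.stratumEvent s) ≠ 0) :
    stratumMean 𝒟 Q₀ (fun w => stratumCentered 𝒟 Q₀ f w ^ 2) s =
      stratumMean 𝒟 Q₀ (fun w => f w ^ 2) s - stratumMean 𝒟 Q₀ f s ^ 2 := by
  have := cond_isProbabilityMeasure hs
  have h := variance_eq_sub (memLp_cond hf (𝒟.stratumEvent s))
  rw [variance_eq_integral (memLp_cond hf _).aestronglyMeasurable.aemeasurable] at h
  simp only [stratumMean]
  refine Eq.trans (integral_congr_ae ?_) h
  filter_upwards [stratumEvent_ae s] with w hw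
  rw [stratumCentered, hw]
  rfl

lemma stratumMean_sq_nonneg (f : Pop k → ℝ) (s : Fin 𝒟.numStrata) :
    0 ≤ stratumMean 𝒟 Q₀ (fun w => f w ^ 2) s :=
  integral_nonneg fun _ => sq_nonneg _

lemma stratumMean_stratumCentered_sq_le [IsFiniteMeasure Q₀] {f : Pop k → ℝ} (hf : MemLp f 2 Q₀)
    (s : Fin 𝒟.numStrata) :
    stratumMean 𝒟 Q₀ (fun w => stratumCentered 𝒟 Q₀ f w ^ 2) s ≤
      stratumMean 𝒟 Q₀ (fun w => f w ^ 2) s := by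
  by_cases hs : Q₀ (𝒟.stratumEvent s) = 0
  · simp [stratumMean, cond_eq_zero_of_meas_eq_zero hs]
  · rw [stratumMean_stratumCentered_sq_eq hf hs]
    linarith [sq_nonneg (stratumMean 𝒟 Q₀ f s)]

namespace IsExperiment

lemma measurable_unit (hX : IsExperiment 𝒟 Q₀ Pr W A) {E : Type*} [MeasurableSpace E]
    {f : Bool → Pop k → E} (hf : ∀ a, Measurable (f a)) {n : ℕ} (i : Fin n) :
    Measurable fun ω => f (A n ω i) (W i ω) := by
  have h : Measurable fun x : Bool × Pop k => f x.1 x.2 := measurable_from_prod_countable_right hf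
  exact h.comp (((measurable_pi_apply i).comp (hX.measurable_assign n)).prodMk
    (hX.measurable_pop i))

lemma integrable_pop (hX : IsExperiment 𝒟 Q₀ Pr W A) {E : Type*} [NormedAddCommGroup E]
    {f : Pop k → E} (hf : Integrable f Q₀) (i : ℕ) : Integrable (fun ω => f (W i ω)) Pr :=
  Integrable.comp_measurable (by rwa [hX.law i]) (hX.measurable_pop i)

lemma integral_pop (hX : IsExperiment 𝒟 Q₀ Pr W A) {f : Pop k → ℝ} (hf : Measurable f) (i : ℕ) :
    ∫ ω, f (W i ω) ∂Pr = ∫ w, f w ∂Q₀ := by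
  rw [← hX.law i, integral_map (hX.measurable_pop i).aemeasurable hf.aestronglyMeasurable]

lemma memLp_unit (hX : IsExperiment 𝒟 Q₀ Pr W A) {f : Bool → Pop k → ℝ} {p : ℝ≥0∞}
    (hm : ∀ a, Measurable (f a)) (hf : ∀ a, MemLp (f a) p Q₀) {n : ℕ} (i : Fin n) :
    MemLp (fun ω => f (A n ω i) (W i ω)) p Pr := by
  have h : ∀ a, MemLp (fun ω => ‖f a (W i ω)‖) p Pr := fun a =>
    ((hf a).comp_measurePreserving ⟨hX.measurable_pop i, hX.law i⟩).norm
  refine MemLp.mono ((h true).add (h false)) (hX.measurable_unit hm i).aestronglyMeasurable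
    (Eventually.of_forall fun ω => ?_)
  simp only [Pi.add_apply]
  rw [Real.norm_of_nonneg (add_nonneg (norm_nonneg (f true (W i ω))) (norm_nonneg _))]
  cases A n ω i <;> simp

lemma integrable_unit (hX : IsExperiment 𝒟 Q₀ Pr W A) {f : Bool → Pop k → ℝ}
    (hm : ∀ a, Measurable (f a)) (hf : ∀ a, Integrable (f a) Q₀) {n : ℕ} (i : Fin n) :
    Integrable (fun ω => f (A n ω i) (W i ω)) Pr :=
  memLp_one_iff_integrable.1
    (hX.memLp_unit hm (fun a => memLp_one_iff_integrable.2 (hf a)) i)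

/-- Since `f_A ≤ f_1 + f_0` for nonnegative functions, sums over the realized treatment arms are
dominated by sums of independent and identically distributed variables. -/
lemma integral_sum_le (hX : IsExperiment 𝒟 Q₀ Pr W A) {f : Bool → Pop k → ℝ}
    (hm : ∀ a, Measurable (f a)) (hf : ∀ a, Integrable (f a) Q₀) (h0 : ∀ a w, 0 ≤ f a w) (n : ℕ) :
    ∫ ω, ∑ i, f (A n ω i) (W i ω) ∂Pr ≤ n * ∑ a, ∫ w, f a w ∂Q₀ := by
  rw [integral_finsetSum _ fun i _ => hX.integrable_unit hm hf i]
  calc ∑ i : Fin n, ∫ ω, f (A n ω i) (W i ω) ∂Pr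
      ≤ ∑ i : Fin n, ∑ a, ∫ w, f a w ∂Q₀ := by
        refine Finset.sum_le_sum fun i _ => ?_
        calc ∫ ω, f (A n ω i) (W i ω) ∂Pr ≤ ∫ ω, ∑ a, f a (W i ω) ∂Pr := by
              refine integral_mono (hX.integrable_unit hm hf i)
                (integrable_finsetSum _ fun a _ => hX.integrable_pop (hf a) i) fun ω => ?_
              exact Finset.single_le_sum (f := fun a => f a (W i ω)) (fun a _ => h0 a _)
                (Finset.mem_univ _)
          _ = ∑ a, ∫ w, f a w ∂Q₀ := by
              rw [integral_finsetSum _ fun a _ => hX.integrable_pop (hf a) i]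
              exact Finset.sum_congr rfl fun a _ => hX.integral_pop (hm a) i
    _ = n * ∑ a, ∫ w, f a w ∂Q₀ := by
      rw [Finset.sum_const, Finset.card_univ, Fintype.card_fin, nsmul_eq_mul]

/-- Almost surely, no unit falls into a stratum of probability zero. -/
lemma ae_stratum_ne_zero (hX : IsExperiment 𝒟 Q₀ Pr W A) [IsFiniteMeasure Q₀] :
    ∀ᵐ ω ∂Pr, ∀ i, Q₀ (𝒟.stratumEvent (𝒟.unitStratum (W i ω))) ≠ 0 := by
  refine ae_all_iff.2 fun i => ?_
  have h : ∀ᵐ w ∂Q₀, Q₀ (𝒟.stratumEvent (𝒟.unitStratum w)) ≠ 0 := by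
    have h' : ∀ s, ∀ᵐ w ∂Q₀, Q₀ (𝒟.stratumEvent s) = 0 → 𝒟.unitStratum w ≠ s := by
      intro s
      by_cases hs : Q₀ (𝒟.stratumEvent s) = 0
      · have : ∀ᵐ w ∂Q₀, w ∉ 𝒟.stratumEvent s := measure_eq_zero_iff_ae_notMem.1 hs
        filter_upwards [this] with w hw _ hws
        exact hw hws
      · exact Eventually.of_forall fun w h => absurd h hs
    filter_upwards [ae_all_iff.2 h'] with w hw h0
    exact hw _ h0 rfl
  exact ae_of_ae_map (hX.measurable_pop i).aemeasurable
    (p := fun w => Q₀ (𝒟.stratumEvent (𝒟.unitStratum w)) ≠ 0) ((hX.law i).symm ▸ h)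

/-- Conditionally on strata and treatments, the centered summands are independent with mean zero,
so that the second moment of their sum is at most that of independent summands. -/
lemma integral_sum_stratumCentered_sq_le [IsProbabilityMeasure Pr]
    (hX : IsExperiment 𝒟 Q₀ Pr W A) {f : Bool → Pop k → ℝ} (hm : ∀ a, Measurable (f a))
    (hf : ∀ a, MemLp (f a) 2 Q₀) (n : ℕ) :
    ∫ ω, (∑ i, stratumCentered 𝒟 Q₀ (f (A n ω i)) (W i ω)) ^ 2 ∂Pr ≤
      n * ∑ a, ∫ w, f a w ^ 2 ∂Q₀ := by
  have := hX.isProbabilityMeasure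
  let g : Bool → Pop k → ℝ := fun a => stratumCentered 𝒟 Q₀ (f a)
  have hgm : ∀ a, Measurable (g a) := fun a => measurable_stratumCentered (hm a)
  have hg : ∀ a, MemLp (g a) 2 Q₀ := fun a => memLp_stratumCentered (hf a)
  let F : (Fin n → Bool) → (Fin n → Pop k) → ℝ := fun a w => (∑ i, g (a i) (w i)) ^ 2
  have hF : ∀ a, StronglyMeasurable (F a) := fun a =>
    ((Finset.measurable_fun_sum _ fun i _ =>
      (hgm (a i)).comp (measurable_pi_apply i)).pow_const 2).stronglyMeasurable
  have hint : Integrable (fun ω => F (A n ω) fun i => W i ω) Pr :=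
    (memLp_finsetSum Finset.univ fun i _ => hX.memLp_unit hgm hg i).integrable_sq
  let V : Bool → Fin 𝒟.numStrata → ℝ := fun a s => stratumMean 𝒟 Q₀ (fun w => g a w ^ 2) s
  have htower := hX.integral_eq_integral_pi n hF hint
  change ∫ ω, F (A n ω) (fun i => W i ω) ∂Pr ≤ _
  rw [htower]
  have hinner : ∀ᵐ ω ∂Pr, (∫ w, F (A n ω) w ∂(Measure.pi fun i : Fin n =>
        cond Q₀ (𝒟.stratumEvent (𝒟.unitStratum (W i ω))))) =
      ∑ i, V (A n ω i) (𝒟.unitStratum (W i ω)) := by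
    filter_upwards [hX.ae_stratum_ne_zero] with ω hω
    have hp : ∀ i : Fin n, IsProbabilityMeasure
        (cond Q₀ (𝒟.stratumEvent (𝒟.unitStratum (W i ω)))) := fun i =>
      cond_isProbabilityMeasure (hω i)
    have hL : ∀ i : Fin n, MemLp (g (A n ω i)) 2
        (cond Q₀ (𝒟.stratumEvent (𝒟.unitStratum (W i ω)))) := fun i => memLp_cond (hg _) _
    have hmean : ∀ i : Fin n, ∫ w, g (A n ω i) w
        ∂(cond Q₀ (𝒟.stratumEvent (𝒟.unitStratum (W i ω)))) = 0 := fun i =>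
      stratumMean_stratumCentered ((hf _).integrable one_le_two) _
    have hvar := variance_sum_pi hL
    have hzero : ∫ w, (∑ i : Fin n, fun w : Fin n → Pop k => g (A n ω i) (w i)) w
        ∂(Measure.pi fun i : Fin n => cond Q₀ (𝒟.stratumEvent (𝒟.unitStratum (W i ω)))) = 0 := by
      simp only [Finset.sum_apply]
      rw [integral_finsetSum]
      · refine Finset.sum_eq_zero fun i _ => ?_
        rw [← hmean i]
        exact integral_comp_eval (hL i).aestronglyMeasurable
      · exact fun i _ => integrable_comp_eval ((hL i).integrable one_le_two)
    rw [variance_of_integral_eq_zero _ hzero] at hvar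
    · simp only [Finset.sum_apply] at hvar
      refine hvar.trans (Finset.sum_congr rfl fun i _ => ?_)
      rw [variance_of_integral_eq_zero (hgm _).aemeasurable (hmean i)]
      rfl
    · exact Finset.aemeasurable_sum _ fun i _ =>
        ((hgm (A n ω i)).comp (measurable_pi_apply i)).aemeasurable
  rw [integral_congr_ae hinner]
  refine (hX.integral_sum_le (f := fun a w => V a (𝒟.unitStratum w))
    (fun a => measurable_comp_unitStratum (V a)) (fun a => integrable_comp_unitStratum (V a))
    (fun a w => stratumMean_sq_nonneg _ _) n).trans ?_
  refine mul_le_mul_of_nonneg_left (Finset.sum_le_sum fun a _ => ?_) n.cast_nonneg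
  rw [integral_comp_unitStratum, integral_eq_sum_stratumMean (𝒟 := 𝒟) (hf a).integrable_sq]
  exact Finset.sum_le_sum fun s _ =>
    mul_le_mul_of_nonneg_left (stratumMean_stratumCentered_sq_le (hf a) s) measureReal_nonneg

end IsExperiment
end Experiment
end CAR

/-! ### Convergence in probability -/

namespace CAR

section InProbability

variable {Ω : Type*} [MeasurableSpace Ω] {Pr : Measure Ω} {X Y Z : ℕ → Ω → ℝ}

lemma tendstoInMeasure_zero_iff :
    TendstoInMeasure Pr X atTop (fun _ => 0) ↔
      ∀ ε > 0, Tendsto (fun n => Pr {ω | ε ≤ |X n ω|}) atTop (𝓝 0) := by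
  rw [tendstoInMeasure_iff_norm]
  simp

lemma tendstoInMeasure_of_abs_le_add (hY : TendstoInMeasure Pr Y atTop fun _ => 0)
    (hZ : TendstoInMeasure Pr Z atTop fun _ => 0)
    (h : ∀ᶠ n in atTop, ∀ᵐ ω ∂Pr, |X n ω| ≤ |Y n ω| + |Z n ω|) :
    TendstoInMeasure Pr X atTop fun _ => 0 := by
  rw [tendstoInMeasure_zero_iff] at *
  intro ε hε
  have h2 := (hY (ε / 2) (half_pos hε)).add (hZ (ε / 2) (half_pos hε))
  rw [add_zero] at h2
  refine tendsto_of_tendsto_of_tendsto_of_le_of_le' tendsto_const_nhds h2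
    (Eventually.of_forall fun _ => zero_le) ?_
  filter_upwards [h] with n hn
  refine (measure_mono_ae ?_).trans (measure_union_le _ _)
  filter_upwards [hn] with ω hω hε'
  change ε ≤ |X n ω| at hε'
  by_contra hc
  have hc1 : ¬ (ε / 2 ≤ |Y n ω| ∨ ε / 2 ≤ |Z n ω|) := hc
  rw [not_or, not_le, not_le] at hc1
  linarith

lemma tendstoInMeasure_of_tendsto {c : ℕ → ℝ} (hc : Tendsto c atTop (𝓝 0)) :
    TendstoInMeasure Pr (fun n _ => c n) atTop fun _ => 0 := by
  rw [tendstoInMeasure_zero_iff]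
  intro ε hε
  refine tendsto_const_nhds.congr' ?_
  filter_upwards [(tendsto_zero_iff_abs_tendsto_zero c).1 hc |>.eventually_lt_const hε] with n hn
  simp only [Function.comp_apply] at hn
  simp [not_le.2 hn]

lemma TendstoInMeasure.of_abs_le (hY : TendstoInMeasure Pr Y atTop fun _ => 0)
    (h : ∀ᶠ n in atTop, ∀ᵐ ω ∂Pr, |X n ω| ≤ |Y n ω|) :
    TendstoInMeasure Pr X atTop fun _ => 0 := by
  refine tendstoInMeasure_of_abs_le_add hY (tendstoInMeasure_of_tendsto
    (tendsto_const_nhds (x := 0))) ?_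
  simpa using h

lemma TendstoInMeasure.add_zero (hX : TendstoInMeasure Pr X atTop fun _ => 0)
    (hY : TendstoInMeasure Pr Y atTop fun _ => 0) :
    TendstoInMeasure Pr (fun n ω => X n ω + Y n ω) atTop fun _ => 0 :=
  tendstoInMeasure_of_abs_le_add hX hY
    (Eventually.of_forall fun _ => Eventually.of_forall fun _ => abs_add_le _ _)

lemma TendstoInMeasure.sum_zero {ι : Type*} (s : Finset ι) {X : ι → ℕ → Ω → ℝ}
    (hX : ∀ i ∈ s, TendstoInMeasure Pr (X i) atTop fun _ => 0) :
    TendstoInMeasure Pr (fun n ω => ∑ i ∈ s, X i n ω) atTop fun _ => 0 := by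
  classical
  induction s using Finset.induction_on with
  | empty => simpa using tendstoInMeasure_of_tendsto (Pr := Pr) (tendsto_const_nhds (x := 0))
  | insert i s hi ih =>
    simp_rw [Finset.sum_insert hi]
    exact TendstoInMeasure.add_zero (hX i (Finset.mem_insert_self _ _))
      (ih fun j hj => hX j (Finset.mem_insert_of_mem hj))

lemma TendstoInMeasure.bdd_mul_zero (hX : TendstoInMeasure Pr X atTop fun _ => 0) {c : ℕ → ℝ}
    {C : ℝ} (hc : ∀ᶠ n in atTop, |c n| ≤ C) :
    TendstoInMeasure Pr (fun n ω => c n * X n ω) atTop fun _ => 0 := by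
  rw [tendstoInMeasure_zero_iff] at *
  intro ε hε
  have hC : 0 < |C| + 1 := by positivity
  refine tendsto_of_tendsto_of_tendsto_of_le_of_le' tendsto_const_nhds
    (hX (ε / (|C| + 1)) (by positivity)) (Eventually.of_forall fun _ => zero_le) ?_
  filter_upwards [hc] with n hn
  refine measure_mono fun ω hω => ?_
  change ε ≤ |c n * X n ω| at hω
  change ε / (|C| + 1) ≤ |X n ω|
  rw [div_le_iff₀ hC]
  rw [abs_mul] at hω
  nlinarith [abs_nonneg (X n ω), le_abs_self C]

lemma measure_le_abs_le_integral [IsFiniteMeasure Pr] {f : Ω → ℝ} (hf : Integrable f Pr) {ε : ℝ}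
    (hε : 0 < ε) : Pr {ω | ε ≤ |f ω|} ≤ ENNReal.ofReal ((∫ ω, |f ω| ∂Pr) / ε) := by
  have h := mul_meas_ge_le_integral_of_nonneg (μ := Pr) (f := fun ω => |f ω|)
    (Eventually.of_forall fun _ => abs_nonneg _) hf.abs ε
  rw [← ENNReal.ofReal_toReal (measure_ne_top Pr {ω | ε ≤ |f ω|})]
  refine ENNReal.ofReal_le_ofReal ?_
  rw [le_div_iff₀ hε, mul_comm]
  exact h

/-- A sequence converges to zero in probability if it can be approximated in mean, to any accuracy,
by sequences that do. -/
lemma tendstoInMeasure_of_approx [IsFiniteMeasure Pr]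
    (h : ∀ δ > 0, ∃ Y : ℕ → Ω → ℝ, TendstoInMeasure Pr Y atTop (fun _ => 0) ∧
      ∀ᶠ n in atTop, Integrable (fun ω => X n ω - Y n ω) Pr ∧
        ∫ ω, |X n ω - Y n ω| ∂Pr ≤ δ) :
    TendstoInMeasure Pr X atTop fun _ => 0 := by
  rw [tendstoInMeasure_zero_iff]
  intro ε hε
  rw [ENNReal.tendsto_nhds_zero]
  intro η hη
  obtain ⟨η', hη'0, hη'⟩ : ∃ η' : ℝ, 0 < η' ∧ ENNReal.ofReal η' + ENNReal.ofReal η' ≤ η := by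
    obtain rfl | hη2 := eq_or_ne η ∞
    · exact ⟨1, one_pos, le_top⟩
    · refine ⟨η.toReal / 2, half_pos (ENNReal.toReal_pos hη.ne' hη2), ?_⟩
      rw [← ENNReal.ofReal_add (by positivity) (by positivity), add_halves,
        ENNReal.ofReal_toReal hη2]
  obtain ⟨Y, hY, hXY⟩ := h (η' * (ε / 2)) (by positivity)
  have hY' := tendstoInMeasure_zero_iff.1 hY (ε / 2) (half_pos hε)
  rw [ENNReal.tendsto_nhds_zero] at hY'
  filter_upwards [hXY, hY' (ENNReal.ofReal η') (by simpa using hη'0)] with n h1 h2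
  refine le_trans (measure_mono (t := {ω | ε / 2 ≤ |Y n ω|} ∪ {ω | ε / 2 ≤ |X n ω - Y n ω|})
    fun ω hω => ?_) ((measure_union_le _ _).trans (le_trans (add_le_add h2 ?_) hη'))
  · change ε ≤ |X n ω| at hω
    by_contra hc
    have hc1 : ¬ (ε / 2 ≤ |Y n ω| ∨ ε / 2 ≤ |X n ω - Y n ω|) := hc
    rw [not_or, not_le, not_le] at hc1
    have := abs_add_le (Y n ω) (X n ω - Y n ω)
    rw [add_sub_cancel] at this
    linarith
  · refine (measure_le_abs_le_integral h1.1 (half_pos hε)).trans (ENNReal.ofReal_le_ofReal ?_)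
    rw [div_le_iff₀ (half_pos hε)]
    exact h1.2

lemma tendstoInMeasure_of_integral_abs [IsFiniteMeasure Pr]
    (hX : ∀ᶠ n in atTop, Integrable (X n) Pr)
    (h : Tendsto (fun n => ∫ ω, |X n ω| ∂Pr) atTop (𝓝 0)) :
    TendstoInMeasure Pr X atTop fun _ => 0 := by
  refine tendstoInMeasure_of_approx fun δ hδ => ⟨fun _ _ => 0,
    tendstoInMeasure_of_tendsto tendsto_const_nhds, ?_⟩
  filter_upwards [hX, h.eventually_le_const hδ] with n h1 h2
  simpa using ⟨h1, h2⟩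

lemma tendstoInMeasure_of_integral_sq [IsFiniteMeasure Pr]
    (hX : ∀ᶠ n in atTop, Integrable (fun ω => X n ω ^ 2) Pr)
    (h : Tendsto (fun n => ∫ ω, X n ω ^ 2 ∂Pr) atTop (𝓝 0)) :
    TendstoInMeasure Pr X atTop fun _ => 0 := by
  have h' := tendstoInMeasure_zero_iff.1
    (tendstoInMeasure_of_integral_abs (X := fun n ω => X n ω ^ 2) hX (by simpa using h))
  rw [tendstoInMeasure_zero_iff]
  intro ε hε
  refine (h' (ε ^ 2) (by positivity)).congr fun n => congrArg Pr (Set.ext fun ω => ?_)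
  change ε ^ 2 ≤ |X n ω ^ 2| ↔ ε ≤ |X n ω|
  rw [abs_pow, pow_le_pow_iff_left₀ hε.le (abs_nonneg _) two_ne_zero]

/-- The bounded convergence theorem for convergence in probability. -/
lemma TendstoInMeasure.tendsto_integral_abs [IsProbabilityMeasure Pr]
    (hX : TendstoInMeasure Pr X atTop fun _ => 0) {C : ℝ}
    (hm : ∀ n, Measurable (X n)) (hC : ∀ n ω, |X n ω| ≤ C) :
    Tendsto (fun n => ∫ ω, |X n ω| ∂Pr) atTop (𝓝 0) := by
  rw [tendstoInMeasure_zero_iff] at hX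
  rw [Metric.tendsto_atTop']
  intro ε hε
  have h1 := (ENNReal.tendsto_toReal ENNReal.zero_ne_top).comp (hX (ε / 2) (half_pos hε))
  have h2 := h1.const_mul C
  simp only [ENNReal.toReal_zero, mul_zero] at h2
  obtain ⟨N, hN⟩ := eventually_atTop.1 (h2.eventually_lt_const (half_pos hε))
  refine ⟨N, fun n hn => ?_⟩
  rw [Real.dist_0_eq_abs, abs_of_nonneg (integral_nonneg fun _ => abs_nonneg _)]
  have hset : MeasurableSet {ω | ε / 2 ≤ |X n ω|} :=
    measurableSet_le measurable_const (continuous_abs.measurable.comp (hm n))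
  have hint : Integrable (fun ω => {ω | ε / 2 ≤ |X n ω|}.indicator (fun _ => C) ω) Pr :=
    (integrable_const C).indicator hset
  calc ∫ ω, |X n ω| ∂Pr ≤ ∫ ω, (ε / 2 + {ω | ε / 2 ≤ |X n ω|}.indicator (fun _ => C) ω) ∂Pr := by
        refine integral_mono_of_nonneg (Eventually.of_forall fun _ => abs_nonneg _)
          ((integrable_const _).add hint) (Eventually.of_forall fun ω => ?_)
        by_cases h : ε / 2 ≤ |X n ω|
        · simp only [Set.indicator, Set.mem_ofPred_eq, h, if_true]
          linarith [hC n ω]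
        · simp only [Set.indicator, Set.mem_ofPred_eq, h, if_false]
          linarith
    _ = ε / 2 + C * Pr.real {ω | ε / 2 ≤ |X n ω|} := by
        rw [integral_add (integrable_const _) hint, integral_indicator hset]
        simp [mul_comm]
    _ < ε := by
        have := hN n hn.le
        simp only [Function.comp_apply] at this
        rw [Measure.real]
        linarith

end InProbability

section Counts

variable {k : ℕ} {𝒟 : Design k} {Ω : Type*} {W : ℕ → Ω → Pop k} {A : (n : ℕ) → Ω → Fin n → Bool}

lemma groupSize_eq_sum (n : ℕ) (ω : Ω) (a : Bool) (s : Fin 𝒟.numStrata) :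
    (𝒟.groupSize (sample W A n ω) a s : ℝ) =
      ∑ i : Fin n, if A n ω i = a ∧ 𝒟.unitStratum (W i ω) = s then 1 else 0 := by
  rw [Design.groupSize, Finset.card_filter]
  push_cast
  rfl

lemma stratumSize_eq_sum (n : ℕ) (ω : Ω) (s : Fin 𝒟.numStrata) :
    (𝒟.stratumSize (sample W A n ω) s : ℝ) =
      ∑ i ∈ Finset.range n, if 𝒟.unitStratum (W i ω) = s then 1 else 0 := by
  rw [Design.stratumSize, Finset.card_filter,
    ← Fin.sum_univ_eq_sum_range (fun i => if 𝒟.unitStratum (W i ω) = s then (1 : ℝ) else 0)]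
  push_cast
  rfl

lemma groupSize_add (n : ℕ) (ω : Ω) (s : Fin 𝒟.numStrata) :
    (𝒟.groupSize (sample W A n ω) true s : ℝ) + 𝒟.groupSize (sample W A n ω) false s =
      𝒟.stratumSize (sample W A n ω) s := by
  rw [groupSize_eq_sum, groupSize_eq_sum, stratumSize_eq_sum,
    ← Fin.sum_univ_eq_sum_range (fun i => if 𝒟.unitStratum (W i ω) = s then (1 : ℝ) else 0),
    ← Finset.sum_add_distrib]
  refine Finset.sum_congr rfl fun i _ => ?_
  cases A n ω i <;> simp

/-- A sum over units of a function of treatment and stratum depends on the data only through the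
group sizes. -/
lemma sum_eq_sum_groupSize (n : ℕ) (ω : Ω) (c : Bool → Fin 𝒟.numStrata → ℝ) :
    ∑ i, c (A n ω i) (𝒟.unitStratum (W i ω)) =
      ∑ s, ∑ a, (𝒟.groupSize (sample W A n ω) a s : ℝ) * c a s := by
  simp_rw [groupSize_eq_sum, Finset.sum_mul]
  rw [Finset.sum_congr rfl fun s _ => Finset.sum_comm, Finset.sum_comm]
  refine Finset.sum_congr rfl fun i _ => ?_
  rw [Finset.sum_eq_single (𝒟.unitStratum (W i ω)), Finset.sum_eq_single (A n ω i)]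
  · simp
  · intro a _ ha
    simp [ha.symm]
  · simp
  · intro s _ hs
    simp [hs.symm]
  · simp

lemma stratumSize_le (n : ℕ) (ω : Ω) (s : Fin 𝒟.numStrata) :
    (n : ℝ)⁻¹ * 𝒟.stratumSize (sample W A n ω) s ≤ 1 := by
  rcases Nat.eq_zero_or_pos n with rfl | hn
  · simp
  · rw [inv_mul_le_iff₀ (by positivity), mul_one, Design.stratumSize]
    exact_mod_cast (Finset.card_filter_le _ _).trans (by simp)

end Counts

section Experiment

variable {k : ℕ} {𝒟 : Design k} {Q₀ : Measure (Pop k)} {Ω : Type*} [MeasurableSpace Ω]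
  {Pr : Measure Ω} {W : ℕ → Ω → Pop k} {A : (n : ℕ) → Ω → Fin n → Bool}

/-- The average of `c` over arms and strata when strata have their population frequencies and
treatments their target proportions. -/
noncomputable def targetSum (𝒟 : Design k) (Q₀ : Measure (Pop k))
    (c : Bool → Fin 𝒟.numStrata → ℝ) : ℝ :=
  ∑ s, Q₀.real (𝒟.stratumEvent s) * ∑ a, 𝒟.armTarget a s * c a s

namespace IsExperiment

lemma tendstoInMeasure_stratumSize [IsProbabilityMeasure Pr]
    (hX : IsExperiment 𝒟 Q₀ Pr W A) (s : Fin 𝒟.numStrata) :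
    TendstoInMeasure Pr (fun (n : ℕ) ω => (n : ℝ)⁻¹ * 𝒟.stratumSize (sample W A n ω) s -
      Q₀.real (𝒟.stratumEvent s)) atTop fun _ => 0 := by
  have := hX.isProbabilityMeasure
  let c : Fin 𝒟.numStrata → ℝ := fun s' => if s' = s then 1 else 0
  have hc : Measurable fun w : Pop k => c (𝒟.unitStratum w) := measurable_comp_unitStratum c
  let X : ℕ → Ω → ℝ := fun i ω => c (𝒟.unitStratum (W i ω))
  have hXm : ∀ i, Measurable (X i) := fun i => hc.comp (hX.measurable_pop i)
  have hlim := strong_law_ae_real X (hX.integrable_pop (integrable_comp_unitStratum c) 0)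
    (fun i j hij => (hX.indep.indepFun hij).comp hc hc)
    (fun i => IdentDistrib.comp ⟨(hX.measurable_pop i).aemeasurable,
      (hX.measurable_pop 0).aemeasurable, (hX.law i).trans (hX.law 0).symm⟩ hc)
  have hmean : ∫ ω, X 0 ω ∂Pr = Q₀.real (𝒟.stratumEvent s) := by
    rw [hX.integral_pop hc 0, integral_comp_unitStratum]
    simp [c]
  have hsize : ∀ n ω, (𝒟.stratumSize (sample W A n ω) s : ℝ) = ∑ i ∈ Finset.range n, X i ω :=
    fun n ω => stratumSize_eq_sum n ω s
  simp_rw [hsize]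
  refine tendstoInMeasure_of_tendsto_ae (fun n => Measurable.aestronglyMeasurable ?_) ?_
  · exact ((Finset.measurable_fun_sum _ fun i _ => hXm i).const_mul _).sub_const _
  · filter_upwards [hlim] with ω hω
    rw [← hmean]
    have h0 := hω.sub_const (∫ ω, X 0 ω ∂Pr)
    rw [sub_self] at h0
    simpa only [div_eq_inv_mul] using h0

/-- For a null stratum, where the design promises no treatment proportions, the fraction of units in
the stratum already vanishes. -/
lemma tendstoInMeasure_groupSize [IsProbabilityMeasure Pr]
    (hX : IsExperiment 𝒟 Q₀ Pr W A) (a : Bool) (s : Fin 𝒟.numStrata) :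
    TendstoInMeasure Pr (fun (n : ℕ) ω => (n : ℝ)⁻¹ * 𝒟.groupSize (sample W A n ω) a s -
      Q₀.real (𝒟.stratumEvent s) * 𝒟.armTarget a s) atTop fun _ => 0 := by
  have := hX.isProbabilityMeasure
  have hsize := hX.tendstoInMeasure_stratumSize s
  have htrue : TendstoInMeasure Pr (fun (n : ℕ) ω => (n : ℝ)⁻¹ * 𝒟.groupSize (sample W A n ω) true s -
      Q₀.real (𝒟.stratumEvent s) * 𝒟.target s) atTop fun _ => 0 := by
    by_cases hs : Q₀ (𝒟.stratumEvent s) = 0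
    · have h0 : Q₀.real (𝒟.stratumEvent s) = 0 := by simp [Measure.real, hs]
      refine TendstoInMeasure.of_abs_le hsize (Eventually.of_forall fun n =>
        Eventually.of_forall fun ω => ?_)
      rw [h0, zero_mul, sub_zero, sub_zero, abs_of_nonneg (by positivity),
        abs_of_nonneg (by positivity), ← groupSize_add]
      gcongr
      simp
    · have hp := hX.proportions s hs
      have hp' : TendstoInMeasure Pr (fun n ω => (𝒟.groupSize (sample W A n ω) true s : ℝ) /
          (𝒟.stratumSize (sample W A n ω) s : ℝ) - 𝒟.target s) atTop fun _ => 0 := by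
        rw [tendstoInMeasure_iff_norm] at hp
        rw [tendstoInMeasure_zero_iff]
        exact hp
      refine tendstoInMeasure_of_abs_le_add hp'
        (TendstoInMeasure.bdd_mul_zero hsize (c := fun _ => 𝒟.target s)
          (Eventually.of_forall fun _ => le_rfl))
        (Eventually.of_forall fun n => Eventually.of_forall fun ω => ?_)
      set G := (𝒟.groupSize (sample W A n ω) true s : ℝ)
      set N := (𝒟.stratumSize (sample W A n ω) s : ℝ) with hN
      -- an empty stratum has no treated units, so the division by zero is harmless
      have hGN : G = G / N * N := by
        by_cases h : N = 0
        · have h2 := groupSize_add (W := W) (A := A) n ω s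
          have h3 : (0 : ℝ) ≤ 𝒟.groupSize (sample W A n ω) false s := Nat.cast_nonneg _
          have h4 : (0 : ℝ) ≤ G := Nat.cast_nonneg _
          rw [h, mul_zero]
          linarith
        · field_simp
      have e : (n : ℝ)⁻¹ * G - Q₀.real (𝒟.stratumEvent s) * 𝒟.target s =
          (G / N - 𝒟.target s) * ((n : ℝ)⁻¹ * N) +
            𝒟.target s * ((n : ℝ)⁻¹ * N - Q₀.real (𝒟.stratumEvent s)) := by
        nth_rewrite 1 [hGN]
        ring
      rw [e]
      refine (abs_add_le _ _).trans (add_le_add_left ?_ _)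
      rw [abs_mul]
      refine mul_le_of_le_one_right (abs_nonneg _) ?_
      rw [abs_of_nonneg (by positivity)]
      exact stratumSize_le n ω s
  cases a
  · refine tendstoInMeasure_of_abs_le_add hsize htrue
      (Eventually.of_forall fun n => Eventually.of_forall fun ω => ?_)
    have e : (n : ℝ)⁻¹ * 𝒟.groupSize (sample W A n ω) false s -
        Q₀.real (𝒟.stratumEvent s) * 𝒟.armTarget false s =
        ((n : ℝ)⁻¹ * 𝒟.stratumSize (sample W A n ω) s - Q₀.real (𝒟.stratumEvent s)) -
        ((n : ℝ)⁻¹ * 𝒟.groupSize (sample W A n ω) true s -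
          Q₀.real (𝒟.stratumEvent s) * 𝒟.target s) := by
      rw [← groupSize_add]
      simp only [Design.armTarget, Bool.false_eq_true, if_false]
      ring
    rw [e]
    exact abs_sub _ _
  · simpa [Design.armTarget] using htrue

/-- The law of large numbers for functions of the treatment and the stratum alone. -/
lemma tendstoInMeasure_sum_strata [IsProbabilityMeasure Pr]
    (hX : IsExperiment 𝒟 Q₀ Pr W A) {c : ℕ → Bool → Fin 𝒟.numStrata → ℝ} {C : ℝ}
    (hc : ∀ᶠ n in atTop, ∀ a s, |c n a s| ≤ C) :
    TendstoInMeasure Pr (fun (n : ℕ) ω => (n : ℝ)⁻¹ * ∑ i, c n (A n ω i) (𝒟.unitStratum (W i ω)) -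
      targetSum 𝒟 Q₀ (c n)) atTop fun _ => 0 := by
  have h := TendstoInMeasure.sum_zero (Pr := Pr) (Finset.univ (α := Fin 𝒟.numStrata))
    fun s _ => TendstoInMeasure.sum_zero (Finset.univ (α := Bool)) fun a _ =>
      TendstoInMeasure.bdd_mul_zero (hX.tendstoInMeasure_groupSize a s)
        (hc.mono fun n hn => hn a s)
  convert h using 3 with n ω
  rw [sum_eq_sum_groupSize, targetSum, Finset.mul_sum, ← Finset.sum_sub_distrib]
  refine Finset.sum_congr rfl fun s _ => ?_
  rw [Finset.mul_sum, Finset.mul_sum, ← Finset.sum_sub_distrib]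
  exact Finset.sum_congr rfl fun a _ => by ring

end IsExperiment
end Experiment
end CAR

/-! ### Law of large numbers under adaptive assignment -/

namespace CAR

section Experiment

variable {k : ℕ} {𝒟 : Design k} {Q₀ : Measure (Pop k)} {Ω : Type*} [MeasurableSpace Ω]
  {Pr : Measure Ω} {W : ℕ → Ω → Pop k} {A : (n : ℕ) → Ω → Fin n → Bool}

lemma abs_stratumMean_le [IsFiniteMeasure Q₀] {f F : Pop k → ℝ} (hF : Integrable F Q₀)
    (h : ∀ w, |f w| ≤ F w) (s : Fin 𝒟.numStrata) :
    |stratumMean 𝒟 Q₀ f s| ≤ stratumMean 𝒟 Q₀ F s :=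
  norm_integral_le_of_norm_le (f := f) (integrable_cond hF (𝒟.stratumEvent s))
    (Eventually.of_forall h)

lemma stratumMean_sub [IsFiniteMeasure Q₀] {f g : Pop k → ℝ} (hf : Integrable f Q₀)
    (hg : Integrable g Q₀) (s : Fin 𝒟.numStrata) :
    stratumMean 𝒟 Q₀ (fun w => f w - g w) s = stratumMean 𝒟 Q₀ f s - stratumMean 𝒟 Q₀ g s :=
  integral_sub (integrable_cond hf _) (integrable_cond hg _)

lemma integrable_stratumCentered [IsFiniteMeasure Q₀] {f : Pop k → ℝ} (hf : Integrable f Q₀) :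
    Integrable (stratumCentered 𝒟 Q₀ f) Q₀ :=
  hf.sub (integrable_comp_unitStratum _)

lemma integral_abs_stratumCentered_le [IsFiniteMeasure Q₀] {f F : Pop k → ℝ}
    (hf : Integrable f Q₀) (hF : Integrable F Q₀) (h : ∀ w, |f w| ≤ F w) :
    ∫ w, |stratumCentered 𝒟 Q₀ f w| ∂Q₀ ≤ 2 * ∫ w, F w ∂Q₀ := by
  calc ∫ w, |stratumCentered 𝒟 Q₀ f w| ∂Q₀
      ≤ ∫ w, (F w + stratumMean 𝒟 Q₀ F (𝒟.unitStratum w)) ∂Q₀ := by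
        refine integral_mono (integrable_stratumCentered hf).abs
          (hF.add (integrable_comp_unitStratum _)) fun w => ?_
        exact (abs_sub _ _).trans (add_le_add (h w) (abs_stratumMean_le hF h _))
    _ = 2 * ∫ w, F w ∂Q₀ := by
        rw [integral_add hF (integrable_comp_unitStratum _), integral_comp_unitStratum,
          ← integral_eq_sum_stratumMean hF]
        ring

namespace IsExperiment

/-- Averages of stratum-centered functions vanish in probability. For bounded functions this is
the variance bound; the general case follows by truncation of the dominating function. -/
lemma tendstoInMeasure_sum_stratumCentered [IsProbabilityMeasure Pr]
    (hX : IsExperiment 𝒟 Q₀ Pr W A) {f : ℕ → Bool → Pop k → ℝ} {F : Bool → Pop k → ℝ}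
    (hfm : ∀ n a, Measurable (f n a)) (hFm : ∀ a, Measurable (F a))
    (hF : ∀ a, Integrable (F a) Q₀) (hfF : ∀ n a w, |f n a w| ≤ F a w) :
    TendstoInMeasure Pr (fun (n : ℕ) ω => (n : ℝ)⁻¹ *
      ∑ i, stratumCentered 𝒟 Q₀ (f n (A n ω i)) (W i ω)) atTop fun _ => 0 := by
  have := hX.isProbabilityMeasure
  have hf : ∀ n a, Integrable (f n a) Q₀ := fun n a =>
    (hF a).mono' (hfm n a).aestronglyMeasurable (Eventually.of_forall (hfF n a))
  refine tendstoInMeasure_of_approx fun δ hδ => ?_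
  have htail : Tendsto (fun K : ℕ => ∑ a, ∫ w, {w | (K : ℝ) < F a w}.indicator (F a) w ∂Q₀) atTop
      (𝓝 0) := by
    rw [show (0 : ℝ) = ∑ a : Bool, ∫ w : Pop k, (0 : ℝ) ∂Q₀ by simp]
    refine tendsto_finsetSum _ fun a _ => ?_
    refine tendsto_integral_of_dominated_convergence (F a)
      (fun K => ((hFm a).indicator (measurableSet_lt measurable_const (hFm a))).aestronglyMeasurable)
      (hF a) (fun K => Eventually.of_forall fun w => ?_) (Eventually.of_forall fun w => ?_)
    · have h0 : 0 ≤ F a w := (abs_nonneg _).trans (hfF 0 a w)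
      rw [Real.norm_of_nonneg (Set.indicator_nonneg (fun _ _ =>
        (abs_nonneg _).trans (hfF 0 a _)) _)]
      exact Set.indicator_le_self' (fun _ _ => h0) _
    · obtain ⟨K₀, hK₀⟩ := exists_nat_ge (F a w)
      refine tendsto_const_nhds.congr' ?_
      filter_upwards [eventually_ge_atTop K₀] with K hK
      have : ¬ (K : ℝ) < F a w := not_lt.2 (hK₀.trans (by exact_mod_cast hK))
      rw [Set.indicator_of_notMem (by simpa using this)]
  obtain ⟨K, hK⟩ := (htail.eventually_le_const (half_pos hδ)).exists
  -- `f` truncated where the dominating function exceeds `K`; the truncation error is at most `δ`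
  -- in mean because the tail of `F` is at most `δ / 2` and centering at most doubles it
  let g : ℕ → Bool → Pop k → ℝ := fun n a => {w | (K : ℝ) < F a w}ᶜ.indicator (f n a)
  have hset : ∀ a, MeasurableSet {w | (K : ℝ) < F a w} := fun a =>
    measurableSet_lt measurable_const (hFm a)
  have hgm : ∀ n a, Measurable (g n a) := fun n a => (hfm n a).indicator (hset a).compl
  have hgK : ∀ n a w, |g n a w| ≤ K := by
    intro n a w
    by_cases hw : (K : ℝ) < F a w
    · simp [g, hw]
    · simp only [g, Set.indicator, Set.mem_compl_iff, Set.mem_ofPred_eq, hw, not_false_eq_true,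
        if_true]
      exact (hfF n a w).trans (not_lt.1 hw)
  have hg2 : ∀ n a, MemLp (g n a) 2 Q₀ := fun n a =>
    MemLp.of_bound (hgm n a).aestronglyMeasurable K (Eventually.of_forall (hgK n a))
  have hgi : ∀ n a, Integrable (g n a) Q₀ := fun n a => (hg2 n a).integrable one_le_two
  refine ⟨fun n ω => (n : ℝ)⁻¹ * ∑ i, stratumCentered 𝒟 Q₀ (g n (A n ω i)) (W i ω), ?_, ?_⟩
  · refine tendstoInMeasure_of_integral_sq (Eventually.of_forall fun n => ?_) ?_
    · exact ((memLp_finsetSum Finset.univ fun i _ => hX.memLp_unit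
        (fun a => measurable_stratumCentered (hgm n a))
        (fun a => memLp_stratumCentered (hg2 n a)) i).const_mul _).integrable_sq
    · have hlim : Tendsto (fun n : ℕ => (n : ℝ)⁻¹ * (2 * (K : ℝ) ^ 2)) atTop (𝓝 0) := by
        simpa using (tendsto_inv_atTop_nhds_zero_nat (𝕜 := ℝ)).mul_const (2 * (K : ℝ) ^ 2)
      refine squeeze_zero (fun n => integral_nonneg fun ω => sq_nonneg _) (fun n => ?_) hlim
      simp_rw [mul_pow]
      rw [integral_const_mul]
      have hb := hX.integral_sum_stratumCentered_sq_le (hgm n) (hg2 n) n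
      have hb2 : ∀ a, ∫ w, g n a w ^ 2 ∂Q₀ ≤ (K : ℝ) ^ 2 := by
        intro a
        calc ∫ w, g n a w ^ 2 ∂Q₀ ≤ ∫ _, (K : ℝ) ^ 2 ∂Q₀ :=
              integral_mono (hg2 n a).integrable_sq (integrable_const _) fun w =>
                sq_le_sq' (neg_le_of_abs_le (hgK n a w)) (le_of_abs_le (hgK n a w))
          _ = (K : ℝ) ^ 2 := by simp
      have hb3 : ∑ a, ∫ w, g n a w ^ 2 ∂Q₀ ≤ 2 * (K : ℝ) ^ 2 := by
        rw [Fintype.sum_bool]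
        linarith [hb2 true, hb2 false]
      rcases Nat.eq_zero_or_pos n with rfl | hn
      · simp
      · have hn' : (0 : ℝ) < n := by exact_mod_cast hn
        calc ((n : ℝ)⁻¹) ^ 2 * ∫ ω, (∑ i, stratumCentered 𝒟 Q₀ (g n (A n ω i)) (W i ω)) ^ 2 ∂Pr
            ≤ ((n : ℝ)⁻¹) ^ 2 * (n * (2 * (K : ℝ) ^ 2)) := by
              gcongr
              exact hb.trans (by gcongr)
          _ = (n : ℝ)⁻¹ * (2 * (K : ℝ) ^ 2) := by field_simp
  · filter_upwards [eventually_gt_atTop 0] with n hn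
    have hn' : (0 : ℝ) < n := by exact_mod_cast hn
    let h : Bool → Pop k → ℝ := fun a w => f n a w - g n a w
    have hhm : ∀ a, Measurable (h a) := fun a => (hfm n a).sub (hgm n a)
    have hhi : ∀ a, Integrable (h a) Q₀ := fun a => (hf n a).sub (hgi n a)
    have hhF : ∀ a w, |h a w| ≤ {w | (K : ℝ) < F a w}.indicator (F a) w := by
      intro a w
      by_cases hw : (K : ℝ) < F a w
      · simpa [h, g, hw] using hfF n a w
      · simp [h, g, hw]
    have hc : ∀ a w, stratumCentered 𝒟 Q₀ (f n a) w - stratumCentered 𝒟 Q₀ (g n a) w =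
        stratumCentered 𝒟 Q₀ (h a) w := by
      intro a w
      simp only [stratumCentered, h, stratumMean_sub (hf n a) (hgi n a)]
      ring
    have e : ∀ ω, (n : ℝ)⁻¹ * ∑ i, stratumCentered 𝒟 Q₀ (f n (A n ω i)) (W i ω) -
        (n : ℝ)⁻¹ * ∑ i, stratumCentered 𝒟 Q₀ (g n (A n ω i)) (W i ω) =
        (n : ℝ)⁻¹ * ∑ i, stratumCentered 𝒟 Q₀ (h (A n ω i)) (W i ω) := by
      intro ω
      rw [← mul_sub, ← Finset.sum_sub_distrib]
      simp_rw [hc]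
    simp_rw [e]
    have hcm : ∀ a, Measurable (stratumCentered 𝒟 Q₀ (h a)) := fun a =>
      measurable_stratumCentered (hhm a)
    have hci : ∀ a, Integrable (stratumCentered 𝒟 Q₀ (h a)) Q₀ := fun a =>
      integrable_stratumCentered (hhi a)
    refine ⟨(integrable_finsetSum _ fun i _ => hX.integrable_unit hcm hci i).const_mul _, ?_⟩
    have hdom := hX.integral_sum_le (f := fun a w => |stratumCentered 𝒟 Q₀ (h a) w|)
      (fun a => (continuous_abs.measurable.comp (hcm a))) (fun a => (hci a).abs)
      (fun a w => abs_nonneg _) n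
    have hInd : ∀ a, Integrable ({w | (K : ℝ) < F a w}.indicator (F a)) Q₀ := fun a =>
      (hF a).indicator (hset a)
    have hsum : ∑ a, ∫ w, |stratumCentered 𝒟 Q₀ (h a) w| ∂Q₀ ≤ δ := by
      calc ∑ a, ∫ w, |stratumCentered 𝒟 Q₀ (h a) w| ∂Q₀
          ≤ ∑ a, 2 * ∫ w, {w | (K : ℝ) < F a w}.indicator (F a) w ∂Q₀ :=
            Finset.sum_le_sum fun a _ =>
              integral_abs_stratumCentered_le (hhi a) (hInd a) (hhF a)
        _ ≤ δ := by rw [← Finset.mul_sum]; linarith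
    calc ∫ ω, |(n : ℝ)⁻¹ * ∑ i, stratumCentered 𝒟 Q₀ (h (A n ω i)) (W i ω)| ∂Pr
        ≤ ∫ ω, (n : ℝ)⁻¹ * ∑ i, |stratumCentered 𝒟 Q₀ (h (A n ω i)) (W i ω)| ∂Pr := by
          refine integral_mono
            ((integrable_finsetSum _ fun i _ => hX.integrable_unit hcm hci i).const_mul _).abs
            ((integrable_finsetSum _ fun i _ =>
              (hX.integrable_unit hcm hci i).abs).const_mul _) fun ω => ?_
          simp only [abs_mul, abs_inv, Nat.abs_cast]
          exact mul_le_mul_of_nonneg_left (Finset.abs_sum_le_sum_abs _ _) (by positivity)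
      _ ≤ (n : ℝ)⁻¹ * (n * δ) := by
          rw [integral_const_mul]
          exact mul_le_mul_of_nonneg_left
            (hdom.trans (mul_le_mul_of_nonneg_left hsum hn'.le)) (by positivity)
      _ = δ := by field_simp

/-- The law of large numbers under covariate-adaptive randomization, for functions that may
depend on the sample size as long as they are dominated by an integrable function. -/
lemma tendstoInMeasure_average [IsProbabilityMeasure Pr]
    (hX : IsExperiment 𝒟 Q₀ Pr W A) {f : ℕ → Bool → Pop k → ℝ} {F : Bool → Pop k → ℝ}
    (hfm : ∀ n a, Measurable (f n a)) (hFm : ∀ a, Measurable (F a))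
    (hF : ∀ a, Integrable (F a) Q₀) (hfF : ∀ n a w, |f n a w| ≤ F a w) :
    TendstoInMeasure Pr (fun (n : ℕ) ω => (n : ℝ)⁻¹ * ∑ i, f n (A n ω i) (W i ω) -
      targetSum 𝒟 Q₀ (fun a => stratumMean 𝒟 Q₀ (f n a))) atTop fun _ => 0 := by
  have := hX.isProbabilityMeasure
  have h1 := hX.tendstoInMeasure_sum_stratumCentered hfm hFm hF hfF
  have h2 := hX.tendstoInMeasure_sum_strata (c := fun n a => stratumMean 𝒟 Q₀ (f n a))
    (C := ∑ a, ∑ s, stratumMean 𝒟 Q₀ (F a) s) (Eventually.of_forall fun n a s => by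
      have h0 : ∀ a s, 0 ≤ stratumMean 𝒟 Q₀ (F a) s := fun a s =>
        integral_nonneg fun w => (abs_nonneg _).trans (hfF 0 a w)
      refine (abs_stratumMean_le (hF a) (hfF n a) s).trans ?_
      refine (Finset.single_le_sum (f := fun s => stratumMean 𝒟 Q₀ (F a) s)
        (fun s _ => h0 a s) (Finset.mem_univ s)).trans ?_
      exact Finset.single_le_sum (f := fun a => ∑ s, stratumMean 𝒟 Q₀ (F a) s)
        (fun a _ => Finset.sum_nonneg fun s _ => h0 a s) (Finset.mem_univ a))
  refine (TendstoInMeasure.add_zero h1 h2).congr_left fun n => Eventually.of_forall fun ω => ?_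
  simp only [stratumCentered, Finset.sum_sub_distrib]
  ring

end IsExperiment
end Experiment
end CAR

/-! ### Central limit theorem under adaptive assignment -/

namespace CAR

/-- Replacing the factors of a product one at a time. -/
lemma norm_prod_sub_prod_le {ι : Type*} (s : Finset ι) {u v : ι → ℂ} (hu : ∀ i ∈ s, ‖u i‖ ≤ 1)
    (hv : ∀ i ∈ s, ‖v i‖ ≤ 1) :
    ‖∏ i ∈ s, u i - ∏ i ∈ s, v i‖ ≤ ∑ i ∈ s, ‖u i - v i‖ := by
  classical
  induction s using Finset.induction_on with
  | empty => simp
  | insert i s hi ih =>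
    rw [Finset.prod_insert hi, Finset.prod_insert hi, Finset.sum_insert hi]
    have ih' := ih (fun j hj => hu j (Finset.mem_insert_of_mem hj))
      (fun j hj => hv j (Finset.mem_insert_of_mem hj))
    have hp : ‖∏ j ∈ s, u j‖ ≤ 1 := by
      rw [norm_prod]
      exact Finset.prod_le_one (fun _ _ => norm_nonneg _)
        fun j hj => hu j (Finset.mem_insert_of_mem hj)
    calc ‖u i * ∏ j ∈ s, u j - v i * ∏ j ∈ s, v j‖
        = ‖(u i - v i) * ∏ j ∈ s, u j + v i * (∏ j ∈ s, u j - ∏ j ∈ s, v j)‖ := by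
          congr 1; ring
      _ ≤ ‖u i - v i‖ * ‖∏ j ∈ s, u j‖ + ‖v i‖ * ‖∏ j ∈ s, u j - ∏ j ∈ s, v j‖ := by
          rw [← norm_mul, ← norm_mul]
          exact norm_add_le _ _
      _ ≤ ‖u i - v i‖ + ∑ j ∈ s, ‖u j - v j‖ := by
          refine add_le_add (mul_le_of_le_one_right (norm_nonneg _) hp) ?_
          exact (mul_le_of_le_one_left (norm_nonneg _) (hv i (Finset.mem_insert_self _ _))).trans
            ih'

/-- Characteristic functions with the same first two moments agree to second order at zero. -/
lemma charFun_sub_charFun_isLittleO {μ ν : Measure ℝ} [IsProbabilityMeasure μ]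
    [IsProbabilityMeasure ν] (hμ : MemLp id 2 μ) (hν : MemLp id 2 ν)
    (h1 : ∫ x, x ∂μ = ∫ x, x ∂ν) (h2 : ∫ x, x ^ 2 ∂μ = ∫ x, x ^ 2 ∂ν) :
    (fun t => charFun μ t - charFun ν t) =o[𝓝 0] fun t : ℝ => t ^ 2 := by
  have hT : taylorWithinEval (charFun μ) 2 Set.univ 0 = taylorWithinEval (charFun ν) 2 Set.univ 0 := by
    ext t
    rw [taylorWithinEval_charFun_zero (n := 2) (by exact_mod_cast hμ),
      taylorWithinEval_charFun_zero (n := 2) (by exact_mod_cast hν)]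
    simp only [Finset.sum_range_succ, Finset.range_zero, Finset.sum_empty, pow_zero, pow_one, h1, h2,
      integral_const, probReal_univ]
  have tμ := taylor_isLittleO_univ (f := charFun μ) (n := 2) (x₀ := 0)
    (contDiff_charFun (by exact_mod_cast hμ))
  have tν := taylor_isLittleO_univ (f := charFun ν) (n := 2) (x₀ := 0)
    (contDiff_charFun (by exact_mod_cast hν))
  rw [hT] at tμ
  simpa using tμ.sub tν

lemma abs_exp_neg_sub_exp_neg_le {x y : ℝ} (hx : 0 ≤ x) (hy : 0 ≤ y) :
    |Real.exp (-x) - Real.exp (-y)| ≤ |x - y| := by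
  wlog h : x ≤ y generalizing x y
  · rw [abs_sub_comm, abs_sub_comm x]
    exact this hy hx (le_of_not_ge h)
  have h1 : Real.exp (-y) ≤ Real.exp (-x) := Real.exp_le_exp.2 (by linarith)
  have h2 : Real.exp (-x) ≤ 1 := Real.exp_le_one_iff.2 (by linarith)
  have h3 : Real.exp (-y) = Real.exp (-x) * Real.exp (x - y) := by
    rw [← Real.exp_add]; congr 1; ring
  rw [abs_of_nonneg (by linarith), abs_of_nonpos (by linarith), h3]
  nlinarith [Real.add_one_le_exp (x - y), Real.exp_pos (-x)]

section Experiment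

variable {k : ℕ} {𝒟 : Design k} {Q₀ : Measure (Pop k)} {Ω : Type*} [MeasurableSpace Ω]
  {Pr : Measure Ω} {W : ℕ → Ω → Pop k} {A : (n : ℕ) → Ω → Fin n → Bool}

lemma armTarget_nonneg (a : Bool) (s : Fin 𝒟.numStrata) : 0 ≤ 𝒟.armTarget a s := by
  have := 𝒟.target_mem s
  cases a <;> simp [Design.armTarget, this.1.le, this.2.le]

lemma sum_armTarget (s : Fin 𝒟.numStrata) : ∑ a, 𝒟.armTarget a s = 1 := by
  simp [Design.armTarget]

/-- In stratum `s`, the characteristic function of `f` agrees to second order with that of a normal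
law with the same mean and variance. -/
lemma tendsto_charFun_stratum [IsFiniteMeasure Q₀] {f : Pop k → ℝ} (hm : Measurable f)
    (hf : MemLp f 2 Q₀) {s : Fin 𝒟.numStrata} (hs : Q₀ (𝒟.stratumEvent s) ≠ 0) :
    Tendsto (fun n : ℕ => (n : ℝ) *
      ‖charFun ((ProbabilityTheory.cond Q₀ (𝒟.stratumEvent s)).map f) (√(n : ℝ))⁻¹ -
        charFun (gaussianReal (stratumMean 𝒟 Q₀ f s)
          (stratumMean 𝒟 Q₀ (fun w => stratumCentered 𝒟 Q₀ f w ^ 2) s).toNNReal)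
          (√(n : ℝ))⁻¹‖) atTop (𝓝 0) := by
  have := cond_isProbabilityMeasure hs
  have hp := Measure.isProbabilityMeasure_map
    (μ := ProbabilityTheory.cond Q₀ (𝒟.stratumEvent s)) hm.aemeasurable
  have hc := memLp_cond hf (𝒟.stratumEvent s)
  set m := stratumMean 𝒟 Q₀ f s
  set V := stratumMean 𝒟 Q₀ (fun w => stratumCentered 𝒟 Q₀ f w ^ 2) s with hV
  have hV0 : 0 ≤ V := integral_nonneg fun _ => sq_nonneg _
  have hid : MemLp id 2 ((ProbabilityTheory.cond Q₀ (𝒟.stratumEvent s)).map f) :=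
    (memLp_map_measure_iff aestronglyMeasurable_id hm.aemeasurable).2 hc
  have hgv := variance_eq_sub (memLp_id_gaussianReal' (μ := m) (v := V.toNNReal) 2 (by simp))
  rw [variance_id_gaussianReal] at hgv
  have hgm : ∫ x, x ∂(gaussianReal m V.toNNReal) = m := integral_id_gaussianReal
  have ho := charFun_sub_charFun_isLittleO hid (memLp_id_gaussianReal' (μ := m)
    (v := V.toNNReal) 2 (by simp)) ?_ ?_
  · have hlim : Tendsto (fun n : ℕ => (√(n : ℝ))⁻¹) atTop (𝓝 0) :=
      tendsto_inv_atTop_zero.comp (Real.tendsto_sqrt_atTop.comp tendsto_natCast_atTop_atTop)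
    have h2 := ((ho.comp_tendsto hlim).norm_left).tendsto_div_nhds_zero
    refine h2.congr fun n => ?_
    simp only [Function.comp_apply]
    rw [inv_pow, Real.sq_sqrt (Nat.cast_nonneg n), div_inv_eq_mul, mul_comm]
  · rw [integral_map hm.aemeasurable (by fun_prop), hgm]
    rfl
  · rw [integral_map hm.aemeasurable (by fun_prop)]
    have h3 := stratumMean_stratumCentered_sq_eq hf hs
    simp only [Pi.pow_apply, id_eq, hgm, Real.coe_toNNReal _ hV0] at hgv
    rw [← hV] at h3
    change stratumMean 𝒟 Q₀ (fun w => f w ^ 2) s = _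
    linarith

namespace IsExperiment

/-- Classical central limit theorem for functions of the strata of the units. -/
lemma tendsto_charFun_sum_strata [IsProbabilityMeasure Pr]
    (hX : IsExperiment 𝒟 Q₀ Pr W A) (c : Fin 𝒟.numStrata → ℝ)
    (hc : ∑ s, Q₀.real (𝒟.stratumEvent s) * c s = 0) :
    Tendsto (fun n : ℕ => ∫ ω, Complex.exp (((√(n : ℝ))⁻¹ *
        ∑ i : Fin n, c (𝒟.unitStratum (W i ω)) : ℝ) * Complex.I) ∂Pr) atTop
      (𝓝 (Real.exp (-(∑ s, Q₀.real (𝒟.stratumEvent s) * c s ^ 2) / 2) : ℝ)) := by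
  have := hX.isProbabilityMeasure
  have hcm : Measurable fun w : Pop k => c (𝒟.unitStratum w) := measurable_comp_unitStratum c
  let X : ℕ → Ω → ℝ := fun i ω => c (𝒟.unitStratum (W i ω))
  have hXm : ∀ i, Measurable (X i) := fun i => hcm.comp (hX.measurable_pop i)
  have hL : MemLp (X 0) 2 Pr :=
    (memLp_comp_unitStratum c 2).comp_measurePreserving ⟨hX.measurable_pop 0, hX.law 0⟩
  have hmean : ∫ ω, X 0 ω ∂Pr = 0 := by
    rw [hX.integral_pop hcm 0, integral_comp_unitStratum, hc]
  have hvar : Var[X 0; Pr] = ∑ s, Q₀.real (𝒟.stratumEvent s) * c s ^ 2 := by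
    rw [variance_of_integral_eq_zero (hXm 0).aemeasurable hmean,
      hX.integral_pop (hcm.pow_const 2) 0]
    exact integral_comp_unitStratum fun s => c s ^ 2
  have hclt := tendstoInDistribution_inv_sqrt_mul_sum_sub (P := Pr)
    (P' := gaussianReal 0 Var[X 0; Pr].toNNReal) (Y := id) (X := X) HasLaw.id hL
    (hX.indep.comp (fun _ w => c (𝒟.unitStratum w)) fun _ => hcm)
    (fun i => IdentDistrib.comp (f := W i) (g := W 0) ⟨(hX.measurable_pop i).aemeasurable,
      (hX.measurable_pop 0).aemeasurable, (hX.law i).trans (hX.law 0).symm⟩ hcm)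
  have h1 := ProbabilityMeasure.tendsto_iff_tendsto_charFun.1 hclt.tendsto 1
  simp only [hmean, mul_zero, sub_zero, ProbabilityMeasure.coe_mk, Measure.map_id,
    charFun_gaussianReal] at h1
  convert h1 using 1
  · ext n
    rw [charFun_apply_real, integral_map]
    · refine integral_congr_ae (Eventually.of_forall fun ω => ?_)
      simp only [Complex.ofReal_one, one_mul]
      rw [← Fin.sum_univ_eq_sum_range (fun i => X i ω)]
    · exact ((Finset.measurable_fun_sum _ fun i _ => hXm i).const_mul _).aemeasurable
    · fun_prop
  · rw [← hvar, Real.coe_toNNReal _ (variance_nonneg _ _)]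
    push_cast
    congr 2
    simp [neg_div]

/-- The characteristic function of a sum is the expected product of the conditional characteristic
functions of the units. -/
lemma integral_exp_sum_eq [IsProbabilityMeasure Pr] (hX : IsExperiment 𝒟 Q₀ Pr W A)
    {f : Bool → Pop k → ℝ} (hm : ∀ a, Measurable (f a)) (n : ℕ) (τ : ℝ) :
    ∫ ω, Complex.exp ((τ * ∑ i, f (A n ω i) (W i ω) : ℝ) * Complex.I) ∂Pr =
      ∫ ω, ∏ i : Fin n, charFun ((ProbabilityTheory.cond Q₀
        (𝒟.stratumEvent (𝒟.unitStratum (W i ω)))).map (f (A n ω i))) τ ∂Pr := by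
  have hexp : ∀ x : ℝ, ‖Complex.exp (x * Complex.I)‖ ≤ 1 := fun x =>
    (Complex.norm_exp_ofReal_mul_I x).le
  have hFm : ∀ a : Fin n → Bool, Measurable fun w : Fin n → Pop k =>
      τ * ∑ i, f (a i) (w i) := fun a =>
    (Finset.measurable_fun_sum _ fun i _ => (hm (a i)).comp (measurable_pi_apply i)).const_mul _
  have hUm : Measurable fun ω => τ * ∑ i, f (A n ω i) (W i ω) :=
    (Finset.measurable_fun_sum _ fun i _ => hX.measurable_unit hm i).const_mul _
  rw [hX.integral_eq_integral_pi n
    (F := fun a w => Complex.exp ((τ * ∑ i, f (a i) (w i) : ℝ) * Complex.I))]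
  · refine integral_congr_ae (Eventually.of_forall fun ω => ?_)
    have e : ∀ w : Fin n → Pop k,
        Complex.exp ((τ * ∑ i, f (A n ω i) (w i) : ℝ) * Complex.I) =
        ∏ i, Complex.exp (τ * f (A n ω i) (w i) * Complex.I) := by
      intro w
      rw [← Complex.exp_sum]
      push_cast
      rw [Finset.mul_sum, Finset.sum_mul]
    simp only [e]
    rw [integral_fintype_prod_eq_prod
      (f := fun i (x : Pop k) => Complex.exp (τ * f (A n ω i) x * Complex.I))]
    refine Finset.prod_congr rfl fun i _ => ?_
    rw [charFun_apply_real, integral_map (hm _).aemeasurable (by fun_prop)]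
  · exact fun a => (Complex.measurable_exp.comp
      ((Complex.measurable_ofReal.comp (hFm a)).mul_const _)).stronglyMeasurable
  · refine Integrable.of_bound (Complex.measurable_exp.comp
      ((Complex.measurable_ofReal.comp hUm).mul_const _)).aestronglyMeasurable 1
      (Eventually.of_forall fun ω => hexp _)

/-- The central limit theorem under covariate-adaptive randomization, for summands whose
conditional mean given the stratum is the same in both arms. The sum splits into the stratum means,
which are independent and identically distributed, and the centered summands, which are
conditionally independent given strata and treatments; replacing the conditional characteristic
functions of the latter by Gaussian ones leaves a quantity that depends on the treatments only
through the group sizes. -/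
lemma tendsto_charFun_sum [IsProbabilityMeasure Pr] (hX : IsExperiment 𝒟 Q₀ Pr W A)
    {f : Bool → Pop k → ℝ} (hm : ∀ a, Measurable (f a)) (hf : ∀ a, MemLp (f a) 2 Q₀)
    {c : Fin 𝒟.numStrata → ℝ} (hc : ∀ a s, stratumMean 𝒟 Q₀ (f a) s = c s)
    (hc0 : ∑ s, Q₀.real (𝒟.stratumEvent s) * c s = 0) :
    Tendsto (fun n : ℕ => ∫ ω, Complex.exp (((√(n : ℝ))⁻¹ *
        ∑ i, f (A n ω i) (W i ω) : ℝ) * Complex.I) ∂Pr) atTop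
      (𝓝 (Real.exp
        (-(targetSum 𝒟 Q₀ fun a => stratumMean 𝒟 Q₀ fun w => f a w ^ 2) / 2) : ℝ)) := by
  have := hX.isProbabilityMeasure
  let V : Bool → Fin 𝒟.numStrata → ℝ := fun a s =>
    stratumMean 𝒟 Q₀ (fun w => stratumCentered 𝒟 Q₀ (f a) w ^ 2) s
  have hV0 : ∀ a s, 0 ≤ V a s := fun a s => integral_nonneg fun _ => sq_nonneg _
  let Φ : ℕ → Bool → Fin 𝒟.numStrata → ℂ := fun n a s =>
    charFun ((ProbabilityTheory.cond Q₀ (𝒟.stratumEvent s)).map (f a)) (√(n : ℝ))⁻¹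
  let Ψ : ℕ → Bool → Fin 𝒟.numStrata → ℂ := fun n a s =>
    charFun (gaussianReal (c s) (V a s).toNNReal) (√(n : ℝ))⁻¹
  -- the error of the Gaussian approximation in each arm and stratum; null strata, in which the
  -- conditional characteristic function is `0`, are discarded
  let e : ℕ → Bool → Fin 𝒟.numStrata → ℝ := fun n a s =>
    if Q₀ (𝒟.stratumEvent s) = 0 then 0 else n * ‖Φ n a s - Ψ n a s‖
  have he0 : ∀ n a s, 0 ≤ e n a s := by
    intro n a s
    simp only [e]
    split_ifs
    · exact le_rfl
    · positivity
  have he : Tendsto (fun n => ∑ a, ∑ s, e n a s) atTop (𝓝 0) := by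
    rw [show (0 : ℝ) = ∑ a : Bool, ∑ s : Fin 𝒟.numStrata, (0 : ℝ) by simp]
    refine tendsto_finsetSum _ fun a _ => tendsto_finsetSum _ fun s _ => ?_
    by_cases hs : Q₀ (𝒟.stratumEvent s) = 0
    · simp [e, hs]
    · have h := tendsto_charFun_stratum (hm a) (hf a) hs
      rw [hc a s] at h
      simpa only [e, hs, if_false] using h
  have hΦ1 : ∀ n a s, ‖Φ n a s‖ ≤ 1 := fun n a s => by
    by_cases hs : Q₀ (𝒟.stratumEvent s) = 0
    · simp [Φ, cond_eq_zero_of_meas_eq_zero hs, charFun]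
    · have := cond_isProbabilityMeasure hs
      have := Measure.isProbabilityMeasure_map
        (μ := ProbabilityTheory.cond Q₀ (𝒟.stratumEvent s)) (hm a).aemeasurable
      exact norm_charFun_le_one _
  have hΨ1 : ∀ n a s, ‖Ψ n a s‖ ≤ 1 := fun n a s => norm_charFun_le_one _
  have hmeas : ∀ (g : Bool → Fin 𝒟.numStrata → ℂ) (n : ℕ),
      Measurable fun ω => ∏ i, g (A n ω i) (𝒟.unitStratum (W i ω)) := fun g n =>
    Finset.measurable_fun_prod _ fun i _ => hX.measurable_unit
      (f := fun a w => g a (𝒟.unitStratum w))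
      (fun a => (measurable_of_finite (g a)).comp 𝒟.measurable_unitStratum) i
  have hprod1 : ∀ (g : Bool → Fin 𝒟.numStrata → ℂ), (∀ a s, ‖g a s‖ ≤ 1) → ∀ (n : ℕ) ω,
      ‖∏ i, g (A n ω i) (𝒟.unitStratum (W i ω))‖ ≤ 1 := by
    intro g hg n ω
    rw [norm_prod]
    exact Finset.prod_le_one (fun _ _ => norm_nonneg _) fun i _ => hg _ _
  have hint : ∀ (g : Bool → Fin 𝒟.numStrata → ℂ), (∀ a s, ‖g a s‖ ≤ 1) → ∀ n : ℕ,
      Integrable (fun ω => ∏ i, g (A n ω i) (𝒟.unitStratum (W i ω))) Pr := fun g hg n =>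
    Integrable.of_bound (hmeas g n).aestronglyMeasurable 1
      (Eventually.of_forall (hprod1 g hg n))
  -- replacing the conditional characteristic functions by Gaussian ones
  have hB : Tendsto (fun n : ℕ =>
      (∫ ω, ∏ i, Φ n (A n ω i) (𝒟.unitStratum (W i ω)) ∂Pr) -
        ∫ ω, ∏ i, Ψ n (A n ω i) (𝒟.unitStratum (W i ω)) ∂Pr) atTop (𝓝 0) := by
    refine squeeze_zero_norm (fun n => ?_) he
    rw [← integral_sub (hint _ (hΦ1 n) n) (hint _ (hΨ1 n) n)]
    refine (norm_integral_le_of_norm_le_const (C := ∑ a, ∑ s, e n a s) ?_).trans (by simp)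
    filter_upwards [hX.ae_stratum_ne_zero] with ω hω
    refine (norm_prod_sub_prod_le _ (fun i _ => hΦ1 n _ _) fun i _ => hΨ1 n _ _).trans ?_
    rcases Nat.eq_zero_or_pos n with rfl | hn
    · rw [Finset.univ_eq_empty, Finset.sum_empty]
      exact Finset.sum_nonneg fun a _ => Finset.sum_nonneg fun s _ => he0 0 a s
    have hn' : (0 : ℝ) < n := by exact_mod_cast hn
    calc ∑ i, ‖Φ n (A n ω i) (𝒟.unitStratum (W i ω)) - Ψ n (A n ω i) (𝒟.unitStratum (W i ω))‖
        ≤ ∑ i : Fin n, (n : ℝ)⁻¹ * ∑ a, ∑ s, e n a s := by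
          refine Finset.sum_le_sum fun i _ => ?_
          rw [le_inv_mul_iff₀ hn']
          have h1 : (n : ℝ) * ‖Φ n (A n ω i) (𝒟.unitStratum (W i ω)) -
              Ψ n (A n ω i) (𝒟.unitStratum (W i ω))‖ =
              e n (A n ω i) (𝒟.unitStratum (W i ω)) := by
            simp only [e, hω i, if_false]
          rw [h1]
          refine (Finset.single_le_sum (f := fun s => e n (A n ω i) s)
            (fun s _ => he0 n _ s) (Finset.mem_univ _)).trans ?_
          exact Finset.single_le_sum (f := fun a => ∑ s, e n a s)
            (fun a _ => Finset.sum_nonneg fun s _ => he0 n a s) (Finset.mem_univ _)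
      _ = ∑ a, ∑ s, e n a s := by
          rw [Finset.sum_const, Finset.card_univ, Fintype.card_fin, nsmul_eq_mul]
          field_simp
  -- half the conditional variance, the contribution of the stratum means, and half the limit of the
  -- conditional variance
  let x : ℕ → Ω → ℝ := fun n ω => 2⁻¹ * ((n : ℝ)⁻¹ * ∑ i, V (A n ω i) (𝒟.unitStratum (W i ω)))
  let z : ℕ → Ω → ℝ := fun n ω => (√(n : ℝ))⁻¹ * ∑ i : Fin n, c (𝒟.unitStratum (W i ω))
  let y : ℝ := 2⁻¹ * targetSum 𝒟 Q₀ V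
  have hy0 : 0 ≤ y := mul_nonneg (by norm_num) (Finset.sum_nonneg fun s _ =>
    mul_nonneg measureReal_nonneg (Finset.sum_nonneg fun a _ =>
      mul_nonneg (armTarget_nonneg a s) (hV0 a s)))
  have hx0 : ∀ n ω, 0 ≤ x n ω := fun n ω => mul_nonneg (by norm_num)
    (mul_nonneg (by positivity) (Finset.sum_nonneg fun i _ => hV0 _ _))
  have hΨ : ∀ n ω, ∏ i, Ψ n (A n ω i) (𝒟.unitStratum (W i ω)) =
      Complex.exp (z n ω * Complex.I) * (Real.exp (-x n ω) : ℝ) := by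
    intro n ω
    have hs : ((√(n : ℝ))⁻¹) ^ 2 = (n : ℝ)⁻¹ := by
      rw [inv_pow, Real.sq_sqrt (Nat.cast_nonneg n)]
    have hs' : (((√(n : ℝ))⁻¹ : ℝ) : ℂ) ^ 2 = ((n : ℝ)⁻¹ : ℝ) := by
      rw [← hs]; push_cast; ring
    simp only [Ψ, charFun_gaussianReal, hs', Real.coe_toNNReal _ (hV0 _ _)]
    rw [← Complex.exp_sum, Complex.ofReal_exp, ← Complex.exp_add, Finset.sum_sub_distrib]
    congr 1
    simp only [z, x]
    push_cast
    rw [Finset.mul_sum, Finset.sum_mul, sub_eq_add_neg, Finset.mul_sum, Finset.mul_sum]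
    congr 1
    rw [← Finset.sum_neg_distrib, ← Finset.sum_neg_distrib]
    exact Finset.sum_congr rfl fun i _ => by ring
  have hVC : ∀ a s, |V a s| ≤ ∑ a, ∑ s, V a s := by
    intro a s
    rw [abs_of_nonneg (hV0 a s)]
    refine (Finset.single_le_sum (f := fun s => V a s) (fun s _ => hV0 a s)
      (Finset.mem_univ s)).trans ?_
    exact Finset.single_le_sum (f := fun a => ∑ s, V a s)
      (fun a _ => Finset.sum_nonneg fun s _ => hV0 a s) (Finset.mem_univ a)
  have hxm : ∀ n, Measurable (x n) := fun n =>
    ((Finset.measurable_fun_sum _ fun i _ => hX.measurable_unit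
      (f := fun a w => V a (𝒟.unitStratum w))
      (fun a => measurable_comp_unitStratum (V a)) i).const_mul _).const_mul _
  have hzm : ∀ n, Measurable (z n) := fun n =>
    (Finset.measurable_fun_sum _ fun (i : Fin n) _ =>
      (measurable_comp_unitStratum c).comp (hX.measurable_pop i)).const_mul _
  have hx : TendstoInMeasure Pr (fun n ω => Real.exp (-x n ω) - Real.exp (-y)) atTop
      fun _ => 0 := by
    have h := hX.tendstoInMeasure_sum_strata (c := fun _ => V) (Eventually.of_forall fun _ => hVC)
    refine TendstoInMeasure.of_abs_le (TendstoInMeasure.bdd_mul_zero h (c := fun _ => 2⁻¹)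
      (Eventually.of_forall fun _ => le_rfl))
      (Eventually.of_forall fun n => Eventually.of_forall fun ω => ?_)
    refine (abs_exp_neg_sub_exp_neg_le (hx0 n ω) hy0).trans_eq ?_
    simp only [x, y]
    congr 1
    ring
  have hexpC : ∀ n ω, |Real.exp (-x n ω) - Real.exp (-y)| ≤ 1 := by
    intro n ω
    have h1 : Real.exp (-x n ω) ≤ 1 := Real.exp_le_one_iff.2 (by linarith [hx0 n ω])
    have h2 : Real.exp (-y) ≤ 1 := Real.exp_le_one_iff.2 (by linarith)
    rw [abs_le]
    constructor <;> linarith [Real.exp_pos (-x n ω), Real.exp_pos (-y)]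
  have hem : ∀ n, Measurable fun ω => Real.exp (-x n ω) := fun n =>
    Real.measurable_exp.comp (hxm n).neg
  have hxlim := TendstoInMeasure.tendsto_integral_abs hx
    (fun n => (hem n).sub_const _) hexpC
  have hzexp : ∀ n, Measurable fun ω => Complex.exp (z n ω * Complex.I) := fun n =>
    Complex.measurable_exp.comp ((Complex.measurable_ofReal.comp (hzm n)).mul_const _)
  have hzint : ∀ n, Integrable (fun ω => Complex.exp (z n ω * Complex.I)) Pr := fun n =>
    Integrable.of_bound (hzexp n).aestronglyMeasurable 1
      (Eventually.of_forall fun ω => (Complex.norm_exp_ofReal_mul_I _).le)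
  -- the conditional variances are asymptotically deterministic
  have hD : Tendsto (fun n : ℕ => (∫ ω, ∏ i, Ψ n (A n ω i) (𝒟.unitStratum (W i ω)) ∂Pr) -
      (∫ ω, Complex.exp (z n ω * Complex.I) ∂Pr) * (Real.exp (-y) : ℝ)) atTop (𝓝 0) := by
    refine squeeze_zero_norm (fun n => ?_) hxlim
    rw [← integral_mul_const, ← integral_sub (hint _ (hΨ1 n) n) ((hzint n).mul_const _)]
    refine (norm_integral_le_integral_norm _).trans_eq
      (integral_congr_ae (Eventually.of_forall fun ω => ?_))
    simp only [hΨ]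
    rw [← mul_sub, norm_mul, Complex.norm_exp_ofReal_mul_I, one_mul, ← Complex.ofReal_sub,
      Complex.norm_real, Real.norm_eq_abs]
  have hE := (hX.tendsto_charFun_sum_strata c hc0).mul_const ((Real.exp (-y) : ℝ) : ℂ)
  have hall := (hB.add hD).add hE
  rw [zero_add, zero_add, ← Complex.ofReal_mul, ← Real.exp_add] at hall
  -- within-stratum and between-stratum variances add up to the second moment
  have hvar : -(∑ s, Q₀.real (𝒟.stratumEvent s) * c s ^ 2) / 2 + -y =
      -(targetSum 𝒟 Q₀ fun a => stratumMean 𝒟 Q₀ fun w => f a w ^ 2) / 2 := by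
    have h : targetSum 𝒟 Q₀ V + ∑ s, Q₀.real (𝒟.stratumEvent s) * c s ^ 2 =
        targetSum 𝒟 Q₀ fun a => stratumMean 𝒟 Q₀ fun w => f a w ^ 2 := by
      simp only [targetSum]
      rw [← Finset.sum_add_distrib]
      refine Finset.sum_congr rfl fun s _ => ?_
      by_cases hs : Q₀ (𝒟.stratumEvent s) = 0
      · simp [Measure.real, hs]
      have h1 : ∀ a, V a s = stratumMean 𝒟 Q₀ (fun w => f a w ^ 2) s - c s ^ 2 := fun a => by
        rw [← hc a s]; exact stratumMean_stratumCentered_sq_eq (hf a) hs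
      simp only [h1, mul_sub, Finset.sum_sub_distrib]
      rw [← Finset.sum_mul, sum_armTarget]
      ring
    simp only [y]
    linarith
  rw [hvar] at hall
  refine hall.congr fun n => ?_
  rw [hX.integral_exp_sum_eq hm]
  simp only [Φ, z]
  ring

end IsExperiment
end Experiment
end CAR

/-! ### Quadratic expansion of a sum of log ratios -/

namespace CAR

/-- The Cauchy-Schwarz inequality for square-integrable real functions. -/
lemma integral_abs_mul_le {α : Type*} [MeasurableSpace α] {ν : Measure α} {f g : α → ℝ}
    (hf : MemLp f 2 ν) (hg : MemLp g 2 ν) :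
    ∫ x, |f x * g x| ∂ν ≤ √(∫ x, f x ^ 2 ∂ν) * √(∫ x, g x ^ 2 ∂ν) := by
  have h := integral_mul_norm_le_Lp_mul_Lq (μ := ν) (f := f) (g := g) (p := 2) (q := 2)
    Real.HolderConjugate.two_two (by simpa using hf) (by simpa using hg)
  simpa [Real.sqrt_eq_rpow, abs_mul] using h

lemma abs_two_mul_log_sub_le {x : ℝ} (hx : |x| ≤ 1 / 2) :
    |2 * Real.log (1 + x) - 2 * x + x ^ 2| ≤ 4 * |x| * x ^ 2 := by
  have h := Real.abs_log_sub_add_sum_range_le (x := -x) (by rw [abs_neg]; linarith) 2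
  simp only [Finset.sum_range_succ, Finset.range_zero, Finset.sum_empty, abs_neg] at h
  norm_num at h
  have h2 : |x| ^ 3 / (1 - |x|) ≤ 2 * |x| ^ 3 := by
    rw [div_le_iff₀ (by linarith)]
    nlinarith [pow_nonneg (abs_nonneg x) 3]
  have h3 : 2 * Real.log (1 + x) - 2 * x + x ^ 2 =
      2 * (-x + x ^ 2 / 2 + Real.log (1 + x)) := by ring
  have h4 : |x| ^ 3 = |x| * x ^ 2 := by rw [← sq_abs x]; ring
  rw [h3, abs_mul, abs_two]
  rw [h4] at h h2
  linarith [h.trans h2]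

section Experiment

variable {k : ℕ} {𝒟 : Design k} {Q₀ : Measure (Pop k)} {Ω : Type*} [MeasurableSpace Ω]
  {Pr : Measure Ω} {W : ℕ → Ω → Pop k} {A : (n : ℕ) → Ω → Fin n → Bool}

namespace IsExperiment

/-- Sums whose summands are `o(n⁻¹)` in mean, in both arms, are negligible whatever the treatments. -/
lemma tendstoInMeasure_sum_of_integral [IsProbabilityMeasure Pr]
    (hX : IsExperiment 𝒟 Q₀ Pr W A) {h : ℕ → Bool → Pop k → ℝ} (hm : ∀ n a, Measurable (h n a))
    (hi : ∀ n a, Integrable (h n a) Q₀)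
    (hlim : ∀ a, Tendsto (fun n : ℕ => (n : ℝ) * ∫ w, |h n a w| ∂Q₀) atTop (𝓝 0)) :
    TendstoInMeasure Pr (fun n ω => ∑ i, h n (A n ω i) (W i ω)) atTop fun _ => 0 := by
  have hlim' := tendsto_finsetSum (Finset.univ (α := Bool)) fun a _ => hlim a
  simp only [Finset.sum_const_zero] at hlim'
  refine tendstoInMeasure_of_integral_abs (Eventually.of_forall fun n =>
    integrable_finsetSum _ fun i _ => hX.integrable_unit (hm n) (hi n) i) ?_
  refine squeeze_zero (fun n => integral_nonneg fun _ => abs_nonneg _) (fun n => ?_) hlim'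
  rw [← Finset.mul_sum]
  refine le_trans ?_ (hX.integral_sum_le (f := fun a w => |h n a w|)
    (fun a => continuous_abs.measurable.comp (hm n a)) (fun a => (hi n a).abs)
    (fun a w => abs_nonneg _) n)
  exact integral_mono
    (integrable_finsetSum _ fun i _ => hX.integrable_unit (hm n) (hi n) i).abs
    (integrable_finsetSum _ fun i _ => (hX.integrable_unit (hm n) (hi n) i).abs)
    fun ω => Finset.abs_sum_le_sum_abs _ _

/-- Functions of the strata that are `o(n^{-1/2})` and whose mean is `o(n⁻¹)` have negligible sums:
this is where the independence of the strata across units is used. -/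
lemma tendstoInMeasure_sum_comp_unitStratum [IsProbabilityMeasure Pr]
    (hX : IsExperiment 𝒟 Q₀ Pr W A) {b : ℕ → Fin 𝒟.numStrata → ℝ}
    (hb : ∀ s, Tendsto (fun n : ℕ => √(n : ℝ) * b n s) atTop (𝓝 0))
    (hb' : Tendsto (fun n : ℕ => (n : ℝ) * ∑ s, Q₀.real (𝒟.stratumEvent s) * b n s) atTop (𝓝 0)) :
    TendstoInMeasure Pr (fun n ω => ∑ i : Fin n, b n (𝒟.unitStratum (W i ω))) atTop
      fun _ => 0 := by
  have := hX.isProbabilityMeasure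
  let X : ℕ → ℕ → Ω → ℝ := fun n i ω => b n (𝒟.unitStratum (W i ω))
  have hXL : ∀ n i, MemLp (X n i) 2 Pr := fun n i =>
    (memLp_comp_unitStratum (b n) 2).comp_measurePreserving ⟨hX.measurable_pop i, hX.law i⟩
  have hsq : ∀ n i, ∫ ω, X n i ω ^ 2 ∂Pr =
      ∑ s, Q₀.real (𝒟.stratumEvent s) * b n s ^ 2 := fun n i => by
    rw [hX.integral_pop ((measurable_comp_unitStratum (b n)).pow_const 2) i]
    exact integral_comp_unitStratum fun s => b n s ^ 2
  have hmean : ∀ n i, ∫ ω, X n i ω ∂Pr = ∑ s, Q₀.real (𝒟.stratumEvent s) * b n s := fun n i => by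
    rw [hX.integral_pop (measurable_comp_unitStratum (b n)) i, integral_comp_unitStratum]
  have hsum : ∀ n, MemLp (∑ i : Fin n, X n i) 2 Pr := fun n =>
    memLp_finsetSum' _ fun i _ => hXL n i
  have hvar : ∀ n, Var[∑ i : Fin n, X n i; Pr] ≤
      ∑ s, Q₀.real (𝒟.stratumEvent s) * (√(n : ℝ) * b n s) ^ 2 := by
    intro n
    rw [IndepFun.variance_sum (X := fun i : Fin n => X n i) (fun i _ => hXL n i)
      fun i _ j _ hij => (hX.indep.indepFun (i := (i : ℕ)) (j := (j : ℕ))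
        (Fin.val_injective.ne hij)).comp
        (measurable_comp_unitStratum (b n)) (measurable_comp_unitStratum (b n))]
    calc ∑ i : Fin n, Var[X n i; Pr] ≤ ∑ i : Fin n, ∫ ω, X n i ω ^ 2 ∂Pr :=
          Finset.sum_le_sum fun i _ =>
            variance_le_expectation_sq (hXL n i).aestronglyMeasurable
      _ = n * ∑ s, Q₀.real (𝒟.stratumEvent s) * b n s ^ 2 := by
          simp_rw [hsq]
          rw [Finset.sum_const, Finset.card_univ, Fintype.card_fin, nsmul_eq_mul]
      _ = _ := by
          rw [Finset.mul_sum]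
          refine Finset.sum_congr rfl fun s _ => ?_
          rw [mul_pow, Real.sq_sqrt (Nat.cast_nonneg n)]
          ring
  have hvlim : Tendsto (fun n : ℕ => ∑ s, Q₀.real (𝒟.stratumEvent s) * (√(n : ℝ) * b n s) ^ 2)
      atTop (𝓝 0) := by
    rw [show (0 : ℝ) = ∑ s, Q₀.real (𝒟.stratumEvent s) * (0 : ℝ) ^ 2 by simp]
    exact tendsto_finsetSum _ fun s _ => ((hb s).pow 2).const_mul _
  have hEsum : ∀ n, ∫ ω, (∑ i : Fin n, X n i) ω ∂Pr =
      n * ∑ s, Q₀.real (𝒟.stratumEvent s) * b n s := by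
    intro n
    simp only [Finset.sum_apply]
    rw [integral_finsetSum _ fun (i : Fin n) _ => (hXL n i).integrable one_le_two]
    simp_rw [hmean]
    rw [Finset.sum_const, Finset.card_univ, Fintype.card_fin, nsmul_eq_mul]
  have h1 : TendstoInMeasure Pr (fun (n : ℕ) ω => (∑ i : Fin n, X n i) ω -
      n * ∑ s, Q₀.real (𝒟.stratumEvent s) * b n s) atTop fun _ => 0 := by
    refine tendstoInMeasure_of_integral_sq (Eventually.of_forall fun n =>
      ((hsum n).sub (memLp_const _)).integrable_sq) ?_
    refine squeeze_zero (fun n => integral_nonneg fun _ => sq_nonneg _) (fun n => ?_) hvlim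
    refine le_trans (le_of_eq ?_) (hvar n)
    rw [variance_eq_integral (hsum n).aestronglyMeasurable.aemeasurable, hEsum]
  refine (TendstoInMeasure.add_zero h1 (tendstoInMeasure_of_tendsto hb')).congr_left
    fun n => Eventually.of_forall fun ω => ?_
  simp [X]

section Expansion

variable {ρ g : ℕ → Bool → Pop k → ℝ} {G : Bool → Pop k → ℝ}

lemma memLp_of_abs_le (hgm : ∀ n a, Measurable (g n a)) (hG : ∀ a, MemLp (G a) 2 Q₀)
    (hgG : ∀ n a w, |g n a w| ≤ G a w) (n : ℕ) (a : Bool) : MemLp (g n a) 2 Q₀ :=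
  (hG a).mono (hgm n a).aestronglyMeasurable (Eventually.of_forall fun w => by
    rw [Real.norm_eq_abs]
    exact (hgG n a w).trans (le_abs_self _))

/-- The largest increment of the root likelihood ratio is negligible. -/
lemma tendsto_measure_exists_le [IsProbabilityMeasure Pr] (hX : IsExperiment 𝒟 Q₀ Pr W A)
    (hρm : ∀ n a, Measurable (ρ n a)) (hgm : ∀ n a, Measurable (g n a))
    (hGm : ∀ a, Measurable (G a)) (hG : ∀ a, MemLp (G a) 2 Q₀)
    (hgG : ∀ n a w, |g n a w| ≤ G a w) (hρ : ∀ n a, MemLp (ρ n a) 2 Q₀)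
    (hr : ∀ a, Tendsto (fun n : ℕ => (n : ℝ) *
      ∫ w, (ρ n a w - (2 * √(n : ℝ))⁻¹ * g n a w) ^ 2 ∂Q₀) atTop (𝓝 0))
    {δ : ℝ} (hδ : 0 < δ) :
    Tendsto (fun n => Pr {ω | ∃ i, δ ≤ |ρ n (A n ω i) (W i ω)|}) atTop (𝓝 0) := by
  let f : ℕ → Bool → Pop k → ℝ := fun n a w => ρ n a w - (2 * √(n : ℝ))⁻¹ * g n a w
  have hfm : ∀ n a, Measurable (f n a) := fun n a => (hρm n a).sub ((hgm n a).const_mul _)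
  have hf : ∀ n a, MemLp (f n a) 2 Q₀ := fun n a =>
    (hρ n a).sub ((memLp_of_abs_le hgm hG hgG n a).const_mul _)
  -- the units whose linear part may exceed `δ / 2`
  let B : ℕ → Bool → Set (Pop k) := fun n a => {w | δ * √(n : ℝ) ≤ G a w}
  have hBm : ∀ n a, MeasurableSet (B n a) := fun n a => measurableSet_le measurable_const (hGm a)
  have hG2 : ∀ a, Integrable (fun w => G a w ^ 2) Q₀ := fun a => (hG a).integrable_sq
  have htail : ∀ a, Tendsto (fun n => ∫ w, (B n a).indicator (fun w => G a w ^ 2) w ∂Q₀) atTop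
      (𝓝 0) := by
    intro a
    rw [show (0 : ℝ) = ∫ w : Pop k, (0 : ℝ) ∂Q₀ by simp]
    refine tendsto_integral_of_dominated_convergence (fun w => G a w ^ 2)
      (fun n => (((hGm a).pow_const 2).indicator (hBm n a)).aestronglyMeasurable)
      (hG2 a) (fun n => Eventually.of_forall fun w => ?_) (Eventually.of_forall fun w => ?_)
    · rw [Real.norm_of_nonneg (Set.indicator_nonneg (fun _ _ => sq_nonneg _) _)]
      exact Set.indicator_le_self' (fun _ _ => sq_nonneg _) _
    · refine tendsto_const_nhds.congr' ?_
      have hlim : Tendsto (fun n : ℕ => δ * √(n : ℝ)) atTop atTop :=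
        (Real.tendsto_sqrt_atTop.comp tendsto_natCast_atTop_atTop).const_mul_atTop hδ
      filter_upwards [hlim.eventually_gt_atTop (G a w)] with n hn
      rw [Set.indicator_of_notMem]
      exact not_le.2 hn
  -- a nonnegative function, of order `o(n⁻¹)` in mean, that is at least `1` where `δ ≤ |ρ|`
  let h : ℕ → Bool → Pop k → ℝ := fun n a w =>
    4 * (δ ^ 2)⁻¹ * f n a w ^ 2 +
      (n : ℝ)⁻¹ * ((δ ^ 2)⁻¹ * (B n a).indicator (fun w => G a w ^ 2) w)
  have h0 : ∀ n a w, 0 ≤ h n a w := fun n a w => by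
    have : 0 ≤ (B n a).indicator (fun w => G a w ^ 2) w :=
      Set.indicator_nonneg (fun _ _ => sq_nonneg _) _
    positivity
  have hi1 : ∀ n a, Integrable (fun w => 4 * (δ ^ 2)⁻¹ * f n a w ^ 2) Q₀ := fun n a =>
    ((hf n a).integrable_sq).const_mul _
  have hi2 : ∀ (n : ℕ) a, Integrable (fun w =>
      (n : ℝ)⁻¹ * ((δ ^ 2)⁻¹ * (B n a).indicator (fun w => G a w ^ 2) w)) Q₀ := fun n a =>
    (((hG2 a).indicator (hBm n a)).const_mul _).const_mul _
  have hsum := hX.tendstoInMeasure_sum_of_integral (h := h)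
    (fun n a => (((hfm n a).pow_const 2).const_mul _).add
      (((((hGm a).pow_const 2).indicator (hBm n a)).const_mul _).const_mul _))
    (fun n a => (hi1 n a).add (hi2 n a)) (fun a => by
      have hl := ((hr a).const_mul (4 * (δ ^ 2)⁻¹)).add ((htail a).const_mul ((δ ^ 2)⁻¹))
      simp only [mul_zero, add_zero] at hl
      refine hl.congr' ?_
      filter_upwards [eventually_gt_atTop 0] with n hn
      have hn' : (n : ℝ) ≠ 0 := by exact_mod_cast hn.ne'
      simp_rw [fun w => abs_of_nonneg (h0 n a w)]
      simp only [h]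
      rw [integral_add (hi1 n a) (hi2 n a), integral_const_mul, integral_const_mul,
        integral_const_mul]
      change _ = (n : ℝ) * (4 * (δ ^ 2)⁻¹ * (∫ w, f n a w ^ 2 ∂Q₀) + _)
      rw [mul_add, mul_inv_cancel_left₀ hn']
      ring)
  refine tendsto_of_tendsto_of_tendsto_of_le_of_le' tendsto_const_nhds
    (tendstoInMeasure_zero_iff.1 hsum 1 one_pos) (Eventually.of_forall fun _ => zero_le) ?_
  filter_upwards [eventually_gt_atTop 0] with n hn
  have hn' : (0 : ℝ) < n := by exact_mod_cast hn
  have hsn : 0 < √(n : ℝ) := Real.sqrt_pos.2 hn'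
  refine measure_mono fun ω hω => ?_
  obtain ⟨i, hi⟩ := hω
  change 1 ≤ |∑ i, h n (A n ω i) (W i ω)|
  refine le_trans ?_ (le_abs_self _)
  refine le_trans ?_ (Finset.single_le_sum (f := fun i => h n (A n ω i) (W i ω))
    (fun i _ => h0 n _ _) (Finset.mem_univ i))
  set a := A n ω i
  set w := W i ω
  -- either the linearization error or the linear part accounts for half of `δ`
  by_cases hB : w ∈ B n a
  · have hGn : (δ * √(n : ℝ)) ^ 2 ≤ G a w ^ 2 := pow_le_pow_left₀ (by positivity) hB 2
    rw [mul_pow, Real.sq_sqrt hn'.le] at hGn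
    have h1 : 1 ≤ (n : ℝ)⁻¹ * ((δ ^ 2)⁻¹ * G a w ^ 2) := by
      rw [le_inv_mul_iff₀ hn', le_inv_mul_iff₀ (by positivity)]
      linarith
    simp only [h, Set.indicator_of_mem hB]
    have : 0 ≤ 4 * (δ ^ 2)⁻¹ * f n a w ^ 2 := by positivity
    linarith
  · have hlt : G a w < δ * √(n : ℝ) := not_le.1 hB
    have hg2 : |(2 * √(n : ℝ))⁻¹ * g n a w| ≤ δ / 2 := by
      rw [abs_mul, abs_of_pos (by positivity), inv_mul_le_iff₀ (by positivity)]
      linarith [hgG n a w]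
    have hf2 : δ / 2 ≤ |f n a w| := by
      have := abs_add_le (f n a w) ((2 * √(n : ℝ))⁻¹ * g n a w)
      simp only [f, sub_add_cancel] at this
      simp only [f]
      linarith
    have hf3 : (δ / 2) ^ 2 ≤ f n a w ^ 2 := by
      rw [← sq_abs (f n a w)]
      exact pow_le_pow_left₀ (by positivity) hf2 2
    have h1 : 1 ≤ 4 * (δ ^ 2)⁻¹ * f n a w ^ 2 := by
      rw [mul_comm 4, mul_assoc, le_inv_mul_iff₀ (by positivity)]
      linarith
    simp only [h, Set.indicator_of_notMem hB]
    linarith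

/-- The squared increments add up to a quarter of the stratified second moment of `g`. -/
lemma tendstoInMeasure_sum_sq [IsProbabilityMeasure Pr] (hX : IsExperiment 𝒟 Q₀ Pr W A)
    (hρm : ∀ n a, Measurable (ρ n a)) (hgm : ∀ n a, Measurable (g n a))
    (hGm : ∀ a, Measurable (G a)) (hG : ∀ a, MemLp (G a) 2 Q₀)
    (hgG : ∀ n a w, |g n a w| ≤ G a w) (hρ : ∀ n a, MemLp (ρ n a) 2 Q₀)
    (hr : ∀ a, Tendsto (fun n : ℕ => (n : ℝ) *
      ∫ w, (ρ n a w - (2 * √(n : ℝ))⁻¹ * g n a w) ^ 2 ∂Q₀) atTop (𝓝 0)) :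
    TendstoInMeasure Pr (fun n ω => ∑ i, ρ n (A n ω i) (W i ω) ^ 2 -
      4⁻¹ * targetSum 𝒟 Q₀ fun a => stratumMean 𝒟 Q₀ fun w => g n a w ^ 2) atTop fun _ => 0 := by
  let f : ℕ → Bool → Pop k → ℝ := fun n a w => ρ n a w - (2 * √(n : ℝ))⁻¹ * g n a w
  have hg : ∀ n a, MemLp (g n a) 2 Q₀ := memLp_of_abs_le hgm hG hgG
  have hf : ∀ n a, MemLp (f n a) 2 Q₀ := fun n a => (hρ n a).sub ((hg n a).const_mul _)
  have h1 := hX.tendstoInMeasure_sum_of_integral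
    (h := fun n a w => ρ n a w ^ 2 - ((2 * √(n : ℝ))⁻¹ * g n a w) ^ 2)
    (fun n a => ((hρm n a).pow_const 2).sub (((hgm n a).const_mul _).pow_const 2))
    (fun n a => (hρ n a).integrable_sq.sub ((hg n a).const_mul _).integrable_sq) (fun a => by
      have hl := (hr a).add ((((hr a).sqrt).mul_const √(∫ w, G a w ^ 2 ∂Q₀)))
      simp only [Real.sqrt_zero, zero_mul, add_zero] at hl
      refine squeeze_zero' (Eventually.of_forall fun n => mul_nonneg (Nat.cast_nonneg n)
        (integral_nonneg fun _ => abs_nonneg _)) ?_ hl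
      filter_upwards [eventually_gt_atTop 0] with n hn
      have hn' : (0 : ℝ) < n := by exact_mod_cast hn
      have hsn : 0 < √(n : ℝ) := Real.sqrt_pos.2 hn'
      have hfg : Integrable (fun w => |f n a w * g n a w|) Q₀ :=
        ((hf n a).integrable_mul (hg n a)).abs
      calc (n : ℝ) * ∫ w, |ρ n a w ^ 2 - ((2 * √(n : ℝ))⁻¹ * g n a w) ^ 2| ∂Q₀
          ≤ n * ∫ w, (f n a w ^ 2 + (√(n : ℝ))⁻¹ * |f n a w * g n a w|) ∂Q₀ := by
            refine mul_le_mul_of_nonneg_left (integral_mono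
              ((hρ n a).integrable_sq.sub ((hg n a).const_mul _).integrable_sq).abs
              ((hf n a).integrable_sq.add (hfg.const_mul _)) fun w => ?_) hn'.le
            have e : ρ n a w ^ 2 - ((2 * √(n : ℝ))⁻¹ * g n a w) ^ 2 =
                f n a w ^ 2 + (√(n : ℝ))⁻¹ * (f n a w * g n a w) := by
              simp only [f, mul_inv]
              ring
            change |ρ n a w ^ 2 - ((2 * √(n : ℝ))⁻¹ * g n a w) ^ 2| ≤ _
            rw [e]
            refine (abs_add_le _ _).trans (add_le_add (abs_of_nonneg (sq_nonneg _)).le ?_)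
            rw [abs_mul, abs_of_pos (inv_pos.2 hsn)]
        _ = n * ∫ w, f n a w ^ 2 ∂Q₀ + √(n : ℝ) * ∫ w, |f n a w * g n a w| ∂Q₀ := by
            rw [integral_add (hf n a).integrable_sq (hfg.const_mul _), integral_const_mul,
              mul_add, ← mul_assoc (n : ℝ)]
            congr 2
            rw [← div_eq_mul_inv, Real.div_sqrt]
        _ ≤ n * ∫ w, f n a w ^ 2 ∂Q₀ +
              √(n : ℝ) * (√(∫ w, f n a w ^ 2 ∂Q₀) * √(∫ w, G a w ^ 2 ∂Q₀)) := by
            refine add_le_add_right (mul_le_mul_of_nonneg_left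
              ((integral_abs_mul_le (hf n a) (hg n a)).trans ?_) hsn.le) _
            refine mul_le_mul_of_nonneg_left (Real.sqrt_le_sqrt ?_) (Real.sqrt_nonneg _)
            exact integral_mono (hg n a).integrable_sq (hG a).integrable_sq fun w =>
              sq_le_sq' (neg_le_of_abs_le (hgG n a w)) (le_of_abs_le (hgG n a w))
        _ = _ := by
            rw [← mul_assoc, ← Real.sqrt_mul hn'.le])
  have h2 := hX.tendstoInMeasure_average (f := fun n a w => g n a w ^ 2)
    (F := fun a w => G a w ^ 2) (fun n a => (hgm n a).pow_const 2)
    (fun a => (hGm a).pow_const 2) (fun a => (hG a).integrable_sq) (fun n a w => by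
      rw [abs_of_nonneg (sq_nonneg _)]
      exact sq_le_sq' (neg_le_of_abs_le (hgG n a w)) (le_of_abs_le (hgG n a w)))
  refine (TendstoInMeasure.add_zero h1 (TendstoInMeasure.bdd_mul_zero h2 (c := fun _ => 4⁻¹)
    (Eventually.of_forall fun _ => le_rfl))).congr_left
    fun n => Eventually.of_forall fun ω => ?_
  have e : ∀ x : ℝ, ((2 * √(n : ℝ))⁻¹ * x) ^ 2 = 4⁻¹ * (n : ℝ)⁻¹ * x ^ 2 := fun x => by
    rw [mul_pow, inv_pow, mul_pow, Real.sq_sqrt (Nat.cast_nonneg n), mul_inv]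
    norm_num
  simp only [e, Finset.sum_sub_distrib, ← Finset.mul_sum]
  ring

/-- The linearization errors `ρ - g / (2 √n)`, centered at their conditional means given the stratum,
have a negligible sum. The conditional means do not: the part `-e` adds up to minus an eighth of the
stratified second moment of `g`, whereas the part `b`, which is the same in both arms, is a function
of the strata alone and averages out across units. -/
lemma tendstoInMeasure_sum_linearization_error [IsProbabilityMeasure Pr]
    (hX : IsExperiment 𝒟 Q₀ Pr W A)
    (hρm : ∀ n a, Measurable (ρ n a)) (hgm : ∀ n a, Measurable (g n a))
    (hG : ∀ a, MemLp (G a) 2 Q₀)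
    (hgG : ∀ n a w, |g n a w| ≤ G a w) (hρ : ∀ n a, MemLp (ρ n a) 2 Q₀)
    (hr : ∀ a, Tendsto (fun n : ℕ => (n : ℝ) *
      ∫ w, (ρ n a w - (2 * √(n : ℝ))⁻¹ * g n a w) ^ 2 ∂Q₀) atTop (𝓝 0))
    {b : ℕ → Fin 𝒟.numStrata → ℝ} {e : ℕ → Bool → Fin 𝒟.numStrata → ℝ}
    (hc : ∀ (n : ℕ) a s, stratumMean 𝒟 Q₀ (fun w => ρ n a w - (2 * √(n : ℝ))⁻¹ * g n a w) s =
      b n s - e n a s)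
    (he : ∀ a s, Tendsto (fun n : ℕ => (n : ℝ) * e n a s -
      8⁻¹ * stratumMean 𝒟 Q₀ (fun w => g n a w ^ 2) s) atTop (𝓝 0))
    (hb : ∀ s, Tendsto (fun n : ℕ => √(n : ℝ) * b n s) atTop (𝓝 0))
    (hb' : Tendsto (fun n : ℕ => (n : ℝ) * ∑ s, Q₀.real (𝒟.stratumEvent s) * b n s) atTop (𝓝 0)) :
    TendstoInMeasure Pr (fun (n : ℕ) ω =>
      ∑ i, (ρ n (A n ω i) (W i ω) - (2 * √(n : ℝ))⁻¹ * g n (A n ω i) (W i ω)) +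
      8⁻¹ * targetSum 𝒟 Q₀ fun a => stratumMean 𝒟 Q₀ fun w => g n a w ^ 2) atTop
      fun _ => 0 := by
  have := hX.isProbabilityMeasure
  let f : ℕ → Bool → Pop k → ℝ := fun n a w => ρ n a w - (2 * √(n : ℝ))⁻¹ * g n a w
  have hg : ∀ n a, MemLp (g n a) 2 Q₀ := memLp_of_abs_le hgm hG hgG
  have hfm : ∀ n a, Measurable (f n a) := fun n a => (hρm n a).sub ((hgm n a).const_mul _)
  have hf : ∀ n a, MemLp (f n a) 2 Q₀ := fun n a => (hρ n a).sub ((hg n a).const_mul _)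
  have h1 : TendstoInMeasure Pr (fun n ω => ∑ i, stratumCentered 𝒟 Q₀ (f n (A n ω i)) (W i ω))
      atTop fun _ => 0 := by
    refine tendstoInMeasure_of_integral_sq (Eventually.of_forall fun n =>
      (memLp_finsetSum Finset.univ fun i _ => hX.memLp_unit
        (fun a => measurable_stratumCentered (hfm n a))
        (fun a => memLp_stratumCentered (hf n a)) i).integrable_sq) ?_
    have hl := tendsto_finsetSum (Finset.univ (α := Bool)) fun a _ => hr a
    simp only [Finset.sum_const_zero, ← Finset.mul_sum] at hl
    exact squeeze_zero (fun n => integral_nonneg fun _ => sq_nonneg _)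
      (fun n => hX.integral_sum_stratumCentered_sq_le (hfm n) (hf n) n) hl
  have h2 := hX.tendstoInMeasure_sum_comp_unitStratum hb hb'
  let m : ℕ → Bool → Fin 𝒟.numStrata → ℝ := fun n a => stratumMean 𝒟 Q₀ fun w => g n a w ^ 2
  have hm0 : ∀ n a s, 0 ≤ m n a s := fun n a s => stratumMean_sq_nonneg _ s
  let C : ℝ := ∑ a, ∑ s, stratumMean 𝒟 Q₀ (fun w => G a w ^ 2) s
  have hmC : ∀ n a s, m n a s ≤ C := by
    intro n a s
    have h0 : ∀ a s, 0 ≤ stratumMean 𝒟 Q₀ (fun w => G a w ^ 2) s := fun a s =>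
      stratumMean_sq_nonneg _ s
    have h3 : m n a s ≤ stratumMean 𝒟 Q₀ (fun w => G a w ^ 2) s :=
      integral_mono (memLp_cond (hg n a) _).integrable_sq (memLp_cond (hG a) _).integrable_sq
        fun w => sq_le_sq' (neg_le_of_abs_le (hgG n a w)) (le_of_abs_le (hgG n a w))
    refine h3.trans ((Finset.single_le_sum (f := fun s => stratumMean 𝒟 Q₀ (fun w => G a w ^ 2) s)
        (fun s _ => h0 a s) (Finset.mem_univ s)).trans ?_)
    exact Finset.single_le_sum (f := fun a => ∑ s, stratumMean 𝒟 Q₀ (fun w => G a w ^ 2) s)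
      (fun a _ => Finset.sum_nonneg fun s _ => h0 a s) (Finset.mem_univ a)
  have hbd : ∀ᶠ n : ℕ in atTop, ∀ a s, |(n : ℝ) * e n a s| ≤ 1 + 8⁻¹ * C := by
    refine eventually_all.2 fun a => eventually_all.2 fun s => ?_
    filter_upwards [((tendsto_zero_iff_abs_tendsto_zero _).1 (he a s)).eventually_le_const
      one_pos] with n hn
    simp only [Function.comp_apply] at hn
    have h3 := abs_add_le ((n : ℝ) * e n a s - 8⁻¹ * m n a s) (8⁻¹ * m n a s)
    rw [sub_add_cancel, abs_of_nonneg (mul_nonneg (by norm_num) (hm0 n a s))] at h3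
    linarith [hmC n a s]
  have h3 := hX.tendstoInMeasure_sum_strata (c := fun (n : ℕ) a s => (n : ℝ) * e n a s) hbd
  have h4 : Tendsto (fun n : ℕ => targetSum 𝒟 Q₀ (fun a s => (n : ℝ) * e n a s) -
      8⁻¹ * targetSum 𝒟 Q₀ (m n)) atTop (𝓝 0) := by
    have hl : Tendsto (fun n : ℕ => ∑ s, Q₀.real (𝒟.stratumEvent s) * ∑ a, 𝒟.armTarget a s *
        ((n : ℝ) * e n a s - 8⁻¹ * m n a s)) atTop
        (𝓝 (∑ s, Q₀.real (𝒟.stratumEvent s) * ∑ a, 𝒟.armTarget a s * 0)) :=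
      tendsto_finsetSum _ fun s _ => (tendsto_finsetSum _ fun a _ =>
        (he a s).const_mul _).const_mul _
    simp only [mul_zero, Finset.sum_const_zero] at hl
    refine hl.congr fun n => ?_
    rw [targetSum, targetSum, Finset.mul_sum, ← Finset.sum_sub_distrib]
    refine Finset.sum_congr rfl fun s _ => ?_
    simp only [mul_sub, Finset.sum_sub_distrib, Finset.mul_sum]
    congr 1
    exact Finset.sum_congr rfl fun a _ => by ring
  have h34 := TendstoInMeasure.add_zero h3 (tendstoInMeasure_of_tendsto h4)
  have h5 := TendstoInMeasure.bdd_mul_zero h34 (c := fun _ => -1)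
    (Eventually.of_forall fun _ => le_rfl)
  refine TendstoInMeasure.of_abs_le (TendstoInMeasure.add_zero
    (TendstoInMeasure.add_zero h1 h2) h5) ?_
  filter_upwards [eventually_gt_atTop 0] with n hn
  refine Eventually.of_forall fun ω => le_of_eq ?_
  have hn' : (n : ℝ) ≠ 0 := by exact_mod_cast hn.ne'
  have hcent : ∀ i : Fin n, stratumCentered 𝒟 Q₀ (f n (A n ω i)) (W i ω) =
      f n (A n ω i) (W i ω) - (b n (𝒟.unitStratum (W i ω)) -
        e n (A n ω i) (𝒟.unitStratum (W i ω))) := fun i => by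
    rw [stratumCentered]
    congr 1
    exact hc n _ _
  simp only [hcent, Finset.sum_sub_distrib, ← Finset.mul_sum, inv_mul_cancel_left₀ hn', f, m]
  congr 1
  ring

/-- The quadratic expansion of the log-likelihood ratio, written in terms of the increments `ρ` of
the root likelihood ratio and of its linearization `g / (2 √n)`. It combines
`2 log (1 + ρ) ≈ 2 ρ - ρ ^ 2` with the limits of the sums of `ρ - g / (2 √n)` and of `ρ ^ 2`, which
contribute `-1/4` each to the coefficient `-1/2` of the quadratic term. -/
lemma tendstoInMeasure_sum_log [IsProbabilityMeasure Pr] (hX : IsExperiment 𝒟 Q₀ Pr W A)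
    (hρm : ∀ n a, Measurable (ρ n a)) (hgm : ∀ n a, Measurable (g n a))
    (hGm : ∀ a, Measurable (G a)) (hG : ∀ a, MemLp (G a) 2 Q₀)
    (hgG : ∀ n a w, |g n a w| ≤ G a w) (hρ : ∀ n a, MemLp (ρ n a) 2 Q₀)
    (hr : ∀ a, Tendsto (fun n : ℕ => (n : ℝ) *
      ∫ w, (ρ n a w - (2 * √(n : ℝ))⁻¹ * g n a w) ^ 2 ∂Q₀) atTop (𝓝 0))
    {b : ℕ → Fin 𝒟.numStrata → ℝ} {e : ℕ → Bool → Fin 𝒟.numStrata → ℝ}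
    (hc : ∀ (n : ℕ) a s, stratumMean 𝒟 Q₀ (fun w => ρ n a w - (2 * √(n : ℝ))⁻¹ * g n a w) s =
      b n s - e n a s)
    (he : ∀ a s, Tendsto (fun n : ℕ => (n : ℝ) * e n a s -
      8⁻¹ * stratumMean 𝒟 Q₀ (fun w => g n a w ^ 2) s) atTop (𝓝 0))
    (hb : ∀ s, Tendsto (fun n : ℕ => √(n : ℝ) * b n s) atTop (𝓝 0))
    (hb' : Tendsto (fun n : ℕ => (n : ℝ) * ∑ s, Q₀.real (𝒟.stratumEvent s) * b n s) atTop (𝓝 0)) :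
    TendstoInMeasure Pr (fun (n : ℕ) ω =>
      ∑ i, 2 * Real.log (1 + ρ n (A n ω i) (W i ω)) -
      ((√(n : ℝ))⁻¹ * ∑ i, g n (A n ω i) (W i ω) -
      2⁻¹ * targetSum 𝒟 Q₀ fun a => stratumMean 𝒟 Q₀ fun w => g n a w ^ 2)) atTop
      fun _ => 0 := by
  have := hX.isProbabilityMeasure
  have hB := hX.tendstoInMeasure_sum_sq hρm hgm hGm hG hgG hρ hr
  have hC := hX.tendstoInMeasure_sum_linearization_error hρm hgm hG hgG hρ hr hc he hb hb'
  have hg : ∀ n a, MemLp (g n a) 2 Q₀ := memLp_of_abs_le hgm hG hgG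
  let T : ℕ → ℝ := fun n => targetSum 𝒟 Q₀ fun a => stratumMean 𝒟 Q₀ fun w => g n a w ^ 2
  let K : ℝ := targetSum 𝒟 Q₀ fun a => stratumMean 𝒟 Q₀ fun w => G a w ^ 2
  have hK0 : 0 ≤ K := Finset.sum_nonneg fun s _ => mul_nonneg measureReal_nonneg
    (Finset.sum_nonneg fun a _ => mul_nonneg (armTarget_nonneg a s) (stratumMean_sq_nonneg _ s))
  have hTK : ∀ n, T n ≤ K := fun n => Finset.sum_le_sum fun s _ =>
    mul_le_mul_of_nonneg_left (Finset.sum_le_sum fun a _ =>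
      mul_le_mul_of_nonneg_left (integral_mono (memLp_cond (hg n a) _).integrable_sq
        (memLp_cond (hG a) _).integrable_sq
        fun w => sq_le_sq' (neg_le_of_abs_le (hgG n a w)) (le_of_abs_le (hgG n a w)))
        (armTarget_nonneg a s)) measureReal_nonneg
  have hD : TendstoInMeasure Pr (fun (n : ℕ) ω =>
      ∑ i, (2 * Real.log (1 + ρ n (A n ω i) (W i ω)) - 2 * ρ n (A n ω i) (W i ω) +
        ρ n (A n ω i) (W i ω) ^ 2)) atTop fun _ => 0 := by
    rw [tendstoInMeasure_zero_iff]
    intro ε hε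
    -- off an event of vanishing probability all increments are at most `δ` and their squares
    -- add up to at most `K + 1`, so that the cubic error is at most `4 δ (K + 1) < ε`
    set δ : ℝ := min (1 / 2) (ε / (8 * (K + 1))) with hδ
    have hδ0 : 0 < δ := by positivity
    have hlim := (hX.tendsto_measure_exists_le hρm hgm hGm hG hgG hρ hr hδ0).add
      (tendstoInMeasure_zero_iff.1 hB 1 one_pos)
    rw [add_zero] at hlim
    refine tendsto_of_tendsto_of_tendsto_of_le_of_le tendsto_const_nhds hlim
      (fun _ => zero_le) fun n => ?_
    refine (measure_mono fun ω hω => ?_).trans (measure_union_le _ _)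
    by_contra hcon
    have hcon' : ¬ ((∃ i, δ ≤ |ρ n (A n ω i) (W i ω)|) ∨
        1 ≤ |∑ i, ρ n (A n ω i) (W i ω) ^ 2 - 4⁻¹ * T n|) := hcon
    rw [not_or, not_exists, not_le] at hcon'
    obtain ⟨h1, h2⟩ := hcon'
    have hS : ∑ i, ρ n (A n ω i) (W i ω) ^ 2 ≤ K + 1 := by
      have := (abs_lt.1 h2).2
      linarith [hTK n]
    have hω' : ε ≤ |∑ i, (2 * Real.log (1 + ρ n (A n ω i) (W i ω)) -
      2 * ρ n (A n ω i) (W i ω) + ρ n (A n ω i) (W i ω) ^ 2)| := hω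
    have h3 : |∑ i, (2 * Real.log (1 + ρ n (A n ω i) (W i ω)) -
        2 * ρ n (A n ω i) (W i ω) + ρ n (A n ω i) (W i ω) ^ 2)| ≤
        4 * δ * ∑ i, ρ n (A n ω i) (W i ω) ^ 2 := by
      refine (Finset.abs_sum_le_sum_abs _ _).trans ?_
      rw [Finset.mul_sum]
      refine Finset.sum_le_sum fun i _ => ?_
      have hi : |ρ n (A n ω i) (W i ω)| ≤ δ := (not_le.1 (h1 i)).le
      refine (abs_two_mul_log_sub_le (hi.trans (min_le_left _ _))).trans ?_
      gcongr
    have h4 : δ * (K + 1) ≤ ε / 8 := by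
      have h5 : δ ≤ ε / (8 * (K + 1)) := min_le_right _ _
      rw [le_div_iff₀ (by positivity)] at h5
      linarith
    nlinarith
  have hC2 := TendstoInMeasure.bdd_mul_zero hC (c := fun _ => 2)
    (Eventually.of_forall fun _ => le_rfl)
  have hB2 := TendstoInMeasure.bdd_mul_zero hB (c := fun _ => -1)
    (Eventually.of_forall fun _ => le_rfl)
  refine (TendstoInMeasure.add_zero (TendstoInMeasure.add_zero hD hC2) hB2).congr_left
    fun n => Eventually.of_forall fun ω => ?_
  simp only [Finset.sum_add_distrib, Finset.sum_sub_distrib, ← Finset.mul_sum, mul_inv]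
  ring

end Expansion

end IsExperiment
end Experiment
end CAR

/-! ### Differentiability in quadratic mean -/

namespace CAR

section QuadraticMean

variable {α : Type*} [MeasurableSpace α] {ν : Measure α} {d : ℕ}

/-- The root densities `p u`, indexed by the local parameter `u`, are differentiable in quadratic
mean at `u = 0` with derivative `D`. Square integrability of `p u` is required for small `u` only. -/
structure IsQMD (ν : Measure α) (p : EuclideanSpace ℝ (Fin d) → α → ℝ)
    (D : α → EuclideanSpace ℝ (Fin d)) : Prop where
  nonneg : ∀ u x, 0 ≤ p u x
  measurable_zero : Measurable (p 0)
  memLp : ∀ᶠ u in 𝓝 0, MemLp (p u) 2 ν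
  memLp_deriv : MemLp D 2 ν
  isLittleO : (fun u => ∫ x, (p u x - p 0 x - inner ℝ (D x) u) ^ 2 ∂ν) =o[𝓝 0] fun u => ‖u‖ ^ 2

namespace IsQMD

variable {p : EuclideanSpace ℝ (Fin d) → α → ℝ} {D : α → EuclideanSpace ℝ (Fin d)}

lemma memLp_inner (h : IsQMD ν p D) (u : EuclideanSpace ℝ (Fin d)) :
    MemLp (fun x => inner ℝ (D x) u) 2 ν :=
  h.memLp_deriv.inner_const u

lemma memLp_at_zero (h : IsQMD ν p D) : MemLp (p 0) 2 ν := h.memLp.self_of_nhds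

lemma memLp_remainder (h : IsQMD ν p D) {u : EuclideanSpace ℝ (Fin d)} (hu : MemLp (p u) 2 ν) :
    MemLp (fun x => p u x - p 0 x - inner ℝ (D x) u) 2 ν :=
  (hu.sub h.memLp_at_zero).sub (h.memLp_inner u)

lemma restrict (h : IsQMD ν p D) (s : Set α) : IsQMD (ν.restrict s) p D where
  nonneg := h.nonneg
  measurable_zero := h.measurable_zero
  memLp := h.memLp.mono fun _ hu => hu.restrict s
  memLp_deriv := h.memLp_deriv.restrict s
  isLittleO := by
    refine Asymptotics.IsBigO.trans_isLittleO (Asymptotics.IsBigO.of_bound 1 ?_) h.isLittleO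
    filter_upwards [h.memLp] with u hu
    rw [one_mul, Real.norm_of_nonneg (integral_nonneg fun _ => sq_nonneg _),
      Real.norm_of_nonneg (integral_nonneg fun _ => sq_nonneg _)]
    exact setIntegral_le_integral (h.memLp_remainder hu).integrable_sq
      (Eventually.of_forall fun _ => sq_nonneg _)

/-- Since root densities are nonnegative, the derivative has a sign in every direction where the
root density at zero vanishes. -/
lemma ae_inner_nonneg (h : IsQMD ν p D) (e : EuclideanSpace ℝ (Fin d)) :
    ∀ᵐ x ∂ν, p 0 x = 0 → 0 ≤ inner ℝ (D x) e := by
  let S : Set α := {x | p 0 x = 0}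
  have hS : MeasurableSet S := h.measurable_zero (measurableSet_singleton 0)
  -- the part of the derivative with the wrong sign bounds the remainder along `τ • e`
  let φ : α → ℝ := S.indicator fun x => (max (-inner ℝ (D x) e) 0) ^ 2
  have hmax : MemLp (fun x => max (-inner ℝ (D x) e) 0) 2 ν := (h.memLp_inner e).neg.pos_part
  have hφi : Integrable φ ν := hmax.integrable_sq.indicator hS
  have hφ0 : ∀ x, 0 ≤ φ x := fun x => Set.indicator_nonneg (fun _ _ => sq_nonneg _) x
  have ht : Tendsto (fun τ : ℝ => τ • e) (𝓝[>] 0) (𝓝 0) := by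
    have : Tendsto (fun τ : ℝ => τ • e) (𝓝 0) (𝓝 ((0 : ℝ) • e)) :=
      (continuous_id.smul continuous_const).tendsto 0
    rw [zero_smul] at this
    exact this.mono_left nhdsWithin_le_nhds
  have hle : ∀ᶠ τ : ℝ in 𝓝[>] 0, ∫ x, φ x ∂ν ≤
      (τ ^ 2)⁻¹ * ∫ x, (p (τ • e) x - p 0 x - inner ℝ (D x) (τ • e)) ^ 2 ∂ν := by
    filter_upwards [ht.eventually h.memLp, self_mem_nhdsWithin] with τ hτ hτ0
    have hτ0' : (0 : ℝ) < τ := hτ0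
    rw [le_inv_mul_iff₀ (by positivity), ← integral_const_mul]
    refine integral_mono (hφi.const_mul _) (h.memLp_remainder hτ).integrable_sq fun x => ?_
    by_cases hx : x ∈ S
    · have hx0 : p 0 x = 0 := hx
      simp only [φ, Set.indicator_of_mem hx, hx0, sub_zero, inner_smul_right]
      rw [← mul_pow]
      have hp := h.nonneg (τ • e) x
      rcases le_total 0 (inner ℝ (D x) e) with h0 | h0
      · rw [max_eq_right (by linarith), mul_zero, zero_pow two_ne_zero]
        exact sq_nonneg _
      · rw [max_eq_left (by linarith)]
        have : 0 ≤ τ * -inner ℝ (D x) e := mul_nonneg hτ0'.le (by linarith)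
        refine pow_le_pow_left₀ this ?_ 2
        linarith
    · simp only [φ, Set.indicator_of_notMem hx, mul_zero]
      exact sq_nonneg _
  have hlim : Tendsto (fun τ : ℝ => (τ ^ 2)⁻¹ *
      ∫ x, (p (τ • e) x - p 0 x - inner ℝ (D x) (τ • e)) ^ 2 ∂ν) (𝓝[>] 0) (𝓝 0) := by
    have h1 := h.isLittleO.comp_tendsto ht
    have h2 : ((fun u : EuclideanSpace ℝ (Fin d) => ‖u‖ ^ 2) ∘ fun τ : ℝ => τ • e) =O[𝓝[>] 0]
        fun τ : ℝ => τ ^ 2 := by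
      refine Asymptotics.IsBigO.of_bound (‖e‖ ^ 2) (Eventually.of_forall fun τ => ?_)
      simp only [Function.comp_apply, norm_smul, mul_pow, norm_pow, norm_mul, norm_norm]
      rw [mul_comm]
    refine ((h1.trans_isBigO h2).tendsto_div_nhds_zero).congr fun τ => ?_
    simp only [Function.comp_apply]
    rw [div_eq_inv_mul]
  have hzero : ∫ x, φ x ∂ν = 0 :=
    le_antisymm (ge_of_tendsto hlim hle) (integral_nonneg hφ0)
  filter_upwards [(integral_eq_zero_iff_of_nonneg hφ0 hφi).1 hzero] with x hx hx0
  have hxS : x ∈ S := hx0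
  simp only [φ, Set.indicator_of_mem hxS, Pi.zero_apply] at hx
  have := pow_eq_zero_iff (two_ne_zero) |>.1 hx
  have h2 := le_max_left (-inner ℝ (D x) e) 0
  linarith

/-- The derivative vanishes where the root density at zero vanishes. -/
lemma ae_deriv_eq_zero (h : IsQMD ν p D) : ∀ᵐ x ∂ν, p 0 x = 0 → D x = 0 := by
  have h1 := ae_all_iff.2 fun i : Fin d => h.ae_inner_nonneg (EuclideanSpace.single i 1)
  have h2 := ae_all_iff.2 fun i : Fin d => h.ae_inner_nonneg (-EuclideanSpace.single i 1)
  filter_upwards [h1, h2] with x hx1 hx2 hx0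
  ext i
  have e1 := hx1 i hx0
  have e2 := hx2 i hx0
  rw [inner_neg_right] at e2
  rw [EuclideanSpace.inner_single_right] at e1 e2
  simp at e1 e2
  simpa using le_antisymm e2 e1

lemma isLittleO_sqrt (h : IsQMD ν p D) :
    (fun u => √(∫ x, (p u x - p 0 x - inner ℝ (D x) u) ^ 2 ∂ν)) =o[𝓝 0] fun u => ‖u‖ := by
  rw [Asymptotics.isLittleO_iff]
  intro c hc
  filter_upwards [(Asymptotics.isLittleO_iff.1 h.isLittleO) (by positivity : 0 < c ^ 2)] with u hu
  rw [Real.norm_of_nonneg (Real.sqrt_nonneg _), norm_norm]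
  refine Real.sqrt_le_iff.2 ⟨by positivity, ?_⟩
  rw [mul_pow]
  refine (le_abs_self _).trans (hu.trans_eq ?_)
  rw [norm_pow, norm_norm]

lemma sqrt_integral_inner_sq_le (h : IsQMD ν p D) (u : EuclideanSpace ℝ (Fin d)) :
    √(∫ x, inner ℝ (D x) u ^ 2 ∂ν) ≤ √(∫ x, ‖D x‖ ^ 2 ∂ν) * ‖u‖ := by
  rw [← Real.sqrt_sq (norm_nonneg u), ← Real.sqrt_mul' _ (sq_nonneg _), ← integral_mul_const]
  refine Real.sqrt_le_sqrt (integral_mono (h.memLp_inner u).integrable_sq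
    (h.memLp_deriv.norm.integrable_sq.mul_const _) fun x => ?_)
  change inner ℝ (D x) u ^ 2 ≤ ‖D x‖ ^ 2 * ‖u‖ ^ 2
  rw [← mul_pow, ← sq_abs]
  exact pow_le_pow_left₀ (abs_nonneg _) (abs_real_inner_le_norm _ _) 2

/-- The squared Hellinger distance is, to second order, the quadratic form of the derivative. -/
lemma isLittleO_hellinger (h : IsQMD ν p D) :
    (fun u => ∫ x, (p u x - p 0 x) ^ 2 ∂ν - ∫ x, inner ℝ (D x) u ^ 2 ∂ν) =o[𝓝 0]
      fun u => ‖u‖ ^ 2 := by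
  have hcross : (fun u => √(∫ x, (p u x - p 0 x - inner ℝ (D x) u) ^ 2 ∂ν) *
      √(∫ x, inner ℝ (D x) u ^ 2 ∂ν)) =o[𝓝 0] fun u => ‖u‖ ^ 2 := by
    simp_rw [pow_two ‖_‖]
    refine h.isLittleO_sqrt.mul_isBigO (Asymptotics.IsBigO.of_bound (√(∫ x, ‖D x‖ ^ 2 ∂ν))
      (Eventually.of_forall fun u => ?_))
    rw [Real.norm_of_nonneg (Real.sqrt_nonneg _), norm_norm]
    exact h.sqrt_integral_inner_sq_le u
  refine Asymptotics.IsBigO.trans_isLittleO (Asymptotics.IsBigO.of_bound 1 ?_)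
    (h.isLittleO.add (hcross.const_mul_left 2))
  filter_upwards [h.memLp] with u hu
  have hr := h.memLp_remainder hu
  have hi := h.memLp_inner u
  have e : ∫ x, (p u x - p 0 x) ^ 2 ∂ν - ∫ x, inner ℝ (D x) u ^ 2 ∂ν =
      ∫ x, (p u x - p 0 x - inner ℝ (D x) u) ^ 2 ∂ν +
        2 * ∫ x, (p u x - p 0 x - inner ℝ (D x) u) * inner ℝ (D x) u ∂ν := by
    have hri : Integrable (fun x => (p u x - p 0 x - inner ℝ (D x) u) * inner ℝ (D x) u) ν :=
      hr.integrable_mul hi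
    have hd : Integrable (fun x => (p u x - p 0 x) ^ 2) ν :=
      (hu.sub h.memLp_at_zero).integrable_sq
    rw [← integral_const_mul, ← integral_add hr.integrable_sq (hri.const_mul 2),
      ← integral_sub hd hi.integrable_sq]
    exact integral_congr_ae (Eventually.of_forall fun x => by ring)
  rw [e, one_mul, Real.norm_eq_abs, Real.norm_of_nonneg (by positivity)]
  refine (abs_add_le _ _).trans (add_le_add (abs_of_nonneg
    (integral_nonneg fun _ => sq_nonneg _)).le ?_)
  rw [abs_mul, abs_two]
  refine mul_le_mul_of_nonneg_left ?_ zero_le_two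
  exact (abs_integral_le_integral_abs).trans (integral_abs_mul_le hr hi)

/-- The first-order expansion of the total mass. -/
lemma isLittleO_mass (h : IsQMD ν p D) :
    (fun u => ∫ x, p u x ^ 2 ∂ν - ∫ x, p 0 x ^ 2 ∂ν - 2 * ∫ x, p 0 x * inner ℝ (D x) u ∂ν)
      =o[𝓝 0] fun u => ‖u‖ := by
  have hsq : (fun u : EuclideanSpace ℝ (Fin d) => ‖u‖ ^ 2) =o[𝓝 0] fun u => ‖u‖ := by
    have h1 : (fun u : EuclideanSpace ℝ (Fin d) => ‖u‖) =o[𝓝 0] fun _ => (1 : ℝ) :=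
      (Asymptotics.isLittleO_one_iff ℝ).2 tendsto_norm_zero
    simpa [pow_two] using h1.mul_isBigO (Asymptotics.isBigO_refl (fun u => ‖u‖) _)
  have hin : (fun u => ∫ x, inner ℝ (D x) u ^ 2 ∂ν) =O[𝓝 0] fun u => ‖u‖ ^ 2 := by
    refine Asymptotics.IsBigO.of_bound (√(∫ x, ‖D x‖ ^ 2 ∂ν) ^ 2)
      (Eventually.of_forall fun u => ?_)
    rw [Real.norm_of_nonneg (integral_nonneg fun _ => sq_nonneg _), norm_pow, norm_norm,
      ← mul_pow, ← Real.sq_sqrt (integral_nonneg fun x => sq_nonneg (inner ℝ (D x) u))]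
    exact pow_le_pow_left₀ (Real.sqrt_nonneg _) (h.sqrt_integral_inner_sq_le u) 2
  have hH : (fun u => ∫ x, (p u x - p 0 x) ^ 2 ∂ν) =o[𝓝 0] fun u => ‖u‖ := by
    have := (h.isLittleO_hellinger.isBigO.add hin).trans_isLittleO hsq
    simpa using this
  refine Asymptotics.IsBigO.trans_isLittleO (Asymptotics.IsBigO.of_bound 1 ?_)
    (hH.add ((h.isLittleO_sqrt.const_mul_left (2 * √(∫ x, p 0 x ^ 2 ∂ν)))))
  filter_upwards [h.memLp] with u hu
  have hr := h.memLp_remainder hu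
  have hi := h.memLp_inner u
  have h0 := h.memLp_at_zero
  have e : ∫ x, p u x ^ 2 ∂ν - ∫ x, p 0 x ^ 2 ∂ν - 2 * ∫ x, p 0 x * inner ℝ (D x) u ∂ν =
      ∫ x, (p u x - p 0 x) ^ 2 ∂ν +
        2 * ∫ x, p 0 x * (p u x - p 0 x - inner ℝ (D x) u) ∂ν := by
    have hr0 : Integrable (fun x => p 0 x * (p u x - p 0 x - inner ℝ (D x) u)) ν :=
      h0.integrable_mul hr
    have hi0 : Integrable (fun x => p 0 x * inner ℝ (D x) u) ν := h0.integrable_mul hi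
    have hd : Integrable (fun x => (p u x - p 0 x) ^ 2) ν := (hu.sub h0).integrable_sq
    have hd2 : Integrable (fun x => p u x ^ 2 - p 0 x ^ 2) ν :=
      hu.integrable_sq.sub h0.integrable_sq
    rw [← integral_const_mul, ← integral_const_mul, ← integral_add hd (hr0.const_mul 2),
      ← integral_sub hu.integrable_sq h0.integrable_sq, ← integral_sub hd2 (hi0.const_mul 2)]
    exact integral_congr_ae (Eventually.of_forall fun x => by ring)
  rw [e, one_mul, Real.norm_eq_abs, Real.norm_of_nonneg (by positivity)]
  refine (abs_add_le _ _).trans (add_le_add (abs_of_nonneg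
    (integral_nonneg fun _ => sq_nonneg _)).le ?_)
  rw [abs_mul, abs_two, mul_assoc]
  refine mul_le_mul_of_nonneg_left ?_ zero_le_two
  exact (abs_integral_le_integral_abs).trans (integral_abs_mul_le h0 hr)

lemma integrable_smul_deriv (h : IsQMD ν p D) : Integrable (fun x => p 0 x • D x) ν :=
  memLp_one_iff_integrable.1 (h.memLp_deriv.smul (r := 1) h.memLp_at_zero)

lemma integral_mul_inner (h : IsQMD ν p D) (u : EuclideanSpace ℝ (Fin d)) :
    ∫ x, p 0 x * inner ℝ (D x) u ∂ν = inner ℝ (∫ x, p 0 x • D x ∂ν) u := by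
  rw [real_inner_comm, ← integral_inner h.integrable_smul_deriv]
  exact integral_congr_ae (Eventually.of_forall fun x => by
    simp only [inner_smul_right, real_inner_comm])

/-- The total mass is differentiable at zero. -/
lemma hasFDerivAt_mass (h : IsQMD ν p D) :
    HasFDerivAt (fun u => ∫ x, p u x ^ 2 ∂ν) (innerSL ℝ ((2 : ℝ) • ∫ x, p 0 x • D x ∂ν)) 0 := by
  rw [hasFDerivAt_iff_isLittleO_nhds_zero, ← Asymptotics.isLittleO_norm_right]
  refine h.isLittleO_mass.congr_left fun u => ?_
  rw [h.integral_mul_inner, zero_add, innerSL_apply_apply, real_inner_smul_left]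

/-- If the root density at zero vanishes, the mass is of smaller order than `‖u‖ ^ 2`. -/
lemma isLittleO_mass_of_ae_eq_zero (h : IsQMD ν p D) (h0 : ∀ᵐ x ∂ν, p 0 x = 0) :
    (fun u => ∫ x, p u x ^ 2 ∂ν) =o[𝓝 0] fun u => ‖u‖ ^ 2 := by
  refine h.isLittleO.congr_left fun u => integral_congr_ae ?_
  filter_upwards [h0, h.ae_deriv_eq_zero] with x hx hD
  simp [hx, hD hx]

end IsQMD

/-- Two mass functions with the same values near zero have the same derivative. -/
lemma integral_smul_deriv_eq {β : Type*} [MeasurableSpace β] {ν' : Measure β}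
    {p : EuclideanSpace ℝ (Fin d) → α → ℝ} {D : α → EuclideanSpace ℝ (Fin d)}
    {p' : EuclideanSpace ℝ (Fin d) → β → ℝ} {D' : β → EuclideanSpace ℝ (Fin d)}
    (h : IsQMD ν p D) (h' : IsQMD ν' p' D')
    (heq : ∀ᶠ u in 𝓝 0, ∫ x, p u x ^ 2 ∂ν = ∫ x, p' u x ^ 2 ∂ν') :
    ∫ x, p 0 x • D x ∂ν = ∫ x, p' 0 x • D' x ∂ν' := by
  have h1 := h.hasFDerivAt_mass.unique
    (h'.hasFDerivAt_mass.congr_of_eventuallyEq heq)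
  have h2 := (innerSL ℝ (E := EuclideanSpace ℝ (Fin d))).map_sub
    ((2 : ℝ) • ∫ x, p 0 x • D x ∂ν) ((2 : ℝ) • ∫ x, p' 0 x • D' x ∂ν')
  rw [h1, sub_self] at h2
  have h3 := DFunLike.congr_fun h2
    ((2 : ℝ) • ∫ x, p 0 x • D x ∂ν - (2 : ℝ) • ∫ x, p' 0 x • D' x ∂ν')
  rw [innerSL_apply_apply, zero_apply, inner_self_eq_zero, sub_eq_zero] at h3
  exact smul_right_injective _ two_ne_zero h3

lemma integral_smul_deriv_eq_zero {p : EuclideanSpace ℝ (Fin d) → α → ℝ}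
    {D : α → EuclideanSpace ℝ (Fin d)} (h : IsQMD ν p D)
    (hone : ∀ᶠ u in 𝓝 0, ∫ x, p u x ^ 2 ∂ν = 1) : ∫ x, p 0 x • D x ∂ν = 0 := by
  have h1 := h.hasFDerivAt_mass.unique
    ((hasFDerivAt_const (1 : ℝ) _).congr_of_eventuallyEq hone)
  have h3 := DFunLike.congr_fun h1 ((2 : ℝ) • ∫ x, p 0 x • D x ∂ν)
  rw [innerSL_apply_apply, zero_apply, inner_self_eq_zero] at h3
  exact (smul_eq_zero.1 h3).resolve_left two_ne_zero

lemma tendsto_inv_sqrt_smul {t : ℕ → EuclideanSpace ℝ (Fin d)} {C : ℝ} (ht : ∀ n, ‖t n‖ ≤ C) :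
    Tendsto (fun n : ℕ => (√(n : ℝ))⁻¹ • t n) atTop (𝓝 0) := by
  have hlim : Tendsto (fun n : ℕ => (√(n : ℝ))⁻¹) atTop (𝓝 0) :=
    tendsto_inv_atTop_zero.comp (Real.tendsto_sqrt_atTop.comp tendsto_natCast_atTop_atTop)
  refine squeeze_zero_norm (fun n => ?_) (by simpa using hlim.mul_const C)
  rw [norm_smul, Real.norm_of_nonneg (by positivity)]
  exact mul_le_mul_of_nonneg_left (ht n) (by positivity)

lemma tendsto_nat_mul_of_isLittleO {f : EuclideanSpace ℝ (Fin d) → ℝ}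
    (hf : f =o[𝓝 0] fun u => ‖u‖ ^ 2) {t : ℕ → EuclideanSpace ℝ (Fin d)} {C : ℝ}
    (ht : ∀ n, ‖t n‖ ≤ C) :
    Tendsto (fun n : ℕ => (n : ℝ) * f ((√(n : ℝ))⁻¹ • t n)) atTop (𝓝 0) := by
  have h1 := hf.comp_tendsto (tendsto_inv_sqrt_smul ht)
  have h2 : ((fun u : EuclideanSpace ℝ (Fin d) => ‖u‖ ^ 2) ∘ fun n : ℕ => (√(n : ℝ))⁻¹ • t n)
      =O[atTop] fun n : ℕ => (n : ℝ)⁻¹ := by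
    refine Asymptotics.IsBigO.of_bound (C ^ 2) (Eventually.of_forall fun n => ?_)
    simp only [Function.comp_apply, norm_smul, norm_pow, norm_mul, norm_norm, norm_inv]
    rw [mul_pow, inv_pow, Real.norm_of_nonneg (Real.sqrt_nonneg _),
      Real.sq_sqrt (Nat.cast_nonneg n), Real.norm_of_nonneg (Nat.cast_nonneg n), mul_comm]
    gcongr
    exact ht n
  refine ((h1.trans_isBigO h2).tendsto_div_nhds_zero).congr fun n => ?_
  simp only [Function.comp_apply]
  rw [div_inv_eq_mul, mul_comm]

lemma tendsto_sqrt_mul_of_isLittleO {f : EuclideanSpace ℝ (Fin d) → ℝ}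
    (hf : f =o[𝓝 0] fun u => ‖u‖) {t : ℕ → EuclideanSpace ℝ (Fin d)} {C : ℝ}
    (ht : ∀ n, ‖t n‖ ≤ C) :
    Tendsto (fun n : ℕ => √(n : ℝ) * f ((√(n : ℝ))⁻¹ • t n)) atTop (𝓝 0) := by
  have h1 := hf.comp_tendsto (tendsto_inv_sqrt_smul ht)
  have h2 : ((fun u : EuclideanSpace ℝ (Fin d) => ‖u‖) ∘ fun n : ℕ => (√(n : ℝ))⁻¹ • t n)
      =O[atTop] fun n : ℕ => (√(n : ℝ))⁻¹ := by
    refine Asymptotics.IsBigO.of_bound C (Eventually.of_forall fun n => ?_)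
    simp only [Function.comp_apply, norm_smul, norm_mul, norm_norm]
    rw [mul_comm]
    gcongr
    exact ht n
  refine ((h1.trans_isBigO h2).tendsto_div_nhds_zero).congr fun n => ?_
  simp only [Function.comp_apply]
  rw [div_inv_eq_mul, mul_comm]

end QuadraticMean
end CAR

/-! ### Score and Hellinger expansions of the submodel by stratum -/

namespace CAR

section Arms

variable {k : ℕ} {𝒟 : Design k} {μ : Bool → Measure ℝ} {μZ : Measure (Fin k → ℝ)}
  {Q : Measure (Pop k)} {q : Bool → ℝ × (Fin k → ℝ) → ℝ}

/-- The values of `(Y(a), Z)` with `𝕊(Z) = s`. -/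
def Design.armStratum (𝒟 : Design k) (s : Fin 𝒟.numStrata) : Set (ℝ × (Fin k → ℝ)) :=
  {x | 𝒟.stratum x.2 = s}

lemma Design.measurableSet_armStratum (s : Fin 𝒟.numStrata) : MeasurableSet (𝒟.armStratum s) :=
  (𝒟.measurable_stratum.comp measurable_snd) (measurableSet_singleton s)

namespace HasArmDensities

lemma setIntegral_arm (h : HasArmDensities μ μZ Q q) (a : Bool) {f : ℝ × (Fin k → ℝ) → ℝ}
    (hf : Measurable f) {B : Set (ℝ × (Fin k → ℝ))} (hB : MeasurableSet B) :
    ∫ w in arm a ⁻¹' B, f (arm a w) ∂Q = ∫ x in B, q a x * f x ∂(armMeasure μ μZ a) := by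
  rw [← setIntegral_map hB hf.aestronglyMeasurable (measurable_arm a).aemeasurable,
    (h a).2.2, setIntegral_withDensity_eq_setIntegral_toReal_smul
      (h a).1.ennreal_ofReal (Eventually.of_forall fun _ => ENNReal.ofReal_lt_top) _ hB]
  exact integral_congr_ae (Eventually.of_forall fun x => by
    simp only [ENNReal.toReal_ofReal ((h a).2.1 x), smul_eq_mul])

lemma integral_arm (h : HasArmDensities μ μZ Q q) (a : Bool) {f : ℝ × (Fin k → ℝ) → ℝ}
    (hf : Measurable f) :
    ∫ w, f (arm a w) ∂Q = ∫ x, q a x * f x ∂(armMeasure μ μZ a) := by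
  simpa using h.setIntegral_arm a hf MeasurableSet.univ

lemma integrable_arm_iff (h : HasArmDensities μ μZ Q q) (a : Bool) {f : ℝ × (Fin k → ℝ) → ℝ}
    (hf : Measurable f) :
    Integrable (fun w => f (arm a w)) Q ↔
      Integrable (fun x => q a x * f x) (armMeasure μ μZ a) := by
  have h1 := integrable_map_measure (μ := Q) (f := arm a) (g := f) hf.aestronglyMeasurable
    (measurable_arm a).aemeasurable
  rw [(h a).2.2, integrable_withDensity_iff_integrable_smul' (h a).1.ennreal_ofReal
    (Eventually.of_forall fun _ => ENNReal.ofReal_lt_top)] at h1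
  refine h1.symm.trans (integrable_congr (Eventually.of_forall fun x => ?_))
  simp only [ENNReal.toReal_ofReal ((h a).2.1 x), smul_eq_mul]

lemma ae_pos (h : HasArmDensities μ μZ Q q) (a : Bool) : ∀ᵐ w ∂Q, 0 < q a (arm a w) := by
  have h1 : ∀ᵐ x ∂((armMeasure μ μZ a).withDensity fun x => ENNReal.ofReal (q a x)),
      0 < q a x := by
    rw [ae_withDensity_iff (h a).1.ennreal_ofReal]
    exact Eventually.of_forall fun x hx => ENNReal.ofReal_pos.1 (pos_iff_ne_zero.2 hx)
  rw [← (h a).2.2] at h1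
  exact ae_of_ae_map (measurable_arm a).aemeasurable h1

lemma integrable [IsFiniteMeasure Q] (h : HasArmDensities μ μZ Q q) (a : Bool) :
    Integrable (q a) (armMeasure μ μZ a) := by
  simpa using (h.integrable_arm_iff a (f := fun _ => 1) measurable_const).1 (integrable_const 1)

lemma setIntegral_armStratum (h : HasArmDensities μ μZ Q q) (a : Bool) (s : Fin 𝒟.numStrata) :
    ∫ x in 𝒟.armStratum s, q a x ∂(armMeasure μ μZ a) = Q.real (𝒟.stratumEvent s) := by
  have h1 := h.setIntegral_arm a (f := fun _ => 1) measurable_const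
    (𝒟.measurableSet_armStratum s)
  simp only [mul_one] at h1
  rw [← h1, setIntegral_const, smul_eq_mul, mul_one]
  rfl

lemma ae_restrict_armStratum_eq_zero (h : HasArmDensities μ μZ Q q) (a : Bool)
    {s : Fin 𝒟.numStrata} (hs : Q (𝒟.stratumEvent s) = 0) :
    ∀ᵐ x ∂((armMeasure μ μZ a).restrict (𝒟.armStratum s)), q a x = 0 := by
  have h1 : Q.map (arm a) (𝒟.armStratum s) = 0 := by
    rw [Measure.map_apply (measurable_arm a) (𝒟.measurableSet_armStratum s)]
    exact hs
  rw [(h a).2.2, withDensity_apply _ (𝒟.measurableSet_armStratum s),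
    lintegral_eq_zero_iff (h a).1.ennreal_ofReal] at h1
  filter_upwards [h1] with x hx
  exact le_antisymm (ENNReal.ofReal_eq_zero.1 hx) ((h a).2.1 x)

end HasArmDensities

end Arms

namespace ParametricSubmodel

variable {k : ℕ} {𝒟 : Design k} {μ : Bool → Measure ℝ} {μZ : Measure (Fin k → ℝ)}
  {Q₀ : Measure (Pop k)} {d : ℕ} (M : ParametricSubmodel 𝒟 μ μZ Q₀ d)
  {D : Bool → ℝ × (Fin k → ℝ) → EuclideanSpace ℝ (Fin d)}

/-- The root density of arm `a` at the parameter `θ₀ + u`. -/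
noncomputable def root (a : Bool) (u : EuclideanSpace ℝ (Fin d)) (x : ℝ × (Fin k → ℝ)) : ℝ :=
  √(M.q a (M.θ₀ + u) x)

lemma isProbabilityMeasure_truth (M : ParametricSubmodel 𝒟 μ μZ Q₀ d) :
    IsProbabilityMeasure Q₀ := M.truth_mem.1

variable {M}

lemma root_zero (a : Bool) (x : ℝ × (Fin k → ℝ)) : M.root a 0 x = √(M.q a M.θ₀ x) := by
  rw [root, add_zero]

lemma sq_root_zero (a : Bool) (x : ℝ × (Fin k → ℝ)) : M.root a 0 x ^ 2 = M.q a M.θ₀ x := by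
  rw [root_zero, Real.sq_sqrt ((M.truth a).2.1 x)]

lemma measurable_root {u : EuclideanSpace ℝ (Fin d)} (hu : M.θ₀ + u ∈ M.Θ) (a : Bool) :
    Measurable (M.root a u) := by
  obtain ⟨Q, -, hQ⟩ := M.population _ hu
  exact (hQ a).1.sqrt

/-- Both arms assign the same mass to every stratum, the probability of the stratum under the
population distribution at the parameter `θ₀ + u`. -/
lemma exists_integral_root_sq {u : EuclideanSpace ℝ (Fin d)} (hu : M.θ₀ + u ∈ M.Θ) :
    ∃ Q : Measure (Pop k), IsProbabilityMeasure Q ∧ ∀ a s,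
      ∫ x in 𝒟.armStratum s, M.root a u x ^ 2 ∂(armMeasure μ μZ a) =
        Q.real (𝒟.stratumEvent s) := by
  obtain ⟨Q, hQ, hQd⟩ := M.population _ hu
  refine ⟨Q, hQ.1, fun a s => ?_⟩
  rw [← hQd.setIntegral_armStratum a s]
  exact integral_congr_ae (Eventually.of_forall fun x => Real.sq_sqrt ((hQd a).2.1 x))

lemma memLp_root {u : EuclideanSpace ℝ (Fin d)} (hu : M.θ₀ + u ∈ M.Θ) (a : Bool) :
    MemLp (M.root a u) 2 (armMeasure μ μZ a) := by
  obtain ⟨Q, hQ, hQd⟩ := M.population _ hu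
  have := hQ.1
  rw [memLp_two_iff_integrable_sq (measurable_root hu a).aestronglyMeasurable]
  exact (hQd.integrable a).congr (Eventually.of_forall fun x =>
    (Real.sq_sqrt ((hQd a).2.1 x)).symm)

lemma eventually_mem (hM : M.IsRegular D) : ∀ᶠ u in 𝓝 0, M.θ₀ + u ∈ M.Θ := by
  have h : Tendsto (fun u => M.θ₀ + u) (𝓝 0) (𝓝 (M.θ₀ + 0)) :=
    (continuous_const.add continuous_id).tendsto 0
  rw [add_zero] at h
  exact h.eventually (hM.isOpen.mem_nhds M.θ₀_mem)

lemma isQMD (hM : M.IsRegular D) (a : Bool) : IsQMD (armMeasure μ μZ a) (M.root a) (D a) where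
  nonneg u x := Real.sqrt_nonneg _
  measurable_zero := measurable_root (by rw [add_zero]; exact M.θ₀_mem) a
  memLp := (eventually_mem hM).mono fun u hu => memLp_root hu a
  memLp_deriv := hM.memLp a
  isLittleO := by
    rw [← nhdsNE_sup_pure]
    refine Asymptotics.IsLittleO.sup ?_ ?_
    · rw [Asymptotics.isLittleO_iff_tendsto' ?_]
      · refine (hM.qmd a).congr fun u => ?_
        simp only [root, add_zero]
        rw [div_eq_inv_mul]
      · filter_upwards [self_mem_nhdsWithin] with u hu h0
        exact absurd (norm_eq_zero.1 (pow_eq_zero_iff two_ne_zero |>.1 h0)) hu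
    · rw [Asymptotics.isLittleO_pure]
      simp

lemma measurable_armScore (hM : M.IsRegular D) (a : Bool) : Measurable (M.armScore D a) := by
  unfold armScore
  exact Measurable.ite (measurableSet_lt measurable_const (M.truth a).1)
    ((measurable_const.div (M.truth a).1.sqrt).smul (hM.measurable a)) measurable_const

lemma density_mul_norm_armScore_sq_le (a : Bool) (x : ℝ × (Fin k → ℝ)) :
    M.q a M.θ₀ x * ‖M.armScore D a x‖ ^ 2 ≤ 4 * ‖D a x‖ ^ 2 := by
  unfold armScore
  split_ifs with h
  · have hs : 0 < √(M.q a M.θ₀ x) := Real.sqrt_pos.2 h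
    rw [norm_smul, mul_pow, Real.norm_of_nonneg (by positivity), div_pow, Real.sq_sqrt h.le]
    apply le_of_eq
    field_simp
    ring
  · simp

/-- The score is square integrable under the population distribution. -/
lemma memLp_armScore (hM : M.IsRegular D) (a : Bool) :
    MemLp (fun w => M.armScore D a (arm a w)) 2 Q₀ := by
  have hm := (measurable_armScore hM a)
  refine (memLp_norm_iff (f := fun w => M.armScore D a (arm a w))
    (hm.comp (measurable_arm a)).aestronglyMeasurable).1 ?_
  rw [memLp_two_iff_integrable_sq (f := fun w => ‖M.armScore D a (arm a w)‖)
    (hm.comp (measurable_arm a)).norm.aestronglyMeasurable, M.truth.integrable_arm_iff a (f := fun x => ‖M.armScore D a x‖ ^ 2) (hm.norm.pow_const 2)]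
  refine ((hM.memLp a).norm.integrable_sq.const_mul 4).mono'
    ((M.truth a).1.mul (hm.norm.pow_const 2)).aestronglyMeasurable
    (Eventually.of_forall fun x => ?_)
  rw [Real.norm_of_nonneg (mul_nonneg ((M.truth a).2.1 x) (sq_nonneg _))]
  exact density_mul_norm_armScore_sq_le a x

lemma density_mul_inner_armScore (a : Bool) (x : ℝ × (Fin k → ℝ))
    (u : EuclideanSpace ℝ (Fin d)) :
    M.q a M.θ₀ x * inner ℝ (M.armScore D a x) u = 2 * (M.root a 0 x * inner ℝ (D a x) u) := by
  have h0 : 0 ≤ M.q a M.θ₀ x := (M.truth a).2.1 x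
  rw [root_zero]
  unfold armScore
  split_ifs with h
  · have hs : 0 < √(M.q a M.θ₀ x) := Real.sqrt_pos.2 h
    have hsq := Real.mul_self_sqrt h0
    rw [real_inner_smul_left]
    field_simp
    rw [pow_two, hsq]
  · rw [le_antisymm (not_lt.1 h) h0]
    simp

/-- The hypothesis, that the quadratic mean derivative vanishes with the root density, makes up for
the truncation in the definition of the score. -/
lemma density_mul_inner_armScore_sq (a : Bool) {x : ℝ × (Fin k → ℝ)}
    (hx : M.root a 0 x = 0 → D a x = 0) (u : EuclideanSpace ℝ (Fin d)) :
    M.q a M.θ₀ x * inner ℝ (M.armScore D a x) u ^ 2 = 4 * inner ℝ (D a x) u ^ 2 := by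
  have h0 : 0 ≤ M.q a M.θ₀ x := (M.truth a).2.1 x
  rw [root_zero] at hx
  unfold armScore
  split_ifs with h
  · have hs : 0 < √(M.q a M.θ₀ x) := Real.sqrt_pos.2 h
    rw [real_inner_smul_left, mul_pow, div_pow, Real.sq_sqrt h.le]
    field_simp
    ring
  · have hq := le_antisymm (not_lt.1 h) h0
    rw [hx (by rw [hq, Real.sqrt_zero])]
    simp

/-- The increment `√(q_a(θ₀ + u) / q_a(θ₀)) - 1` of the root likelihood ratio in arm `a`. Its value
`-1` where `q_a(θ₀) = 0` is irrelevant, because observations do not fall there. -/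
noncomputable def rootRatio (M : ParametricSubmodel 𝒟 μ μZ Q₀ d) (a : Bool)
    (u : EuclideanSpace ℝ (Fin d)) (x : ℝ × (Fin k → ℝ)) : ℝ :=
  M.root a u x / M.root a 0 x - 1

lemma measurable_rootRatio {u : EuclideanSpace ℝ (Fin d)} (hu : M.θ₀ + u ∈ M.Θ) (a : Bool) :
    Measurable (M.rootRatio a u) :=
  ((measurable_root hu a).div
    (measurable_root (by rw [add_zero]; exact M.θ₀_mem) a)).sub_const 1

/-- The error of the linearization of the root likelihood ratio by half the score. -/
noncomputable def ratioError (M : ParametricSubmodel 𝒟 μ μZ Q₀ d)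
    (D : Bool → ℝ × (Fin k → ℝ) → EuclideanSpace ℝ (Fin d)) (a : Bool)
    (u : EuclideanSpace ℝ (Fin d)) (x : ℝ × (Fin k → ℝ)) : ℝ :=
  M.rootRatio a u x - 2⁻¹ * inner ℝ (M.armScore D a x) u

lemma measurable_ratioError (hM : M.IsRegular D) {u : EuclideanSpace ℝ (Fin d)}
    (hu : M.θ₀ + u ∈ M.Θ) (a : Bool) : Measurable (M.ratioError D a u) :=
  (measurable_rootRatio hu a).sub
    (((measurable_armScore hM a).inner_const (c := u)).const_mul _)

lemma density_mul_ratioError_sq_le (a : Bool) (x : ℝ × (Fin k → ℝ))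
    (u : EuclideanSpace ℝ (Fin d)) :
    M.q a M.θ₀ x * M.ratioError D a u x ^ 2 ≤
      (M.root a u x - M.root a 0 x - inner ℝ (D a x) u) ^ 2 := by
  have h0 : 0 ≤ M.q a M.θ₀ x := (M.truth a).2.1 x
  unfold ratioError rootRatio armScore
  rw [root_zero]
  split_ifs with h
  · have hs : 0 < √(M.q a M.θ₀ x) := Real.sqrt_pos.2 h
    rw [real_inner_smul_left]
    apply le_of_eq
    nth_rewrite 1 [← Real.sq_sqrt h0]
    rw [← mul_pow]
    congr 1
    field_simp
  · rw [le_antisymm (not_lt.1 h) h0, zero_mul]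
    exact sq_nonneg _

/-- The algebraic identity behind the conditional means of the linearization error: a first-order
error of the mass and a squared difference of root densities. -/
lemma density_mul_ratioError (a : Bool) (x : ℝ × (Fin k → ℝ)) (u : EuclideanSpace ℝ (Fin d)) :
    M.q a M.θ₀ x * M.ratioError D a u x =
      2⁻¹ * (M.root a u x ^ 2 - M.root a 0 x ^ 2 - 2 * (M.root a 0 x * inner ℝ (D a x) u)) -
        2⁻¹ * (M.root a u x - M.root a 0 x) ^ 2 := by
  have h0 : 0 ≤ M.q a M.θ₀ x := (M.truth a).2.1 x
  have h1 : M.q a M.θ₀ x * M.rootRatio a u x =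
      M.root a 0 x * M.root a u x - M.root a 0 x ^ 2 := by
    rw [rootRatio, ← sq_root_zero]
    by_cases h : M.root a 0 x = 0
    · simp [h]
    · field_simp
  rw [ratioError, mul_sub, h1, ← mul_assoc, mul_comm _ (2⁻¹ : ℝ), mul_assoc,
    density_mul_inner_armScore]
  ring

lemma memLp_rootRatio {u : EuclideanSpace ℝ (Fin d)} (hu : M.θ₀ + u ∈ M.Θ) (a : Bool) :
    MemLp (fun w => M.rootRatio a u (arm a w)) 2 Q₀ := by
  have := M.isProbabilityMeasure_truth
  have h00 : M.θ₀ + 0 ∈ M.Θ := by rw [add_zero]; exact M.θ₀_mem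
  have hm : Measurable fun x => M.root a u x / M.root a 0 x :=
    (measurable_root hu a).div (measurable_root h00 a)
  have h1 : MemLp (fun w => M.root a u (arm a w) / M.root a 0 (arm a w)) 2 Q₀ := by
    rw [memLp_two_iff_integrable_sq
        (f := fun w => M.root a u (arm a w) / M.root a 0 (arm a w))
        (hm.comp (measurable_arm a)).aestronglyMeasurable,
      M.truth.integrable_arm_iff a (f := fun x => (M.root a u x / M.root a 0 x) ^ 2)
        (hm.pow_const 2)]
    refine (memLp_root hu a).integrable_sq.mono'
      ((M.truth a).1.mul (hm.pow_const 2)).aestronglyMeasurable (Eventually.of_forall fun x => ?_)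
    rw [Real.norm_of_nonneg (mul_nonneg ((M.truth a).2.1 x) (sq_nonneg _))]
    change M.q a M.θ₀ x * _ ≤ _
    rw [← sq_root_zero, ← mul_pow]
    by_cases h : M.root a 0 x = 0
    · rw [h, zero_mul, zero_pow two_ne_zero]
      exact sq_nonneg _
    · rw [mul_div_cancel₀ _ h]
  exact h1.sub (memLp_const 1)

lemma integral_ratioError_sq_le (hM : M.IsRegular D) {u : EuclideanSpace ℝ (Fin d)}
    (hu : M.θ₀ + u ∈ M.Θ) (a : Bool) :
    ∫ w, M.ratioError D a u (arm a w) ^ 2 ∂Q₀ ≤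
      ∫ x, (M.root a u x - M.root a 0 x - inner ℝ (D a x) u) ^ 2 ∂(armMeasure μ μZ a) := by
  rw [M.truth.integral_arm a (f := fun x => M.ratioError D a u x ^ 2)
    ((measurable_ratioError hM hu a).pow_const 2)]
  exact integral_mono_of_nonneg (Eventually.of_forall fun x =>
      mul_nonneg ((M.truth a).2.1 x) (sq_nonneg _))
    ((isQMD hM a).memLp_remainder (memLp_root hu a)).integrable_sq
    (Eventually.of_forall fun x => density_mul_ratioError_sq_le a x u)

/-- The first-order error of the probability of stratum `s`, computed in arm `a`. -/
noncomputable def massError (M : ParametricSubmodel 𝒟 μ μZ Q₀ d)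
    (D : Bool → ℝ × (Fin k → ℝ) → EuclideanSpace ℝ (Fin d)) (a : Bool) (s : Fin 𝒟.numStrata)
    (u : EuclideanSpace ℝ (Fin d)) : ℝ :=
  ∫ x in 𝒟.armStratum s, M.root a u x ^ 2 ∂(armMeasure μ μZ a) -
    ∫ x in 𝒟.armStratum s, M.root a 0 x ^ 2 ∂(armMeasure μ μZ a) -
    2 * ∫ x in 𝒟.armStratum s, M.root a 0 x * inner ℝ (D a x) u ∂(armMeasure μ μZ a)

/-- The squared distance of the root densities at `θ₀ + u` and `θ₀` on stratum `s`, in arm `a`. -/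
noncomputable def hellinger (M : ParametricSubmodel 𝒟 μ μZ Q₀ d) (a : Bool)
    (s : Fin 𝒟.numStrata) (u : EuclideanSpace ℝ (Fin d)) : ℝ :=
  ∫ x in 𝒟.armStratum s, (M.root a u x - M.root a 0 x) ^ 2 ∂(armMeasure μ μZ a)

lemma stratumMean_eq_inv_mul {f : Pop k → ℝ} {s : Fin 𝒟.numStrata} [IsFiniteMeasure Q₀] :
    stratumMean 𝒟 Q₀ f s =
      (Q₀.real (𝒟.stratumEvent s))⁻¹ * ∫ w in 𝒟.stratumEvent s, f w ∂Q₀ := by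
  by_cases hs : Q₀ (𝒟.stratumEvent s) = 0
  · simp [stratumMean, cond_eq_zero_of_meas_eq_zero hs, Measure.real, hs]
  · have hp : Q₀.real (𝒟.stratumEvent s) ≠ 0 := ENNReal.toReal_ne_zero.2 ⟨hs, measure_ne_top _ _⟩
    rw [← real_mul_integral_cond f, smul_eq_mul, inv_mul_cancel_left₀ hp, stratumMean]

lemma stratumMean_arm [IsFiniteMeasure Q₀] (a : Bool) (s : Fin 𝒟.numStrata)
    {f : ℝ × (Fin k → ℝ) → ℝ} (hf : Measurable f) :
    stratumMean 𝒟 Q₀ (fun w => f (arm a w)) s = (Q₀.real (𝒟.stratumEvent s))⁻¹ *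
      ∫ x in 𝒟.armStratum s, M.q a M.θ₀ x * f x ∂(armMeasure μ μZ a) := by
  rw [stratumMean_eq_inv_mul, ← M.truth.setIntegral_arm a hf (𝒟.measurableSet_armStratum s)]
  rfl

/-- For a null stratum both sides are `0`, as `0⁻¹ = 0`. -/
lemma stratumMean_ratioError (hM : M.IsRegular D) {u : EuclideanSpace ℝ (Fin d)}
    (hu : M.θ₀ + u ∈ M.Θ) (a : Bool) (s : Fin 𝒟.numStrata) :
    stratumMean 𝒟 Q₀ (fun w => M.ratioError D a u (arm a w)) s =
      (2 * Q₀.real (𝒟.stratumEvent s))⁻¹ * M.massError D a s u -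
        (2 * Q₀.real (𝒟.stratumEvent s))⁻¹ * M.hellinger a s u := by
  have := M.isProbabilityMeasure_truth
  have hqmd := isQMD hM a
  have h0 := hqmd.memLp_at_zero.restrict (𝒟.armStratum s)
  have hp := (memLp_root hu a).restrict (𝒟.armStratum s)
  have hin := (hqmd.memLp_inner u).restrict (𝒟.armStratum s)
  have hi1 : Integrable (fun x => M.root a u x ^ 2 - M.root a 0 x ^ 2)
    ((armMeasure μ μZ a).restrict (𝒟.armStratum s)) := hp.integrable_sq.sub h0.integrable_sq
  have hi2 : Integrable (fun x => 2 * (M.root a 0 x * inner ℝ (D a x) u))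
    ((armMeasure μ μZ a).restrict (𝒟.armStratum s)) := (h0.integrable_mul hin).const_mul 2
  have hi4 : Integrable (fun x => M.root a u x ^ 2 - M.root a 0 x ^ 2 -
      2 * (M.root a 0 x * inner ℝ (D a x) u))
    ((armMeasure μ μZ a).restrict (𝒟.armStratum s)) := hi1.sub hi2
  have hi3 : Integrable (fun x => (M.root a u x - M.root a 0 x) ^ 2)
    ((armMeasure μ μZ a).restrict (𝒟.armStratum s)) := (hp.sub h0).integrable_sq
  rw [stratumMean_arm (M := M) a s (measurable_ratioError hM hu a)]
  simp_rw [density_mul_ratioError]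
  rw [integral_sub (hi4.const_mul _) (hi3.const_mul _),
    integral_const_mul, integral_const_mul, integral_sub hi1 hi2,
    integral_sub hp.integrable_sq h0.integrable_sq, integral_const_mul, massError, hellinger,
    mul_inv]
  ring

lemma stratumMean_inner_armScore (hM : M.IsRegular D) (a : Bool) (s : Fin 𝒟.numStrata)
    (t : EuclideanSpace ℝ (Fin d)) :
    stratumMean 𝒟 Q₀ (fun w => inner ℝ (M.armScore D a (arm a w)) t) s =
      (Q₀.real (𝒟.stratumEvent s))⁻¹ * (2 * inner ℝ
        (∫ x in 𝒟.armStratum s, M.root a 0 x • D a x ∂(armMeasure μ μZ a)) t) := by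
  have := M.isProbabilityMeasure_truth
  rw [stratumMean_arm (M := M) a s ((measurable_armScore hM a).inner_const (c := t)),
    ← ((isQMD hM a).restrict _).integral_mul_inner]
  simp_rw [density_mul_inner_armScore]
  rw [integral_const_mul]

lemma stratumMean_inner_armScore_sq (hM : M.IsRegular D) (a : Bool) (s : Fin 𝒟.numStrata)
    (t : EuclideanSpace ℝ (Fin d)) :
    stratumMean 𝒟 Q₀ (fun w => inner ℝ (M.armScore D a (arm a w)) t ^ 2) s =
      (Q₀.real (𝒟.stratumEvent s))⁻¹ * (4 *
        ∫ x in 𝒟.armStratum s, inner ℝ (D a x) t ^ 2 ∂(armMeasure μ μZ a)) := by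
  have := M.isProbabilityMeasure_truth
  rw [stratumMean_arm (M := M) a s (f := fun x => inner ℝ (M.armScore D a x) t ^ 2)
    (((measurable_armScore hM a).inner_const (c := t)).pow_const 2),
    ← integral_const_mul (4 : ℝ)]
  congr 1
  refine integral_congr_ae ?_
  filter_upwards [((isQMD hM a).restrict (𝒟.armStratum s)).ae_deriv_eq_zero] with x hx
  exact density_mul_inner_armScore_sq a hx t

/-- Both arms have the same score of the stratum probabilities, because their `Z`-marginals
agree along the submodel. -/
lemma integral_root_smul_eq (hM : M.IsRegular D) (a b : Bool) (s : Fin 𝒟.numStrata) :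
    ∫ x in 𝒟.armStratum s, M.root a 0 x • D a x ∂(armMeasure μ μZ a) =
      ∫ x in 𝒟.armStratum s, M.root b 0 x • D b x ∂(armMeasure μ μZ b) := by
  refine integral_smul_deriv_eq ((isQMD hM a).restrict _) ((isQMD hM b).restrict _) ?_
  filter_upwards [eventually_mem hM] with u hu
  obtain ⟨Q, -, hQ⟩ := exists_integral_root_sq hu
  rw [hQ a s, hQ b s]

/-- The score has mean zero. -/
lemma integral_inner_armScore (hM : M.IsRegular D) (a : Bool) (t : EuclideanSpace ℝ (Fin d)) :
    ∫ w, inner ℝ (M.armScore D a (arm a w)) t ∂Q₀ = 0 := by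
  have hone : ∀ᶠ u in 𝓝 0, ∫ x, M.root a u x ^ 2 ∂(armMeasure μ μZ a) = 1 := by
    filter_upwards [eventually_mem hM] with u hu
    obtain ⟨Q, hQ, hQd⟩ := M.population _ hu
    have := hQ.1
    have h := hQd.integral_arm a (f := fun _ => 1) measurable_const
    simp only [integral_const, probReal_univ, smul_eq_mul, mul_one] at h
    rw [h]
    exact integral_congr_ae (Eventually.of_forall fun x => Real.sq_sqrt ((hQd a).2.1 x))
  rw [M.truth.integral_arm a ((measurable_armScore hM a).inner_const (c := t))]
  simp_rw [density_mul_inner_armScore]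
  rw [integral_const_mul, (isQMD hM a).integral_mul_inner,
    integral_smul_deriv_eq_zero (isQMD hM a) hone, inner_zero_left, mul_zero]

/-- The mass errors are the same in both arms, so that they are functions of the stratum alone. -/
lemma massError_eq (hM : M.IsRegular D) {u : EuclideanSpace ℝ (Fin d)} (hu : M.θ₀ + u ∈ M.Θ)
    (a b : Bool) (s : Fin 𝒟.numStrata) : M.massError D a s u = M.massError D b s u := by
  obtain ⟨Q, -, hQ⟩ := exists_integral_root_sq hu
  obtain ⟨Q', -, hQ'⟩ := exists_integral_root_sq (M := M) (u := 0)
    (by rw [add_zero]; exact M.θ₀_mem)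
  rw [massError, massError, hQ a s, hQ b s, hQ' a s, hQ' b s,
    ((isQMD hM a).restrict _).integral_mul_inner, ((isQMD hM b).restrict _).integral_mul_inner,
    integral_root_smul_eq hM a b]

lemma sum_real_stratumEvent (Q : Measure (Pop k)) [IsProbabilityMeasure Q] :
    ∑ s, Q.real (𝒟.stratumEvent s) = 1 := by
  have h := integral_comp_unitStratum (𝒟 := 𝒟) (Q₀ := Q) fun _ => 1
  simpa using h.symm

lemma sum_massError (hM : M.IsRegular D) {u : EuclideanSpace ℝ (Fin d)} (hu : M.θ₀ + u ∈ M.Θ)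
    (a : Bool) : ∑ s, M.massError D a s u = 0 := by
  obtain ⟨Q, hQp, hQ⟩ := exists_integral_root_sq hu
  obtain ⟨Q', hQp', hQ'⟩ := exists_integral_root_sq (M := M) (u := 0)
    (by rw [add_zero]; exact M.θ₀_mem)
  have := M.isProbabilityMeasure_truth
  have h1 : ∀ s : Fin 𝒟.numStrata,
      2 * ∫ x in 𝒟.armStratum s, M.root a 0 x * inner ℝ (D a x) u ∂(armMeasure μ μZ a) =
      ∫ w in 𝒟.stratumEvent s, inner ℝ (M.armScore D a (arm a w)) u ∂Q₀ := by
    intro s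
    rw [← integral_const_mul]
    simp_rw [← density_mul_inner_armScore]
    exact (M.truth.setIntegral_arm a ((measurable_armScore hM a).inner_const (c := u))
      (𝒟.measurableSet_armStratum s)).symm
  have hin : Integrable (fun w => (inner ℝ (M.armScore D a (arm a w)) u : ℝ)) Q₀ :=
    ((memLp_armScore hM a).inner_const u).integrable one_le_two
  have h2 := integral_eq_sum_strata (𝒟 := 𝒟) hin
  rw [integral_inner_armScore hM] at h2
  simp only [massError, hQ a, hQ' a, h1, Finset.sum_sub_distrib, sum_real_stratumEvent, ← h2]
  ring

end ParametricSubmodel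
end CAR

/-! ### Expansion of the log-likelihood ratio -/

namespace CAR
namespace ParametricSubmodel

variable {k : ℕ} {𝒟 : Design k} {μ : Bool → Measure ℝ} {μZ : Measure (Fin k → ℝ)}
  {Q₀ : Measure (Pop k)} {d : ℕ} {M : ParametricSubmodel 𝒟 μ μZ Q₀ d}
  {D : Bool → ℝ × (Fin k → ℝ) → EuclideanSpace ℝ (Fin d)}

/-- The squared distance of root densities on a stratum of positive probability gives, to second
order, an eighth of the conditional second moment of the score in direction `t n`. -/
lemma tendsto_hellinger (hM : M.IsRegular D) (a : Bool) (s : Fin 𝒟.numStrata)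
    {t : ℕ → EuclideanSpace ℝ (Fin d)} {C : ℝ} (ht : ∀ n, ‖t n‖ ≤ C) :
    Tendsto (fun n : ℕ => (n : ℝ) * ((2 * Q₀.real (𝒟.stratumEvent s))⁻¹ *
        M.hellinger a s ((√(n : ℝ))⁻¹ • t n)) -
      8⁻¹ * stratumMean 𝒟 Q₀ (fun w => inner ℝ (M.armScore D a (arm a w)) (t n) ^ 2) s)
      atTop (𝓝 0) := by
  have h := (tendsto_nat_mul_of_isLittleO
    ((isQMD hM a).restrict (𝒟.armStratum s)).isLittleO_hellinger ht).const_mul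
    (2 * Q₀.real (𝒟.stratumEvent s))⁻¹
  rw [mul_zero] at h
  refine h.congr' ?_
  filter_upwards [eventually_gt_atTop 0] with n hn
  have hn' : (n : ℝ) ≠ 0 := by exact_mod_cast hn.ne'
  rw [stratumMean_inner_armScore_sq hM, hellinger]
  simp only [inner_smul_right, mul_pow, inv_pow, Real.sq_sqrt (Nat.cast_nonneg (α := ℝ) n)]
  rw [integral_const_mul, mul_sub, mul_inv_cancel_left₀ hn', mul_inv]
  ring

/-- The first-order errors of the stratum probabilities sum to zero, so that those of the strata of
positive probability are controlled by the mass of the null strata, which is of second order. -/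
lemma tendsto_sum_massError (hM : M.IsRegular D) {t : ℕ → EuclideanSpace ℝ (Fin d)} {C : ℝ}
    (ht : ∀ n, ‖t n‖ ≤ C) (hmem : ∀ n : ℕ, M.θ₀ + (√(n : ℝ))⁻¹ • t n ∈ M.Θ) :
    Tendsto (fun n : ℕ => (n : ℝ) * ∑ s, Q₀.real (𝒟.stratumEvent s) *
      ((2 * Q₀.real (𝒟.stratumEvent s))⁻¹ * M.massError D true s ((√(n : ℝ))⁻¹ • t n)))
      atTop (𝓝 0) := by
  have := M.isProbabilityMeasure_truth
  -- for a stratum of positive probability the two weights agree; for a null stratum they do not,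
  -- but there the root density at zero vanishes
  have hterm : ∀ s : Fin 𝒟.numStrata, Tendsto (fun n : ℕ => (n : ℝ) *
      (Q₀.real (𝒟.stratumEvent s) * ((2 * Q₀.real (𝒟.stratumEvent s))⁻¹ *
        M.massError D true s ((√(n : ℝ))⁻¹ • t n)) -
      2⁻¹ * M.massError D true s ((√(n : ℝ))⁻¹ • t n))) atTop (𝓝 0) := by
    intro s
    by_cases hs : Q₀ (𝒟.stratumEvent s) = 0
    · have h0 : ∀ᵐ x ∂(armMeasure μ μZ true).restrict (𝒟.armStratum s), M.root true 0 x = 0 := by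
        filter_upwards [M.truth.ae_restrict_armStratum_eq_zero true hs] with x hx
        have hx' : M.q true M.θ₀ x = 0 := hx
        rw [root_zero, hx', Real.sqrt_zero]
      have h := (tendsto_nat_mul_of_isLittleO
        (((isQMD hM true).restrict _).isLittleO_mass_of_ae_eq_zero h0) ht).const_mul (-2⁻¹)
      rw [mul_zero] at h
      refine h.congr fun n => ?_
      have e1 : ∫ x in 𝒟.armStratum s, M.root true 0 x ^ 2 ∂(armMeasure μ μZ true) = 0 := by
        rw [integral_eq_zero_of_ae]
        filter_upwards [h0] with x hx
        simp [hx]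
      have e2 : ∫ x in 𝒟.armStratum s, M.root true 0 x *
          inner ℝ (D true x) ((√(n : ℝ))⁻¹ • t n) ∂(armMeasure μ μZ true) = 0 := by
        rw [integral_eq_zero_of_ae]
        filter_upwards [h0] with x hx
        simp [hx]
      rw [massError, e1, e2, Measure.real, hs, ENNReal.toReal_zero]
      ring
    · have hp : Q₀.real (𝒟.stratumEvent s) ≠ 0 :=
        ENNReal.toReal_ne_zero.2 ⟨hs, measure_ne_top _ _⟩
      refine tendsto_const_nhds.congr fun n => ?_
      field_simp
      ring
  have h := tendsto_finsetSum Finset.univ fun s _ => hterm s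
  rw [Finset.sum_const_zero] at h
  refine h.congr fun n => ?_
  rw [← Finset.mul_sum, Finset.sum_sub_distrib, ← Finset.mul_sum, sum_massError hM (hmem n),
    mul_zero, sub_zero]

/-- The stratified second moment of the score in direction `t` is the quadratic form of the
information. -/
lemma targetSum_inner_sq (hM : M.IsRegular D) (t : EuclideanSpace ℝ (Fin d)) :
    (targetSum 𝒟 Q₀ fun a => stratumMean 𝒟 Q₀ fun w => inner ℝ (M.armScore D a (arm a w)) t ^ 2) =
      t.ofLp ⬝ᵥ (M.information D *ᵥ t.ofLp) := by
  have := M.isProbabilityMeasure_truth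
  have hc : ∀ a i, MemLp (fun w => M.armScore D a (arm a w) i) 2 Q₀ := fun a i =>
    ((memLp_armScore hM a).eval_piLp i)
  have hint : ∀ a s i j, Integrable (fun w => M.armScore D a (arm a w) i *
      M.armScore D a (arm a w) j) (ProbabilityTheory.cond Q₀ (𝒟.stratumEvent s)) := fun a s i j =>
    integrable_cond ((hc a i).integrable_mul (hc a j)) _
  have hsq : ∀ a s, stratumMean 𝒟 Q₀ (fun w => inner ℝ (M.armScore D a (arm a w)) t ^ 2) s =
      ∑ i, ∑ j, t i * t j * ∫ w, M.armScore D a (arm a w) i * M.armScore D a (arm a w) j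
        ∂(ProbabilityTheory.cond Q₀ (𝒟.stratumEvent s)) := by
    intro a s
    rw [stratumMean]
    simp_rw [← integral_const_mul]
    simp_rw [← integral_finsetSum _ fun j _ => (hint a s _ j).const_mul _]
    rw [← integral_finsetSum _ fun i _ => integrable_finsetSum _ fun j _ =>
      (hint a s i j).const_mul _]
    refine integral_congr_ae (Eventually.of_forall fun w => ?_)
    simp only [PiLp.inner_apply, RCLike.inner_apply, conj_trivial, pow_two, Finset.sum_mul_sum]
    exact Finset.sum_congr rfl fun i _ => Finset.sum_congr rfl fun j _ => by ring
  have hcomm : ∀ c : Fin 𝒟.numStrata → Bool → Fin d → Fin d → ℝ,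
      ∑ s, ∑ a, ∑ i, ∑ j, c s a i j = ∑ i, ∑ j, ∑ s, ∑ a, c s a i j := fun c =>
    calc ∑ s, ∑ a, ∑ i, ∑ j, c s a i j = ∑ s, ∑ i, ∑ j, ∑ a, c s a i j :=
          Finset.sum_congr rfl fun s _ => Finset.sum_comm.trans
            (Finset.sum_congr rfl fun i _ => Finset.sum_comm)
      _ = ∑ i, ∑ s, ∑ j, ∑ a, c s a i j := Finset.sum_comm
      _ = ∑ i, ∑ j, ∑ s, ∑ a, c s a i j := Finset.sum_congr rfl fun i _ => Finset.sum_comm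
  simp only [targetSum, hsq, dotProduct, Matrix.mulVec, information, Matrix.of_apply,
    Finset.mul_sum, Finset.sum_mul]
  rw [hcomm]
  refine Finset.sum_congr rfl fun i _ => Finset.sum_congr rfl fun j _ =>
    Finset.sum_congr rfl fun s _ => Finset.sum_congr rfl fun a _ => ?_
  ring

/-- The quadratic expansion of the log-likelihood ratio along a bounded sequence of local
parameters. -/
lemma tendstoInMeasure_sum_log_rootRatio {Ω : Type*} [MeasurableSpace Ω] {Pr : Measure Ω}
    [IsProbabilityMeasure Pr] {W : ℕ → Ω → Pop k} {A : (n : ℕ) → Ω → Fin n → Bool}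
    (hX : IsExperiment 𝒟 Q₀ Pr W A) (hM : M.IsRegular D)
    {t : ℕ → EuclideanSpace ℝ (Fin d)} {C : ℝ} (ht : ∀ n, ‖t n‖ ≤ C)
    (hmem : ∀ n : ℕ, M.θ₀ + (√(n : ℝ))⁻¹ • t n ∈ M.Θ) :
    (TendstoInMeasure Pr (fun (n : ℕ) ω =>
      ∑ i, 2 * Real.log (1 + M.rootRatio (A n ω i) ((√(n : ℝ))⁻¹ • t n)
        (arm (A n ω i) (W i ω))) -
      (inner ℝ (t n) ((√(n : ℝ))⁻¹ • M.score D n (sample W A n ω)) -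
        2⁻¹ * ((t n).ofLp ⬝ᵥ (M.information D *ᵥ (t n).ofLp)))) atTop fun _ => 0) ∧
    Tendsto (fun n => Pr {ω | ∃ i, 1 / 2 ≤ |M.rootRatio (A n ω i) ((√(n : ℝ))⁻¹ • t n)
        (arm (A n ω i) (W i ω))|}) atTop (𝓝 0) := by
  have := M.isProbabilityMeasure_truth
  let ρ : ℕ → Bool → Pop k → ℝ := fun n a w => M.rootRatio a ((√(n : ℝ))⁻¹ • t n) (arm a w)
  let g : ℕ → Bool → Pop k → ℝ := fun n a w => inner ℝ (M.armScore D a (arm a w)) (t n)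
  let G : Bool → Pop k → ℝ := fun a w => ‖M.armScore D a (arm a w)‖ * C
  have hsm : ∀ a, Measurable fun w => M.armScore D a (arm a w) := fun a =>
    (measurable_armScore hM a).comp (measurable_arm a)
  have hρm : ∀ n a, Measurable (ρ n a) := fun n a =>
    (measurable_rootRatio (hmem n) a).comp (measurable_arm a)
  have hgm : ∀ n a, Measurable (g n a) := fun n a => (hsm a).inner_const
  have hGm : ∀ a, Measurable (G a) := fun a => (hsm a).norm.mul_const C
  have hG : ∀ a, MemLp (G a) 2 Q₀ := fun a => (memLp_armScore hM a).norm.mul_const C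
  have hgG : ∀ n a w, |g n a w| ≤ G a w := fun n a w =>
    (abs_real_inner_le_norm _ _).trans (mul_le_mul_of_nonneg_left (ht n) (norm_nonneg _))
  have hρ : ∀ n a, MemLp (ρ n a) 2 Q₀ := fun n a => memLp_rootRatio (hmem n) a
  have herr : ∀ (n : ℕ) a, (fun w => ρ n a w - (2 * √(n : ℝ))⁻¹ * g n a w) =
      fun w => M.ratioError D a ((√(n : ℝ))⁻¹ • t n) (arm a w) := by
    intro n a
    funext w
    simp only [ρ, g, ratioError, inner_smul_right, mul_inv]
    ring
  have hr : ∀ a, Tendsto (fun n : ℕ => (n : ℝ) *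
      ∫ w, (ρ n a w - (2 * √(n : ℝ))⁻¹ * g n a w) ^ 2 ∂Q₀) atTop (𝓝 0) := by
    intro a
    refine squeeze_zero (fun n => mul_nonneg n.cast_nonneg (integral_nonneg fun _ => sq_nonneg _))
      (fun n => ?_) (tendsto_nat_mul_of_isLittleO (isQMD hM a).isLittleO ht)
    simp_rw [fun w => congrFun (herr n a) w]
    exact mul_le_mul_of_nonneg_left (integral_ratioError_sq_le hM (hmem n) a) n.cast_nonneg
  refine ⟨?_, hX.tendsto_measure_exists_le hρm hgm hGm hG hgG hρ hr (by norm_num)⟩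
  have h := hX.tendstoInMeasure_sum_log hρm hgm hGm hG hgG hρ hr
    (b := fun n s => (2 * Q₀.real (𝒟.stratumEvent s))⁻¹ *
      M.massError D true s ((√(n : ℝ))⁻¹ • t n))
    (e := fun n a s => (2 * Q₀.real (𝒟.stratumEvent s))⁻¹ *
      M.hellinger a s ((√(n : ℝ))⁻¹ • t n))
    (fun n a s => by
      rw [herr, stratumMean_ratioError hM (hmem n), massError_eq hM (hmem n) a true])
    (fun a s => tendsto_hellinger hM a s ht)
    (fun s => by
      have h := (tendsto_sqrt_mul_of_isLittleO
        ((isQMD hM true).restrict (𝒟.armStratum s)).isLittleO_mass ht).const_mul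
        (2 * Q₀.real (𝒟.stratumEvent s))⁻¹
      rw [mul_zero] at h
      refine h.congr fun n => ?_
      rw [massError]
      ring)
    (tendsto_sum_massError hM ht hmem)
  refine h.congr_left fun n => Eventually.of_forall fun ω => ?_
  have e : inner ℝ (t n) ((√(n : ℝ))⁻¹ • M.score D n (sample W A n ω)) =
      (√(n : ℝ))⁻¹ * ∑ i, g n (A n ω i) (W i ω) := by
    rw [inner_smul_right, score, inner_sum]
    congr 1
    exact Finset.sum_congr rfl fun i _ => real_inner_comm _ _
  simp only [e, ρ]
  rw [← targetSum_inner_sq hM]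

end ParametricSubmodel
end CAR

/-! ### Information, asymptotic normality and the remainder -/

namespace CAR
namespace ParametricSubmodel

variable {k : ℕ} {𝒟 : Design k} {μ : Bool → Measure ℝ} {μZ : Measure (Fin k → ℝ)}
  {Q₀ : Measure (Pop k)} {d : ℕ} {M : ParametricSubmodel 𝒟 μ μZ Q₀ d}
  {D : Bool → ℝ × (Fin k → ℝ) → EuclideanSpace ℝ (Fin d)}

lemma posSemidef_information (hM : M.IsRegular D) : (M.information D).PosSemidef := by
  refine Matrix.PosSemidef.of_dotProduct_mulVec_nonneg ?_ fun x => ?_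
  · ext i j
    simp only [information, Matrix.conjTranspose_apply, Matrix.of_apply, star_trivial, mul_comm]
  · rw [star_trivial, ← targetSum_inner_sq hM (WithLp.toLp 2 x)]
    exact Finset.sum_nonneg fun s _ => mul_nonneg measureReal_nonneg
      (Finset.sum_nonneg fun a _ => mul_nonneg (armTarget_nonneg a s) (stratumMean_sq_nonneg _ s))

lemma measurable_obsScore (hM : M.IsRegular D) : Measurable (M.obsScore D) := by
  have h : Measurable fun x : Bool × (ℝ × (Fin k → ℝ)) => M.armScore D x.1 x.2 :=
    measurable_from_prod_countable_right fun a => measurable_armScore hM a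
  exact h.comp ((measurable_fst.comp measurable_snd).prodMk
    (measurable_fst.prodMk (measurable_snd.comp measurable_snd)))

lemma information_apply_eq_integral (hM : M.IsRegular D) (i j : Fin d) :
    M.information D i j = ∫ x, M.obsScore D x i * M.obsScore D x j ∂(𝒟.targetLaw Q₀) := by
  have := M.isProbabilityMeasure_truth
  let F : Bool → Pop k → ℝ := fun a w => M.armScore D a (arm a w) i * M.armScore D a (arm a w) j
  let π : Bool → Pop k → ℝ := fun a w => 𝒟.armTarget a (𝒟.stratum (covariates w))
  have hF : ∀ a, Integrable (F a) Q₀ := fun a =>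
    ((memLp_armScore hM a).eval_piLp i).integrable_mul ((memLp_armScore hM a).eval_piLp j)
  have hπm : ∀ a, Measurable (π a) := fun a =>
    measurable_comp_unitStratum (𝒟 := 𝒟) (𝒟.armTarget a)
  have hπ0 : ∀ a w, 0 ≤ π a w := fun a w => armTarget_nonneg a _
  have hπF : ∀ a, Integrable (fun w => π a w * F a w) Q₀ := fun a => by
    refine (hF a).mono ((hπm a).aestronglyMeasurable.mul (hF a).1)
      (Eventually.of_forall fun w => ?_)
    have h1 : π a w ≤ 1 := by
      have h2 := armTarget_nonneg (𝒟 := 𝒟) (!a) (𝒟.stratum (covariates w))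
      have h3 := sum_armTarget (𝒟 := 𝒟) (𝒟.stratum (covariates w))
      rw [Fintype.sum_bool] at h3
      simp only [π]
      cases a <;> simp only [Bool.not_true, Bool.not_false] at h2 <;> linarith
    rw [norm_mul, Real.norm_of_nonneg (hπ0 a w)]
    exact mul_le_of_le_one_left (norm_nonneg _) h1
  have hm : Measurable fun x => M.obsScore D x i * M.obsScore D x j :=
    ((measurable_pi_apply i).comp ((WithLp.measurable_ofLp 2 _).comp (measurable_obsScore hM))).mul
      ((measurable_pi_apply j).comp ((WithLp.measurable_ofLp 2 _).comp (measurable_obsScore hM)))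
  have hlt : ∀ a, ∀ᵐ w ∂Q₀, ENNReal.ofReal (π a w) < ∞ := fun a =>
    Eventually.of_forall fun w => ENNReal.ofReal_lt_top
  have hsmul : ∀ a w, (ENNReal.ofReal (π a w)).toReal • F a w = π a w * F a w := fun a w => by
    rw [ENNReal.toReal_ofReal (hπ0 a w), smul_eq_mul]
  rw [Design.targetLaw, integral_finsetSum_measure]
  · have harm : ∀ a, ∫ x, M.obsScore D x i * M.obsScore D x j
        ∂((Q₀.withDensity fun w => ENNReal.ofReal (π a w)).map (observe a)) =
        ∑ s, Q₀.real (𝒟.stratumEvent s) * (𝒟.armTarget a s * stratumMean 𝒟 Q₀ (F a) s) := by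
      intro a
      rw [integral_map (measurable_observe a).aemeasurable hm.aestronglyMeasurable,
        integral_withDensity_eq_integral_toReal_smul (hπm a).ennreal_ofReal (hlt a)]
      refine (integral_congr_ae (Eventually.of_forall (hsmul a))).trans ?_
      rw [integral_eq_sum_strata (𝒟 := 𝒟) (hπF a)]
      refine Finset.sum_congr rfl fun s _ => ?_
      rw [mul_left_comm, stratumMean, ← smul_eq_mul (Q₀.real _), real_mul_integral_cond,
        ← integral_const_mul]
      refine setIntegral_congr_fun (𝒟.measurableSet_stratumEvent s) fun w hw => ?_
      have hw' : 𝒟.stratum (covariates w) = s := hw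
      simp only [π, hw']
    refine Eq.trans ?_ (Finset.sum_congr rfl fun a _ => (harm a).symm)
    rw [Finset.sum_comm]
    simp only [information, Matrix.of_apply, ← Finset.mul_sum]
    rfl
  · intro a _
    rw [integrable_map_measure hm.aestronglyMeasurable (measurable_observe a).aemeasurable,
      integrable_withDensity_iff_integrable_smul' (hπm a).ennreal_ofReal (hlt a)]
    exact (hπF a).congr (Eventually.of_forall fun w => (hsmul a w).symm)

section Experiment

variable {Ω : Type*} {W : ℕ → Ω → Pop k} {A : (n : ℕ) → Ω → Fin n → Bool}

lemma score_sample (n : ℕ) (ω : Ω) : M.score D n (sample W A n ω) =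
    ∑ i, M.armScore D (A n ω i) (arm (A n ω i) (W i ω)) := rfl

lemma log_jointDensity {q : Bool → ℝ × (Fin k → ℝ) → ℝ} {n : ℕ} {x : Fin n → Obs k}
    (hα : 𝒟.assign n (𝒟.sampleStrata x) (fun i => (x i).2.1) ≠ 0)
    (hq : ∀ i, 0 < q (x i).2.1 ((x i).1, (x i).2.2)) :
    ENNReal.log (jointDensity 𝒟 q n x) =
      ((Real.log (𝒟.assign n (𝒟.sampleStrata x) (fun i => (x i).2.1)).toReal +
        ∑ i, Real.log (q (x i).2.1 ((x i).1, (x i).2.2)) : ℝ) : EReal) := by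
  have hα' : 0 < (𝒟.assign n (𝒟.sampleStrata x) (fun i => (x i).2.1)).toReal :=
    ENNReal.toReal_pos hα (PMF.apply_ne_top _ _)
  have hto : (jointDensity 𝒟 q n x).toReal =
      (𝒟.assign n (𝒟.sampleStrata x) (fun i => (x i).2.1)).toReal *
        ∏ i, q (x i).2.1 ((x i).1, (x i).2.2) := by
    rw [jointDensity, ENNReal.toReal_mul, ENNReal.toReal_prod]
    simp only [ENNReal.toReal_ofReal (hq _).le]
  have hprod : 0 < ∏ i, q (x i).2.1 ((x i).1, (x i).2.2) := Finset.prod_pos fun i _ => hq i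
  rw [ENNReal.log_pos_real' (by rw [hto]; exact mul_pos hα' hprod), hto,
    Real.log_mul hα'.ne' hprod.ne', Real.log_prod fun i _ => (hq i).ne']

/-- If all increments of the root likelihood ratio exceed `-1`, both likelihoods are positive and the
remainder is the real number given by the increments. -/
lemma remainder_eq {n : ℕ} {t : EuclideanSpace ℝ (Fin d)} {ω : Ω}
    (hα : 𝒟.assign n (𝒟.sampleStrata (sample W A n ω)) (A n ω) ≠ 0)
    (hq : ∀ i : Fin n, 0 < M.q (A n ω i) M.θ₀ (arm (A n ω i) (W i ω)))
    (hρ : ∀ i, |M.rootRatio (A n ω i) ((√(n : ℝ))⁻¹ • t) (arm (A n ω i) (W i ω))| < 1 / 2) :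
    M.remainder D n t (sample W A n ω) =
      ((∑ i, 2 * Real.log (1 + M.rootRatio (A n ω i) ((√(n : ℝ))⁻¹ • t)
        (arm (A n ω i) (W i ω))) -
      (inner ℝ t ((√(n : ℝ))⁻¹ • M.score D n (sample W A n ω)) -
        2⁻¹ * (t.ofLp ⬝ᵥ (M.information D *ᵥ t.ofLp))) : ℝ) : EReal) := by
  have hr : ∀ i : Fin n,
      1 + M.rootRatio (A n ω i) ((√(n : ℝ))⁻¹ • t) (arm (A n ω i) (W i ω)) =
      √(M.q (A n ω i) (M.θ₀ + (√(n : ℝ))⁻¹ • t) (arm (A n ω i) (W i ω))) /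
        √(M.q (A n ω i) M.θ₀ (arm (A n ω i) (W i ω))) := fun i => by
    rw [rootRatio, root_zero, root]
    ring
  have hqt : ∀ i : Fin n,
      0 < M.q (A n ω i) (M.θ₀ + (√(n : ℝ))⁻¹ • t) (arm (A n ω i) (W i ω)) := by
    intro i
    by_contra hneg
    have h1 := hr i
    rw [Real.sqrt_eq_zero_of_nonpos (not_lt.1 hneg), zero_div] at h1
    have h2 := (abs_lt.1 (hρ i)).1
    linarith
  have hlog : ∀ i : Fin n,
      2 * Real.log (1 + M.rootRatio (A n ω i) ((√(n : ℝ))⁻¹ • t) (arm (A n ω i) (W i ω))) =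
      Real.log (M.q (A n ω i) (M.θ₀ + (√(n : ℝ))⁻¹ • t) (arm (A n ω i) (W i ω))) -
        Real.log (M.q (A n ω i) M.θ₀ (arm (A n ω i) (W i ω))) := fun i => by
    rw [hr i, Real.log_div (Real.sqrt_pos.2 (hqt i)).ne' (Real.sqrt_pos.2 (hq i)).ne',
      Real.log_sqrt (hqt i).le, Real.log_sqrt (hq i).le]
    ring
  rw [remainder, logLikelihood, logLikelihood,
    log_jointDensity (q := fun a => M.q a (M.θ₀ + (√(n : ℝ))⁻¹ • t)) hα hqt,
    log_jointDensity (q := fun a => M.q a M.θ₀) hα hq,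
    ← EReal.coe_sub, ← EReal.coe_sub, EReal.coe_eq_coe_iff]
  simp only [hlog, Finset.sum_sub_distrib]
  congr 1
  exact add_sub_add_left_eq_sub _ _ _

variable [MeasurableSpace Ω] {Pr : Measure Ω}

lemma measurable_smul_score_sample (hX : IsExperiment 𝒟 Q₀ Pr W A) (hM : M.IsRegular D) (c : ℝ)
    (n : ℕ) : Measurable fun ω => c • M.score D n (sample W A n ω) := by
  simp only [score_sample]
  exact (Finset.measurable_sum _ fun i _ => hX.measurable_unit
    (f := fun a w => M.armScore D a (arm a w))
    (fun a => (measurable_armScore hM a).comp (measurable_arm a)) i).const_smul c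

/-- The score is asymptotically normal: the two arms have the same conditional mean scores given
the strata, so that the imbalance of the treatments does not contribute at the order `√n`. -/
lemma tendstoInDistribution_score [IsProbabilityMeasure Pr]
    (hX : IsExperiment 𝒟 Q₀ Pr W A) (hM : M.IsRegular D) :
    TendstoInDistribution
      (fun (n : ℕ) ω => (√(n : ℝ))⁻¹ • M.score D n (sample W A n ω)) atTop
      (id : EuclideanSpace ℝ (Fin d) → EuclideanSpace ℝ (Fin d))
      (fun _ => Pr) (multivariateGaussian 0 (M.information D)) where
  forall_aemeasurable n := (measurable_smul_score_sample hX hM _ n).aemeasurable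
  aemeasurable_limit := aemeasurable_id
  tendsto := by
    have := M.isProbabilityMeasure_truth
    refine ProbabilityMeasure.tendsto_iff_tendsto_charFun.2 fun t => ?_
    have hsm : ∀ a, Measurable fun w => (inner ℝ (M.armScore D a (arm a w)) t : ℝ) := fun a =>
      ((measurable_armScore hM a).comp (measurable_arm a)).inner_const
    have hL : ∀ a, MemLp (fun w => (inner ℝ (M.armScore D a (arm a w)) t : ℝ)) 2 Q₀ := fun a =>
      (memLp_armScore hM a).inner_const t
    have h := hX.tendsto_charFun_sum hsm hL
      (c := stratumMean 𝒟 Q₀ fun w => inner ℝ (M.armScore D true (arm true w)) t)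
      (fun a s => by
        rw [stratumMean_inner_armScore hM, stratumMean_inner_armScore hM,
          integral_root_smul_eq hM a true])
      (by rw [← integral_eq_sum_stratumMean ((hL true).integrable one_le_two),
        integral_inner_armScore hM])
    have hlim : charFun ((multivariateGaussian 0 (M.information D)).map
        (id : EuclideanSpace ℝ (Fin d) → EuclideanSpace ℝ (Fin d))) t =
        (Real.exp (-(t.ofLp ⬝ᵥ (M.information D *ᵥ t.ofLp)) / 2) : ℝ) := by
      rw [Measure.map_id, charFun_multivariateGaussian (posSemidef_information hM),
        inner_zero_right]
      push_cast
      congr 1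
      ring
    change Tendsto _ atTop (𝓝 (charFun ((multivariateGaussian 0 (M.information D)).map
        (id : EuclideanSpace ℝ (Fin d) → EuclideanSpace ℝ (Fin d))) t))
    rw [hlim, ← targetSum_inner_sq hM]
    refine h.congr fun n => ?_
    change _ = charFun (Pr.map fun ω => (√(n : ℝ))⁻¹ • M.score D n (sample W A n ω)) t
    rw [charFun_apply, integral_map (φ := fun ω => (√(n : ℝ))⁻¹ • M.score D n (sample W A n ω))
      (measurable_smul_score_sample hX hM _ n).aemeasurable (by fun_prop)]
    refine integral_congr_ae (Eventually.of_forall fun ω => ?_)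
    simp only [real_inner_smul_left, score_sample, sum_inner]

/-- Almost surely the realized assignment has positive probability under the design. -/
lemma ae_assign_ne_zero [IsProbabilityMeasure Pr] (hX : IsExperiment 𝒟 Q₀ Pr W A)
    (n : ℕ) :
    ∀ᵐ ω ∂Pr, 𝒟.assign n (𝒟.sampleStrata (sample W A n ω)) (A n ω) ≠ 0 := by
  have h : ∀ s a, ∀ᵐ ω ∂Pr, 𝒟.assign n s a = 0 → ω ∉ block 𝒟 W A n s a := by
    intro s a
    by_cases hα : 𝒟.assign n s a = 0
    · have hnull : Pr (block 𝒟 W A n s a) = 0 := by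
        by_cases h0 : Pr {ω | 𝒟.sampleStrata (sample W A n ω) = s} = 0
        · exact measure_mono_null (fun ω hω => hω.1) h0
        have hm : MeasurableSet {ω | 𝒟.sampleStrata (sample W A n ω) = s} :=
          hX.measurable_strata n (measurableSet_singleton s)
        have h1 := hX.adaptive n s a h0
        rw [hα, cond_apply hm, mul_eq_zero] at h1
        exact h1.resolve_left (ENNReal.inv_ne_zero.2 (measure_ne_top _ _))
      filter_upwards [measure_eq_zero_iff_ae_notMem.1 hnull] with ω hω _ using hω
    · exact Eventually.of_forall fun ω h => absurd h hα
  filter_upwards [ae_all_iff.2 fun s => ae_all_iff.2 (h s)] with ω hω h0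
  exact hω _ _ h0 ⟨rfl, rfl⟩

lemma ae_density_pos (hX : IsExperiment 𝒟 Q₀ Pr W A) (a : Bool) :
    ∀ᵐ ω ∂Pr, ∀ i, 0 < M.q a M.θ₀ (arm a (W i ω)) := by
  refine ae_all_iff.2 fun i => ?_
  exact ae_of_ae_map (hX.measurable_pop i).aemeasurable
    (p := fun w => 0 < M.q a M.θ₀ (arm a w)) ((hX.law i).symm ▸ M.truth.ae_pos a)

/-- The remainder vanishes in probability along bounded sequences of local parameters. -/
lemma tendsto_measure_lt_abs_remainder [IsProbabilityMeasure Pr]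
    (hX : IsExperiment 𝒟 Q₀ Pr W A) (hM : M.IsRegular D)
    {t : ℕ → EuclideanSpace ℝ (Fin d)} {C : ℝ} (ht : ∀ n, ‖t n‖ ≤ C)
    (hmem : ∀ n : ℕ, M.θ₀ + (√(n : ℝ))⁻¹ • t n ∈ M.Θ) {ε : ℝ} (hε : 0 < ε) :
    Tendsto (fun n => Pr {ω | ENNReal.ofReal ε <
      (M.remainder D n (t n) (sample W A n ω)).abs}) atTop (𝓝 0) := by
  obtain ⟨h1, h2⟩ := tendstoInMeasure_sum_log_rootRatio hX hM ht hmem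
  have h3 := (tendstoInMeasure_zero_iff.1 h1 ε hε).add h2
  rw [add_zero] at h3
  refine tendsto_of_tendsto_of_tendsto_of_le_of_le tendsto_const_nhds h3 (fun _ => zero_le)
    fun n => ?_
  -- the remainder can exceed `ε` only if the expansion fails or some increment is at least `1 / 2`
  refine le_trans (measure_mono_ae ?_) (measure_union_le _ _)
  filter_upwards [ae_assign_ne_zero hX n, ae_all_iff.2 (ae_density_pos (M := M) hX)]
    with ω hα hq hω
  by_contra hnot
  obtain ⟨hZ, hρ⟩ := not_or.1 (show ¬(ω ∈ _ ∨ ω ∈ _) from hnot)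
  have hω' : ENNReal.ofReal ε < (M.remainder D n (t n) (sample W A n ω)).abs := hω
  rw [remainder_eq hα (fun i => hq _ i) fun i => not_le.1 fun hi => hρ ⟨i, hi⟩,
    EReal.abs_def] at hω'
  exact hZ ((ENNReal.ofReal_lt_ofReal_iff_of_nonneg hε.le).1 hω').le

/-- A statement uniform over balls follows from the one for bounded sequences, by choosing nearly
least favorable local parameters. -/
lemma tendsto_iSup_measure_lt_abs_remainder [IsProbabilityMeasure Pr]
    (hX : IsExperiment 𝒟 Q₀ Pr W A) (hM : M.IsRegular D) {B : ℝ} (hB : 0 ≤ B)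
    {ε : ℝ} (hε : 0 < ε) :
    Tendsto (fun n : ℕ => ⨆ t ∈ Metric.closedBall (0 : EuclideanSpace ℝ (Fin d)) B,
      Pr {ω | ENNReal.ofReal ε < (M.remainder D n t (sample W A n ω)).abs}) atTop (𝓝 0) := by
  let F : ℕ → EuclideanSpace ℝ (Fin d) → ℝ≥0∞ := fun n t =>
    Pr {ω | ENNReal.ofReal ε < (M.remainder D n t (sample W A n ω)).abs}
  refine ENNReal.tendsto_nhds_zero.2 fun η hη => ?_
  -- a parameter in the ball at which the probability exceeds `η`, if there is one
  have hex : ∀ n : ℕ, ∃ t : EuclideanSpace ℝ (Fin d), ‖t‖ ≤ B ∧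
      M.θ₀ + (√(n : ℝ))⁻¹ • t ∈ M.Θ ∧
      ((∃ t', ‖t'‖ ≤ B ∧ M.θ₀ + (√(n : ℝ))⁻¹ • t' ∈ M.Θ ∧ η < F n t') → η < F n t) := by
    intro n
    by_cases h : ∃ t', ‖t'‖ ≤ B ∧ M.θ₀ + (√(n : ℝ))⁻¹ • t' ∈ M.Θ ∧ η < F n t'
    · obtain ⟨t, h1, h2, h3⟩ := h
      exact ⟨t, h1, h2, fun _ => h3⟩
    · exact ⟨0, by simpa using hB, by simpa using M.θ₀_mem, fun h' => absurd h' h⟩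
  choose t ht hmem hF using hex
  have hball : ∀ᶠ n : ℕ in atTop, ∀ u : EuclideanSpace ℝ (Fin d), ‖u‖ ≤ B →
      M.θ₀ + (√(n : ℝ))⁻¹ • u ∈ M.Θ := by
    obtain ⟨δ, hδ, hsub⟩ := Metric.eventually_nhds_iff.1 (eventually_mem hM)
    have hlim : Tendsto (fun n : ℕ => (√(n : ℝ))⁻¹ * B) atTop (𝓝 0) := by
      simpa using (tendsto_inv_atTop_zero.comp
        (Real.tendsto_sqrt_atTop.comp tendsto_natCast_atTop_atTop)).mul_const B
    filter_upwards [hlim.eventually_lt_const hδ] with n hn u hu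
    refine hsub ?_
    rw [dist_zero_right, norm_smul, Real.norm_of_nonneg (by positivity)]
    exact (mul_le_mul_of_nonneg_left hu (by positivity)).trans_lt hn
  filter_upwards [hball, ENNReal.tendsto_nhds_zero.1
    (tendsto_measure_lt_abs_remainder hX hM ht hmem hε) η hη] with n hn hle
  refine iSup₂_le fun u hu => ?_
  by_contra hlt
  have hu' : ‖u‖ ≤ B := mem_closedBall_zero_iff.1 hu
  exact absurd (hF n ⟨u, hu', hn u hu', not_le.1 hlt⟩) (not_lt.2 hle)

end Experiment

end ParametricSubmodel
end CAR

theorem mainTheorem4 {k d : ℕ} (𝒟 : CAR.Design k)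
    (μ : Bool → Measure ℝ) [∀ a, SigmaFinite (μ a)]
    (μZ : Measure (Fin k → ℝ)) [SigmaFinite μZ]
    (Q₀ : Measure (CAR.Pop k))
    {Ω : Type*} [MeasurableSpace Ω] (Pr : Measure Ω) [IsProbabilityMeasure Pr]
    (W : ℕ → Ω → CAR.Pop k) (A : (n : ℕ) → Ω → Fin n → Bool)
    (hX : CAR.IsExperiment 𝒟 Q₀ Pr W A)
    (M : CAR.ParametricSubmodel 𝒟 μ μZ Q₀ d)
    (D : Bool → ℝ × (Fin k → ℝ) → EuclideanSpace ℝ (Fin d))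
    (hM : M.IsRegular D) :
    ((M.information D).PosSemidef ∧
      ∀ i j, M.information D i j =
        ∫ x, M.obsScore D x i * M.obsScore D x j ∂(𝒟.targetLaw Q₀)) ∧
    TendstoInDistribution
      (fun (n : ℕ) ω => (√(n : ℝ))⁻¹ • M.score D n (CAR.sample W A n ω)) atTop
      (id : EuclideanSpace ℝ (Fin d) → EuclideanSpace ℝ (Fin d))
      (fun _ => Pr) (multivariateGaussian 0 (M.information D)) ∧
    ∀ B > (0 : ℝ), ∀ ε > (0 : ℝ),
      Tendsto
        (fun n : ℕ => ⨆ t ∈ Metric.closedBall (0 : EuclideanSpace ℝ (Fin d)) B,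
          Pr {ω | ENNReal.ofReal ε < (M.remainder D n t (CAR.sample W A n ω)).abs})
        atTop (𝓝 0) := by
  exact ⟨⟨CAR.ParametricSubmodel.posSemidef_information hM,
      CAR.ParametricSubmodel.information_apply_eq_integral hM⟩,
    CAR.ParametricSubmodel.tendstoInDistribution_score hX hM, fun _ hB _ hε =>
      CAR.ParametricSubmodel.tendsto_iSup_measure_lt_abs_remainder hX hM hB.le hε⟩
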